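/- Work over $\mathbb{C}$, with coordinates $x_0,\dots,x_3$ on $\mathbb{P}^3$. Let $W$ be the space of quadratic forms in $x_0,\dots,x_3$. A pencil of quadrics is a point $\Phi(f,g)=\langle f,g\rangle$ of $\mathrm{Gr}(2,W)$, with $f,g\in W$ linearly independent. Let $\mathrm{SL}_4(\mathbb{C})$ act by $(A\cdot f)(x)=f(Ax)$, and linearise by the Plücker embedding: $\Phi(f,g)$ is semistable if $0\notin\overline{\mathrm{SL}_4\cdot(f\wedge g)}\subset\bigwedge^2W$, polystable if the orbit $\mathrm{SL}_4\cdot(f\wedge g)$ is closed in $\bigwedge^2 W$, and stable if moreover the stabiliser of $f\wedge g$ is finite; strictly semistable (strictly polystable) means semistable (polystable) and not stable. The base locus $\mathrm{Bs}(f,g)=\{f=g=0\}\subset\mathbb{P}^3$ is singular at one of its points if the Jacobian matrix of $(f,g)$ has rank $<2$ there. A singular point $p$ is an $\mathbf{A}_1$ singularity (ordinary double point) if the pencil is generated by forms $h,k$ such that $\{k=0\}$ is smooth at $p$ and $h|_{\{k=0\}}$ has a nondegenerate critical point at $p$. Two pencils are projectively equivalent if some element of $\mathrm{SL}_4(\mathbb{C})$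 carries one to the other. Consider the following families of pairs $(f,g)$, in which the $l_i$ run over all linear forms and the $q_i$ over all quadratic forms in the indicated variables: * Family 1: $f=x_3l_1(x_0,x_1,x_2,x_3)+x_2l_2(x_0,x_1,x_2)+x_1l_3(x_0,x_1)$, $\ g=q_1(x_1,x_2,x_3)$; * Family 2: $f=q_2(x_0,x_1,x_2,x_3)$, $\ g=q_3(x_2,x_3)$; * Family 3: $f=x_3l_4(x_0,x_1,x_2,x_3)+x_2l_5(x_0,x_1,x_2)$, $\ g=x_3l_6(x_0,x_1,x_2,x_3)+x_2l_7(x_0,x_1,x_2)$; * Family 4: $f=x_3l_8(x_0,x_1,x_2,x_3)+q_4(x_1,x_2)$, $\ g=x_3l_9(x_0,x_1,x_2,x_3)+q_5(x_1,x_2)$. Then the following hold. (a) For a pencil $\Phi(f,g)$ of quadrics in $\mathbb{P}^3$ the following are equivalent: (1) $\Phi(f,g)$ is not stable; (2) $\mathrm{Bs}(f,g)$ is singular; (3) up to an element of $\mathrm{SL}_4(\mathbb{C})$, the pencil is generated by a member of one of Families 1–4 (arbitrary, possibly special, coefficients being allowed). (b) The general member $(f,g)$ of each of the four families (that is, every member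 outside the zero locus of some polynomial in the coefficients that does not vanish identically on the family) generates a strictly semistable pencil, and * in Family 1, $f$ is an irreducible smooth quadric, $g$ is an irreducible singular quadric, and $\mathrm{Bs}(f,g)$ is an irreducible nodal curve whose only singular point is an $\mathbf{A}_1$ singularity at $(1:0:0:0)$; * in Family 2, $f$ is an irreducible smooth quadric, $g$ is a pair of distinct planes, each of which $f$ meets in a smooth conic, and, after a change of coordinates under which the pair stays in the family, the singular points of $\mathrm{Bs}(f,g)$ are exactly $(1:i:0:0)$ and $(1:-i:0:0)$, both $\mathbf{A}_1$; * in Family 3, $f$ and $g$ are irreducible smooth quadrics, $\mathrm{Bs}(f,g)$ is the union of a twisted cubic and a bisecant line (meeting it in two distinct points), and, after a change of coordinates under which the pair stays in the family, the singular points of $\mathrm{Bs}(f,g)$ are exactly $(1:0:0:0)$ and $(0:1:0:0)$, both $\mathbf{A}_1$; * in Family 4, $f$ and $g$ are irreducible smooth quadrics, and $\mathrm{Bs}(f,g)$ is an irreducible nodal curve whose only singular point is an $\mathbf{A}_1$ singularity at $(1:0:0:0)$. (c) Families 1 and 4 are projectively equivalent: a pencil is projectively equivalent to one generated by a member of Family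 1 if and only if it is projectively equivalent to one generated by a member of Family 4. (d) A pencil $\Phi(f,g)$ is stable if and only if $\mathrm{Bs}(f,g)$ is smooth. (e) A pencil is strictly polystable if and only if, up to an element of $\mathrm{SL}_4(\mathbb{C})$, it is generated by $q(x_0,x_1)$ and $q'(x_2,x_3)$ with $q,q'$ nondegenerate binary quadratic forms (which are reducible singular quadrics in $\mathbb{P}^3$). Any two strictly polystable pencils are projectively equivalent, and the base locus of a strictly polystable pencil is a quadrangle, that is, the union of the four lines joining cyclically consecutive ones of four non-coplanar points; its singular points are exactly these four points, all of them $\mathbf{A}_1$ singularities. -/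

import Mathlib

open scoped MatrixGroups

noncomputable section

namespace QuadricPencil

/-- The vector space `ℂ⁴` with coordinates `x 0, x 1, x 2, x 3`; `ℙ³` is its space of lines. -/
abbrev Vec := Fin 4 → ℂ

/-- Quadratic forms in `x₀, x₁, x₂, x₃`. -/
abbrev Quadric := QuadraticForm ℂ Vec

/-- `f` and `g` generate a pencil: they span a two-dimensional space of quadratic forms,
that is, a point of the Grassmannian `Gr(2, 10)`. -/
def IsPencil (f g : Quadric) : Prop := LinearIndependent ℂ ![f, g]

/-! ### GIT stability of pencils -/

/-- The action of `A ∈ SL(4, ℂ)` on quadratic forms, `(A · f)(x) = f (A x)`. -/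
def act (A : SL(4, ℂ)) : Quadric →ₗ[ℂ] Quadric where
  toFun f := f.comp (Matrix.toLin' (A : Matrix (Fin 4) (Fin 4) ℂ))
  map_add' f g := by ext x; simp
  map_smul' c f := by ext x; simp

/-- The induced action on `⋀² W`, where `W` is the space of quadratic forms. -/
def actWedge (A : SL(4, ℂ)) : ⋀[ℂ]^2 Quadric →ₗ[ℂ] ⋀[ℂ]^2 Quadric :=
  exteriorPower.map 2 (act A)

/-- The lift `f ∧ g ∈ ⋀² W` of the Pluecker point of the pencil. -/
def wedge (f g : Quadric) : ⋀[ℂ]^2 Quadric := exteriorPower.ιMulti ℂ 2 ![f, g]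

/-- The usual topology of the finite-dimensional complex vector space `⋀² W`. -/
instance wedgeTopology : TopologicalSpace (⋀[ℂ]^2 Quadric) :=
  moduleTopology ℂ (⋀[ℂ]^2 Quadric)

instance wedgeIsModuleTopology : IsModuleTopology ℂ (⋀[ℂ]^2 Quadric) := ⟨rfl⟩

/-- The `SL(4, ℂ)`-orbit of a vector of `⋀² W`. -/
def orbit (w : ⋀[ℂ]^2 Quadric) : Set (⋀[ℂ]^2 Quadric) := Set.range fun A => actWedge A w

/-- The stabiliser in `SL(4, ℂ)` of a vector of `⋀² W`. -/
def stabilizer (w : ⋀[ℂ]^2 Quadric) : Set SL(4, ℂ) := {A | actWedge A w = w}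

/-- GIT semistability (with respect to the Pluecker linearisation): the closure of the orbit of
a lift does not contain the origin. -/
def IsSemistable (f g : Quadric) : Prop := 0 ∉ closure (orbit (wedge f g))

/-- GIT polystability: the orbit of a (nonzero) lift is closed. -/
def IsPolystable (f g : Quadric) : Prop := wedge f g ≠ 0 ∧ IsClosed (orbit (wedge f g))

/-- GIT stability: the orbit of a lift is closed and its stabiliser is finite. -/
def IsStable (f g : Quadric) : Prop :=
  IsPolystable f g ∧ (stabilizer (wedge f g)).Finite

/-- Strict semistability: semistable and not stable. -/
def IsStrictlySemistable (f g : Quadric) : Prop := IsSemistable f g ∧ ¬ IsStable f g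

/-- Strict polystability: polystable and not stable. -/
def IsStrictlyPolystable (f g : Quadric) : Prop := IsPolystable f g ∧ ¬ IsStable f g

/-- The pencils generated by `f, g` and by `f', g'` are projectively equivalent. -/
def ProjEquiv (f g f' g' : Quadric) : Prop :=
  ∃ A : SL(4, ℂ), Submodule.span ℂ {act A f, act A g} = Submodule.span ℂ {f', g'}

/-! ### Geometry of quadrics and of base loci -/

/-- The quadric `f = 0` in `ℙ³` is smooth. (The differential of `f` at `p` is
`v ↦ polar f p v = f (p + v) - f p - f v`.) -/
def IsSmoothQuadric (f : Quadric) : Prop :=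
  ∀ p : Vec, p ≠ 0 → f p = 0 → f.polarBilin p ≠ 0

/-- `f` is a product of two linear forms. -/
def IsReducibleQuadric (f : Quadric) : Prop :=
  ∃ l m : Module.Dual ℂ Vec, ∀ x, f x = l x * m x

/-- The affine cone over the base locus `f = g = 0` in `ℙ³`. -/
def baseLocus (f g : Quadric) : Set Vec := {p | f p = 0 ∧ g p = 0}

/-- `[p]` is a singular point of the complete intersection `f = g = 0`: it lies on it and the
Jacobian matrix of `(f, g)` at `p` has rank less than two. -/
def IsSingularPoint (f g : Quadric) (p : Vec) : Prop :=
  p ≠ 0 ∧ p ∈ baseLocus f g ∧ ¬ LinearIndependent ℂ ![f.polarBilin p, g.polarBilin p]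

/-- The base locus of the pencil is singular. -/
def HasSingularBaseLocus (f g : Quadric) : Prop := ∃ p, IsSingularPoint f g p

/-- The base locus of the pencil is smooth. -/
def HasSmoothBaseLocus (f g : Quadric) : Prop := ¬ HasSingularBaseLocus f g

/-- `[p]` is an `A₁` singularity (ordinary double point) of `f = g = 0`: the pencil is generated
by some `h, k` such that the surface `k = 0` is smooth at `[p]` and the restriction of `h` to this
surface has a nondegenerate critical point at `[p]`. After changing `h` by a multiple of `k` its
differential at `p` vanishes, and its Hessian on the tangent plane
`{v | dk_p(v) = 0} / ℂ p` is `(v, w) ↦ polar h v w`. -/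
def IsA1Point (f g : Quadric) (p : Vec) : Prop :=
  p ≠ 0 ∧ p ∈ baseLocus f g ∧
  ∃ h k : Quadric, Submodule.span ℂ {h, k} = Submodule.span ℂ {f, g} ∧
    h.polarBilin p = 0 ∧ k.polarBilin p ≠ 0 ∧
    ∀ v : Vec, k.polarBilin p v = 0 →
      (∀ w : Vec, k.polarBilin p w = 0 → h.polarBilin v w = 0) → v ∈ Submodule.span ℂ {p}

/-- The singular points of the base locus are exactly the points `[u]`, `u ∈ P`, and all of them
are `A₁` singularities. -/
def SingularExactlyA1At (f g : Quadric) (P : Set Vec) : Prop :=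
  (∀ u ∈ P, IsA1Point f g u) ∧
  ∀ p, IsSingularPoint f g p → ∃ u ∈ P, p ∈ Submodule.span ℂ {u}

/-- The base locus is irreducible. -/
def HasIrreducibleBaseLocus (f g : Quadric) : Prop :=
  (MvPolynomial.vanishingIdeal ℂ (baseLocus f g)).IsPrime

/-- The base locus is an irreducible curve with exactly one singular point, namely a node
at `[u]`. -/
def IsNodalCurveAt (f g : Quadric) (u : Vec) : Prop :=
  HasIrreducibleBaseLocus f g ∧ SingularExactlyA1At f g {u}

/-- `f` cuts out a smooth conic on the plane `l = 0`. -/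
def CutsSmoothConic (f : Quadric) (l : Module.Dual ℂ Vec) : Prop :=
  ∀ v, l v = 0 → (∀ w, l w = 0 → f.polarBilin v w = 0) → v = 0

/-- `g` is a pair of distinct planes and `f` cuts out a smooth conic on each of them. -/
def IsPairOfConics (f g : Quadric) : Prop :=
  ∃ l m : Module.Dual ℂ Vec, LinearIndependent ℂ ![l, m] ∧ (∀ x, g x = l x * m x) ∧
    CutsSmoothConic f l ∧ CutsSmoothConic f m

/-- The standard basis vector `e i`, representing a coordinate point of `ℙ³`. -/
def e (i : Fin 4) : Vec := Pi.single i 1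

/-- The affine cone over the standard twisted cubic. -/
def twistedCubic : Set Vec :=
  Set.range fun s : ℂ × ℂ => ![s.1 ^ 3, s.1 ^ 2 * s.2, s.1 * s.2 ^ 2, s.2 ^ 3]

/-- The base locus is the union of a twisted cubic and of a line joining two distinct points
of it: in suitable coordinates the twisted cubic is the standard one and the two points are
the images of `(1 : 0)` and `(0 : 1)`. -/
def IsTwistedCubicWithBisecant (f g : Quadric) : Prop :=
  ∃ B : SL(4, ℂ), baseLocus f g = (Matrix.toLin' (B : Matrix (Fin 4) (Fin 4) ℂ)) ''
    (twistedCubic ∪ (Submodule.span ℂ {e 0, e 3} : Set Vec))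

/-- The affine cone `S` is a quadrangle with vertices `[b 0], [b 1], [b 2], [b 3]`: the vertices
are not coplanar and `S` is the union of the four lines joining cyclically consecutive vertices. -/
def IsQuadrangle (S : Set Vec) (b : Fin 4 → Vec) : Prop :=
  LinearIndependent ℂ b ∧ S = ⋃ i : Fin 4, (Submodule.span ℂ {b i, b (i + 1)} : Set Vec)

/-! ### The families -/

/-- The members of Family 1, with arbitrary coefficients. -/
def Family1 (f g : Quadric) : Prop :=
  ∃ (l₁ : Module.Dual ℂ (Fin 4 → ℂ)) (l₂ : Module.Dual ℂ (Fin 3 → ℂ))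
    (l₃ : Module.Dual ℂ (Fin 2 → ℂ)) (q₁ : QuadraticForm ℂ (Fin 3 → ℂ)),
    (∀ x, f x = x 3 * l₁ ![x 0, x 1, x 2, x 3] + x 2 * l₂ ![x 0, x 1, x 2]
      + x 1 * l₃ ![x 0, x 1]) ∧
    (∀ x, g x = q₁ ![x 1, x 2, x 3])

/-- The members of Family 2, with arbitrary coefficients. -/
def Family2 (f g : Quadric) : Prop :=
  ∃ (q₂ : QuadraticForm ℂ (Fin 4 → ℂ)) (q₃ : QuadraticForm ℂ (Fin 2 → ℂ)),
    (∀ x, f x = q₂ ![x 0, x 1, x 2, x 3]) ∧ (∀ x, g x = q₃ ![x 2, x 3])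

/-- The members of Family 3, with arbitrary coefficients. -/
def Family3 (f g : Quadric) : Prop :=
  ∃ (l₄ l₆ : Module.Dual ℂ (Fin 4 → ℂ)) (l₅ l₇ : Module.Dual ℂ (Fin 3 → ℂ)),
    (∀ x, f x = x 3 * l₄ ![x 0, x 1, x 2, x 3] + x 2 * l₅ ![x 0, x 1, x 2]) ∧
    (∀ x, g x = x 3 * l₆ ![x 0, x 1, x 2, x 3] + x 2 * l₇ ![x 0, x 1, x 2])

/-- The members of Family 4, with arbitrary coefficients. -/
def Family4 (f g : Quadric) : Prop :=
  ∃ (l₈ l₉ : Module.Dual ℂ (Fin 4 → ℂ)) (q₄ q₅ : QuadraticForm ℂ (Fin 2 → ℂ)),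
    (∀ x, f x = x 3 * l₈ ![x 0, x 1, x 2, x 3] + q₄ ![x 1, x 2]) ∧
    (∀ x, g x = x 3 * l₉ ![x 0, x 1, x 2, x 3] + q₅ ![x 1, x 2])

/-- A binary quadratic form which is nondegenerate. -/
def IsNondegenerateBinary (q : QuadraticForm ℂ (Fin 2 → ℂ)) : Prop :=
  ∀ v, (∀ w, q.polarBilin v w = 0) → v = 0

/-- The pairs `q(x₀, x₁), q'(x₂, x₃)` with `q, q'` nondegenerate. -/
def PolystableFamily (f g : Quadric) : Prop :=
  ∃ q₂ q₃ : QuadraticForm ℂ (Fin 2 → ℂ), IsNondegenerateBinary q₂ ∧ IsNondegenerateBinary q₃ ∧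
    (∀ x, f x = q₂ ![x 0, x 1]) ∧ (∀ x, g x = q₃ ![x 2, x 3])

/-- Up to a change of coordinates, the pencil of `f, g` is generated by a member of the
family `F`. -/
def GeneratedBy (F : Quadric → Quadric → Prop) (f g : Quadric) : Prop :=
  ∃ f' g', F f' g' ∧ ProjEquiv f g f' g'

/-- The coefficients of a pair of quadratic forms: `(k, i, j)` is sent to the coefficient of
`x i * x j` in the `k`-th form (to twice this coefficient if `i = j`). -/
def coeffs (f g : Quadric) (c : Fin 2 × Fin 4 × Fin 4) : ℂ :=
  QuadraticMap.polarBilin (![f, g] c.1) (e c.2.1) (e c.2.2)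

/-- `P` holds for the general member of the family `F`: there is a polynomial in the
coefficients, not vanishing identically on `F`, such that `P` holds wherever it does not vanish.
(Each of the four families is a vector space, hence irreducible, so this means that `P` holds on
a dense Zariski open subset.) -/
def HoldsForGeneralMember (F P : Quadric → Quadric → Prop) : Prop :=
  ∃ D : MvPolynomial (Fin 2 × Fin 4 × Fin 4) ℂ,
    (∃ f g, F f g ∧ MvPolynomial.eval (coeffs f g) D ≠ 0) ∧
    ∀ f g, F f g → MvPolynomial.eval (coeffs f g) D ≠ 0 → P f g

end QuadricPencil

end

open scoped MatrixGroups
open QuadricPencil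

/-!
A pencil `⟨f, g⟩` is handled through the Gram matrices `F, G` of its generators; its Plücker
coordinates are the `2 × 2` minors of the pair of coefficient vectors. An orbit in `⋀² W` is closed
as soon as its bounded parts are swept out by bounded sets of matrices
(`isClosed_orbit_of_proper`), and a pencil with bounded Plücker coordinates has bounded generators
(`exists_small_generators`).

*Smooth base locus implies stable* (`isStable_of_smooth`). If the base locus is smooth, then
`det (x F + y G)` does not vanish identically, and an isotropic eigenvector of `F⁻¹ G` would be a
singular point. So the pencil can be diagonalised to `∑ xᵢ²`, `∑ aᵢ xᵢ²` with distinct `aᵢ`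
(`exists_diagForm_of_smooth`). For a translate by `A` with bounded Plücker coordinates, the roots
of the determinant being distinct, `Aᵀ A` and `Aᵀ D A` with `D = diag(aᵢ)` are bounded, hence so are
all `Aᵀ Dᵏ A` and, by interpolation, `A` (`isClosed_orbit_diagForm`). The stabiliser permutes the
four singular members of the pencil and is therefore finite (`finite_stabilizer_diagForm`).

*Singular base locus implies not stable* (`not_isStable_of_singular`). With a singular point
moved to `(1 : 0 : 0 : 0)` and the common tangent plane to `x₃ = 0`, the pencil lies in Family 4.
It degenerates along the one-parameter subgroup with weights `(-1, 0, 0, 1)` to a pencil which this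
subgroup stabilises. Using the member which is singular at the point as a generator, the pencil
also lies in Family 1. As all members of the four families have singular base locus, the three
conditions are equivalent, and so are Families 1 and 4 (`tfae_not_isStable`).

*Strictly polystable pencils* (`isStrictlyPolystable_iff`). The degeneration of a polystable pencil
is equivalent to the pencil itself, and further one-parameter subgroups bring it to
`⟨x₀ x₃, q(x₁, x₂)⟩` with `q` nondegenerate, that is, to `⟨x₀ x₁, x₂ x₃⟩`. The orbit of the latter
is closed (`isPolystable_quadrangle`): the products of the pairs of linear forms are bounded, and
the torus in the stabiliser balances their factors.

*General members.* If the invariant `12 a e - 3 b d + c²` of the binary quartic `det (x F + y G)` is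
nonzero, the pencil is semistable, since the invariant is constant along the orbit and tends to zero
with the Plücker coordinates (`isSemistable_of_quarticInvariant_ne_zero`). The geometry is read off
from normal forms, valid outside the zero locus of an explicit polynomial. Family 1 is reduced to
`⟨x₀ x₃ + (x₁² + x₂²) / 2, x₁ x₂ + x₃² / 2⟩` (`exists_node`), whose base locus is parametrised by
quartic forms and hence irreducible; the pencils in Family 4 contain a cone with vertex at the node
and are reduced to Family 1. In Family 2, `f` becomes `c (x₀² + x₁²) / 2` plus a binary form in
`x₂, x₃` (`exists_family2NormalForm`). In Family 3, the zeros of the Jacobian determinant with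
respect to `x₀, x₁` provide coordinates in which the pencil is `⟨x₀ x₃ + x₂² / 2, x₁ x₂ + x₃² / 2⟩`
(`projEquiv_cubic`), whose base locus is a twisted cubic together with the line `x₂ = x₃ = 0`.
-/

open scoped MatrixGroups
open QuadricPencil

namespace QuadricPencil

/-! ### Gram matrices -/

/-- The Gram matrix of the polar form of a quadratic form in the standard basis, that is, its
Hessian: the diagonal entries are twice the coefficients of the squares. -/
noncomputable def gram : Quadric →ₗ[ℂ] Matrix (Fin 4) (Fin 4) ℂ where
  toFun f := Matrix.of fun i j => f.polarBilin (e i) (e j)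
  map_add' f g := by ext i j; simp [QuadraticMap.polar_add]
  map_smul' c f := by ext i j; simp [QuadraticMap.polar_smul]

lemma gram_apply (f : Quadric) (i j : Fin 4) : gram f i j = f.polarBilin (e i) (e j) := rfl

lemma sum_smul_e (v : Vec) : v = ∑ i, v i • e i := by
  simpa [e] using (pi_eq_sum_univ' v)

lemma polarBilin_eq_sum (f : Quadric) (v w : Vec) :
    f.polarBilin v w = ∑ i, ∑ j, v i * w j * gram f i j := by
  conv_lhs => rw [sum_smul_e v, sum_smul_e w]
  simp only [map_sum, LinearMap.sum_apply, map_smul, LinearMap.smul_apply, gram_apply,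
    smul_eq_mul, Finset.mul_sum]
  rw [Finset.sum_comm]
  refine Finset.sum_congr rfl fun i _ => Finset.sum_congr rfl fun j _ => by ring

lemma polarBilin_eq (f : Quadric) (v w : Vec) :
    f.polarBilin v w = v ⬝ᵥ (gram f).mulVec w := by
  rw [polarBilin_eq_sum]
  simp only [dotProduct, Matrix.mulVec, Finset.mul_sum]
  refine Finset.sum_congr rfl fun i _ => Finset.sum_congr rfl fun j _ => by ring

lemma polarBilin_self (f : Quadric) (v : Vec) : f.polarBilin v v = 2 * f v := by
  simp [QuadraticMap.polar_self]

lemma polarBilin_comm (f : Quadric) (v w : Vec) : f.polarBilin v w = f.polarBilin w v := by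
  simp [QuadraticMap.polar_comm]

lemma gram_comm (f : Quadric) (i j : Fin 4) : gram f i j = gram f j i := by
  rw [gram_apply, gram_apply, polarBilin_comm]

lemma apply_eq_sum (f : Quadric) (v : Vec) :
    f v = (∑ i, ∑ j, v i * v j * gram f i j) / 2 := by
  rw [← polarBilin_eq_sum, polarBilin_self]; ring

lemma apply_eq_zero_iff (f : Quadric) (v : Vec) : f v = 0 ↔ f.polarBilin v v = 0 := by
  rw [polarBilin_self]; simp

lemma gram_injective : Function.Injective gram := by
  intro f g h
  ext v
  rw [apply_eq_sum, apply_eq_sum, h]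

lemma polarBilin_add_smul (f g : Quadric) (a b : ℂ) :
    (a • f + b • g).polarBilin = a • f.polarBilin + b • g.polarBilin := by
  ext v w
  simp [QuadraticMap.polar_add, QuadraticMap.polar_smul]

lemma polarBilin_apply_eq_zero_iff (f : Quadric) (v : Vec) :
    f.polarBilin v = 0 ↔ (gram f).mulVec v = 0 := by
  constructor
  · intro h
    ext i
    have := LinearMap.congr_fun h (e i)
    rw [polarBilin_comm, polarBilin_eq] at this
    simpa [e] using this
  · intro h
    refine LinearMap.ext fun w => ?_
    rw [polarBilin_comm, polarBilin_eq, h]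
    simp

lemma act_apply (A : SL(4, ℂ)) (f : Quadric) (v : Vec) :
    act A f v = f ((A : Matrix (Fin 4) (Fin 4) ℂ).mulVec v) := rfl

lemma act_polarBilin (A : SL(4, ℂ)) (f : Quadric) (v w : Vec) :
    (act A f).polarBilin v w = f.polarBilin ((A : Matrix (Fin 4) (Fin 4) ℂ).mulVec v)
      ((A : Matrix (Fin 4) (Fin 4) ℂ).mulVec w) := by
  simp [QuadraticMap.polar, act_apply, Matrix.mulVec_add]

lemma gram_act (A : SL(4, ℂ)) (f : Quadric) :
    gram (act A f) = (A : Matrix (Fin 4) (Fin 4) ℂ).transpose * gram f * A := by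
  ext i j
  rw [gram_apply, act_polarBilin, polarBilin_eq]
  simp only [e, Matrix.mulVec_single, MulOpposite.op_one, one_smul]
  rw [Matrix.mul_assoc, Matrix.mul_apply]
  rfl

lemma act_act (A B : SL(4, ℂ)) (f : Quadric) : act A (act B f) = act (B * A) f := by
  ext v; simp [act_apply, Matrix.mulVec_mulVec]

lemma act_one (f : Quadric) : act 1 f = f := by
  ext v; simp [act_apply]

lemma act_inv_act (A : SL(4, ℂ)) (f : Quadric) : act A⁻¹ (act A f) = f := by
  rw [act_act, mul_inv_cancel, act_one]

lemma act_act_inv (A : SL(4, ℂ)) (f : Quadric) : act A (act A⁻¹ f) = f := by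
  rw [act_act, inv_mul_cancel, act_one]

/-- The quadratic form `x ↦ xᵀ N x`. -/
noncomputable def quad : Matrix (Fin 4) (Fin 4) ℂ →ₗ[ℂ] Quadric where
  toFun N := N.toQuadraticForm'
  map_add' M N := by ext v; simp [Matrix.toQuadraticForm']
  map_smul' c N := by ext v; simp [Matrix.toQuadraticForm']

lemma quad_apply (N : Matrix (Fin 4) (Fin 4) ℂ) (v : Vec) :
    quad N v = ∑ i, ∑ j, v i * v j * N i j := by
  simp only [quad, LinearMap.coe_mk, AddHom.coe_mk, Matrix.toQuadraticForm',
    LinearMap.BilinMap.toQuadraticMap_apply, Matrix.toLinearMap₂'_apply, smul_eq_mul]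
  simp [mul_assoc]

lemma quad_gram (f : Quadric) : quad ((1 / 2 : ℂ) • gram f) = f := by
  ext v
  rw [quad_apply, apply_eq_sum]
  simp only [Matrix.smul_apply, smul_eq_mul, Finset.sum_div]
  refine Finset.sum_congr rfl fun i _ => Finset.sum_congr rfl fun j _ => by ring

lemma polarBilin_quad (N : Matrix (Fin 4) (Fin 4) ℂ) (v w : Vec) :
    (quad N).polarBilin v w = ∑ i, ∑ j, v i * w j * (N i j + N j i) := by
  have h : ∑ i, ∑ j, v i * w j * N j i = ∑ i, ∑ j, w i * v j * N i j := by
    rw [Finset.sum_comm]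
    refine Finset.sum_congr rfl fun i _ => Finset.sum_congr rfl fun j _ => by ring
  simp only [QuadraticMap.polarBilin_apply_apply, QuadraticMap.polar, quad_apply, mul_add,
    Finset.sum_add_distrib, h, Pi.add_apply, add_mul]
  ring

lemma gram_quad (N : Matrix (Fin 4) (Fin 4) ℂ) : gram (quad N) = N + N.transpose := by
  ext i j
  rw [gram_apply, polarBilin_quad]
  simp [e, Pi.single_apply]

/-! ### Pencils and their changes of generators -/

lemma isPencil_iff (f g : Quadric) : IsPencil f g ↔ ∀ a b : ℂ, a • f + b • g = 0 → a = 0 ∧ b = 0 :=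
  LinearIndependent.pair_iff

lemma update_pair_zero {α : Type*} (a b c : α) : Function.update ![a, b] 0 c = ![c, b] := by
  ext i
  fin_cases i <;> rfl

lemma wedge_add_left (f f' g : Quadric) : wedge (f + f') g = wedge f g + wedge f' g := by
  simpa only [wedge, update_pair_zero] using
    (exteriorPower.ιMulti ℂ 2).map_update_add ![f, g] 0 f f'

lemma wedge_smul_left (c : ℂ) (f g : Quadric) : wedge (c • f) g = c • wedge f g := by
  simpa only [wedge, update_pair_zero] using
    (exteriorPower.ιMulti ℂ 2).map_update_smul ![f, g] 0 c f

lemma wedge_self (f : Quadric) : wedge f f = 0 :=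
  (exteriorPower.ιMulti ℂ 2).map_eq_zero_of_eq ![f, f] (i := 0) (j := 1) rfl (by decide)

lemma wedge_swap (f g : Quadric) : wedge g f = - wedge f g := by
  have h := (exteriorPower.ιMulti ℂ 2 (M := Quadric)).map_swap ![f, g] (i := 0) (j := 1)
    (by decide)
  rw [wedge, wedge, ← h]
  congr 1
  ext i : 1
  fin_cases i <;> simp

lemma wedge_add_right (f g g' : Quadric) : wedge f (g + g') = wedge f g + wedge f g' := by
  rw [wedge_swap, wedge_add_left, wedge_swap f g, wedge_swap f g']; abel

lemma wedge_smul_right (c : ℂ) (f g : Quadric) : wedge f (c • g) = c • wedge f g := by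
  rw [wedge_swap, wedge_smul_left, wedge_swap f g]; simp

lemma wedge_combination (f g : Quadric) (a b c d : ℂ) :
    wedge (a • f + b • g) (c • f + d • g) = (a * d - b * c) • wedge f g := by
  simp only [wedge_add_left, wedge_add_right, wedge_smul_left, wedge_smul_right, wedge_self,
    wedge_swap f g, smul_zero, zero_add, add_zero]
  module

/-- The linear functional on `⋀² W` sending `f ∧ g` to `φ f * ψ g - ψ f * φ g`. -/
noncomputable def plucker (φ ψ : Quadric →ₗ[ℂ] ℂ) : ⋀[ℂ]^2 Quadric →ₗ[ℂ] ℂ :=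
  exteriorPower.alternatingMapLinearEquiv
    (Matrix.detRowAlternating.compLinearMap (LinearMap.pi ![φ, ψ]))

lemma plucker_wedge (φ ψ : Quadric →ₗ[ℂ] ℂ) (f g : Quadric) :
    plucker φ ψ (wedge f g) = φ f * ψ g - ψ f * φ g := by
  rw [plucker, wedge, exteriorPower.alternatingMapLinearEquiv_apply_ιMulti,
    AlternatingMap.compLinearMap_apply]
  change Matrix.det (Matrix.of fun i => (LinearMap.pi ![φ, ψ]) (![f, g] i)) = _
  rw [Matrix.det_fin_two]
  simp

lemma actWedge_wedge (A : SL(4, ℂ)) (f g : Quadric) :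
    actWedge A (wedge f g) = wedge (act A f) (act A g) := by
  rw [actWedge, wedge, exteriorPower.map_apply_ιMulti, wedge]
  congr 1
  ext i : 1
  fin_cases i <;> rfl

/-- The functional reading off one entry of the Gram matrix. -/
noncomputable def gramEntry (c : Fin 4 × Fin 4) : Quadric →ₗ[ℂ] ℂ :=
  Matrix.entryLinearMap ℂ ℂ c.1 c.2 ∘ₗ gram

lemma gramEntry_apply (c : Fin 4 × Fin 4) (f : Quadric) : gramEntry c f = gram f c.1 c.2 := rfl

lemma IsPencil.exists_minor_ne_zero {f g : Quadric} (hp : IsPencil f g) :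
    ∃ x y, gramEntry x f * gramEntry y g - gramEntry y f * gramEntry x g ≠ 0 := by
  by_contra! hcon
  rw [isPencil_iff] at hp
  have hf : f ≠ 0 := by
    rintro rfl
    simpa using hp 1 0 (by simp)
  obtain ⟨c, hc⟩ : ∃ c, gramEntry c f ≠ 0 := by
    by_contra! hc
    apply hf
    apply gram_injective
    ext i j
    simpa [gramEntry_apply] using hc (i, j)
  refine hc (hp (gramEntry c g) (-gramEntry c f) ?_ |>.2 |> neg_eq_zero.1)
  apply gram_injective
  ext i j
  have := hcon c (i, j)
  simp only [gramEntry_apply] at this ⊢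
  simp
  linear_combination -this

lemma wedge_ne_zero_iff (f g : Quadric) : wedge f g ≠ 0 ↔ IsPencil f g := by
  constructor
  · intro h
    by_contra hf
    exact h ((exteriorPower.ιMulti ℂ 2).map_linearDependent _ hf)
  · intro hp h0
    obtain ⟨x, y, hxy⟩ := hp.exists_minor_ne_zero
    apply hxy
    rw [← plucker_wedge, h0, map_zero]

lemma IsPencil.act {f g : Quadric} (h : IsPencil f g) (A : SL(4, ℂ)) :
    IsPencil (act A f) (act A g) := by
  rw [isPencil_iff] at h ⊢
  intro a b hab
  apply h
  have := congrArg (QuadricPencil.act A⁻¹) hab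
  simpa [act_inv_act] using this

lemma span_combination_le (f g : Quadric) (a b c d : ℂ) :
    Submodule.span ℂ {a • f + b • g, c • f + d • g} ≤ Submodule.span ℂ {f, g} := by
  rw [Submodule.span_le]
  rintro x (rfl | rfl) <;> exact Submodule.mem_span_pair.2 ⟨_, _, rfl⟩

lemma span_combination_eq (f g : Quadric) {a b c d : ℂ} (h : a * d - b * c ≠ 0) :
    Submodule.span ℂ {a • f + b • g, c • f + d • g} = Submodule.span ℂ {f, g} := by
  refine le_antisymm (span_combination_le f g a b c d) ?_
  rw [Submodule.span_le]
  set D := a * d - b * c with hD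
  rintro x (rfl | rfl) <;> refine Submodule.mem_span_pair.2 ?_
  · refine ⟨d / D, -b / D, ?_⟩
    simp only [smul_add, smul_smul]
    have h1 : d / D * a + -b / D * c = 1 := by field_simp; rw [hD]; ring
    have h2 : d / D * b + -b / D * d = 0 := by field_simp; ring
    calc _ = (d / D * a + -b / D * c) • x + (d / D * b + -b / D * d) • g := by module
      _ = x := by rw [h1, h2]; simp
  · refine ⟨-c / D, a / D, ?_⟩
    simp only [smul_add, smul_smul]
    have h1 : -c / D * a + a / D * c = 0 := by field_simp; ring
    have h2 : -c / D * b + a / D * d = 1 := by field_simp; rw [hD]; ring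
    calc _ = (-c / D * a + a / D * c) • f + (-c / D * b + a / D * d) • x := by module
      _ = x := by rw [h1, h2]; simp

lemma exists_combination_of_span_le {f g f' g' : Quadric}
    (h : Submodule.span ℂ {f', g'} ≤ Submodule.span ℂ {f, g}) :
    ∃ a b c d : ℂ, f' = a • f + b • g ∧ g' = c • f + d • g := by
  obtain ⟨a, b, hf⟩ := Submodule.mem_span_pair.1 (h (Submodule.subset_span (by simp : f' ∈ _)))
  obtain ⟨c, d, hg⟩ := Submodule.mem_span_pair.1 (h (Submodule.subset_span (by simp : g' ∈ _)))
  exact ⟨a, b, c, d, hf.symm, hg.symm⟩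

lemma IsPencil.det_ne_zero {f g : Quadric} {a b c d : ℂ}
    (h : IsPencil (a • f + b • g) (c • f + d • g)) : a * d - b * c ≠ 0 := by
  rw [← wedge_ne_zero_iff, wedge_combination] at h
  exact left_ne_zero_of_smul h

/-- Two pairs of generators of one pencil differ by an invertible `2 × 2` matrix. -/
lemma exists_combination_of_span_eq {f g f' g' : Quadric} (hp : IsPencil f' g')
    (h : Submodule.span ℂ {f', g'} = Submodule.span ℂ {f, g}) :
    ∃ a b c d : ℂ, a * d - b * c ≠ 0 ∧ f' = a • f + b • g ∧ g' = c • f + d • g := by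
  obtain ⟨a, b, c, d, rfl, rfl⟩ := exists_combination_of_span_le h.le
  exact ⟨a, b, c, d, hp.det_ne_zero, rfl, rfl⟩

lemma IsPencil.of_span_eq {f g f' g' : Quadric} (hp : IsPencil f g)
    (h : Submodule.span ℂ {f, g} = Submodule.span ℂ {f', g'}) : IsPencil f' g' := by
  have e1 := finrank_span_eq_card hp
  unfold IsPencil
  rw [linearIndependent_iff_card_eq_finrank_span, Set.finrank]
  rw [Matrix.range_cons_cons_empty] at e1 ⊢
  rw [← h, e1]

lemma map_act_span (A : SL(4, ℂ)) (f g : Quadric) :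
    (Submodule.span ℂ {f, g}).map (act A) = Submodule.span ℂ {act A f, act A g} := by
  rw [Submodule.map_span, Set.image_pair]

lemma ProjEquiv.of_span_eq {f g f' g' : Quadric}
    (h : Submodule.span ℂ {f, g} = Submodule.span ℂ {f', g'}) : ProjEquiv f g f' g' :=
  ⟨1, by simpa [act_one] using h⟩

lemma ProjEquiv.trans {f g f' g' f'' g'' : Quadric} (h : ProjEquiv f g f' g')
    (h' : ProjEquiv f' g' f'' g'') : ProjEquiv f g f'' g'' := by
  obtain ⟨A, hA⟩ := h
  obtain ⟨B, hB⟩ := h'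
  refine ⟨A * B, ?_⟩
  rw [← hB, ← map_act_span B f', ← hA, map_act_span, act_act, act_act]

lemma ProjEquiv.symm {f g f' g' : Quadric} (h : ProjEquiv f g f' g') : ProjEquiv f' g' f g := by
  obtain ⟨A, hA⟩ := h
  refine ⟨A⁻¹, ?_⟩
  rw [← map_act_span, ← hA, map_act_span, act_inv_act, act_inv_act]

lemma ProjEquiv.isPencil {f g f' g' : Quadric} (h : ProjEquiv f g f' g') (hp : IsPencil f g) :
    IsPencil f' g' := by
  obtain ⟨A, hA⟩ := h
  exact (hp.act A).of_span_eq hA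

/-! ### The topology of the orbits -/

lemma wedge_continuousAdd : ContinuousAdd (⋀[ℂ]^2 Quadric) := IsModuleTopology.toContinuousAdd ℂ _

lemma wedge_t2Space : T2Space (⋀[ℂ]^2 Quadric) := by
  let b := Module.Free.chooseBasis ℂ (⋀[ℂ]^2 Quadric)
  have := wedge_continuousAdd
  refine T2Space.of_injective_continuous (f := fun w i => b.coord i w) ?_ ?_
  · intro v w h
    exact b.ext_elem fun i => congrFun h i
  · exact continuous_pi fun i => IsModuleTopology.continuous_of_linearMap (b.coord i)

lemma continuous_plucker (φ ψ : Quadric →ₗ[ℂ] ℂ) : Continuous (plucker φ ψ) :=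
  IsModuleTopology.continuous_of_linearMap _

/-- The bilinear map sending a pair of matrices to the wedge product of their quadratic forms. -/
noncomputable def wedgeQuad :
    (Fin 4 → Fin 4 → ℂ) →ₗ[ℂ] (Fin 4 → Fin 4 → ℂ) →ₗ[ℂ] ⋀[ℂ]^2 Quadric :=
  LinearMap.mk₂ ℂ (fun M N => wedge (quad (Matrix.of M)) (quad (Matrix.of N)))
    (fun M M' N => by rw [← wedge_add_left, ← map_add]; rfl)
    (fun c M N => by rw [← wedge_smul_left, ← map_smul]; rfl)
    (fun M N N' => by rw [← wedge_add_right, ← map_add]; rfl)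
    (fun c M N => by rw [← wedge_smul_right, ← map_smul]; rfl)

lemma continuous_wedgeQuad : Continuous fun p : (Fin 4 → Fin 4 → ℂ) × (Fin 4 → Fin 4 → ℂ) =>
    wedgeQuad p.1 p.2 := by
  have := wedge_continuousAdd
  exact IsModuleTopology.continuous_bilinear_of_finite_left wedgeQuad

lemma actWedge_eq_wedgeQuad (A : SL(4, ℂ)) (f g : Quadric) :
    actWedge A (wedge f g) =
      wedgeQuad ((1 / 2 : ℂ) • ((A : Matrix (Fin 4) (Fin 4) ℂ).transpose * gram f * A))
        ((1 / 2 : ℂ) • ((A : Matrix (Fin 4) (Fin 4) ℂ).transpose * gram g * A)) := by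
  rw [actWedge_wedge, ← gram_act, ← gram_act]
  conv_lhs => rw [← quad_gram (act A f), ← quad_gram (act A g)]
  rfl

lemma actWedge_actWedge (A B : SL(4, ℂ)) (w : ⋀[ℂ]^2 Quadric) :
    actWedge A (actWedge B w) = actWedge (B * A) w := by
  have h : act (B * A) = act A ∘ₗ act B := by
    ext1 f; exact (act_act A B f).symm
  simp only [actWedge, h, exteriorPower.map_comp]
  rfl

lemma actWedge_one (w : ⋀[ℂ]^2 Quadric) : actWedge 1 w = w := by
  have h : act 1 = LinearMap.id := by ext1 f; exact act_one f
  simp only [actWedge, h, exteriorPower.map_id]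
  rfl

/-- An orbit is closed as soon as bounded parts of it are swept out by bounded sets of matrices. -/
lemma isClosed_orbit_of_proper (f g : Quadric)
    (h : ∀ C : ℝ, 0 < C → ∃ K : ℝ, ∀ A : SL(4, ℂ),
      (∀ c d, ‖plucker (gramEntry c) (gramEntry d) (actWedge A (wedge f g))‖ ≤ C) →
      ∃ A' : SL(4, ℂ), actWedge A' (wedge f g) = actWedge A (wedge f g) ∧
        ∀ i j, ‖A' i j‖ ≤ K) : IsClosed (orbit (wedge f g)) := by
  have := wedge_t2Space
  rw [← closure_subset_iff_isClosed]
  intro w' hw'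
  obtain ⟨u, hu, hlim⟩ := mem_closure_iff_ultrafilter.1 hw'
  set C : ℝ := 1 + ∑ c, ∑ d, ‖plucker (gramEntry c) (gramEntry d) w'‖ with hC
  have hC0 : 0 < C := by positivity
  obtain ⟨K, hK⟩ := h C hC0
  have hev : ∀ᶠ w in (u : Filter _), ∀ c d, ‖plucker (gramEntry c) (gramEntry d) w‖ ≤ C := by
    rw [Filter.eventually_all]
    intro c
    rw [Filter.eventually_all]
    intro d
    have ht : Filter.Tendsto (fun w => ‖plucker (gramEntry c) (gramEntry d) w‖) u
        (nhds ‖plucker (gramEntry c) (gramEntry d) w'‖) :=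
      ((continuous_plucker _ _).norm.tendsto w').mono_left hlim
    refine (ht.eventually_lt_const ?_).mono fun w hw => hw.le
    have h1 : ‖plucker (gramEntry c) (gramEntry d) w'‖ ≤
        ∑ d, ‖plucker (gramEntry c) (gramEntry d) w'‖ :=
      Finset.single_le_sum (f := fun d => ‖plucker (gramEntry c) (gramEntry d) w'‖)
        (fun _ _ => norm_nonneg _) (Finset.mem_univ d)
    have h2 : ∑ d, ‖plucker (gramEntry c) (gramEntry d) w'‖ ≤
        ∑ c, ∑ d, ‖plucker (gramEntry c) (gramEntry d) w'‖ :=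
      Finset.single_le_sum (f := fun c => ∑ d, ‖plucker (gramEntry c) (gramEntry d) w'‖)
        (fun _ _ => Finset.sum_nonneg fun _ _ => norm_nonneg _) (Finset.mem_univ c)
    linarith
  -- a bounded choice of group elements along the ultrafilter
  have hex : ∀ w, ∃ A : SL(4, ℂ), (w ∈ orbit (wedge f g) →
      (∀ c d, ‖plucker (gramEntry c) (gramEntry d) w‖ ≤ C) →
      actWedge A (wedge f g) = w ∧ ∀ i j, ‖A i j‖ ≤ K) := by
    intro w
    by_cases hw : w ∈ orbit (wedge f g) ∧
      ∀ c d, ‖plucker (gramEntry c) (gramEntry d) w‖ ≤ C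
    · obtain ⟨⟨A, rfl⟩, hA⟩ := hw
      obtain ⟨A', h1, h2⟩ := hK A hA
      exact ⟨A', fun _ _ => ⟨h1, h2⟩⟩
    · exact ⟨1, fun h1 h2 => absurd ⟨h1, h2⟩ hw⟩
  choose A hA using hex
  have hgood : ∀ᶠ w in (u : Filter _), actWedge (A w) (wedge f g) = w ∧ ∀ i j, ‖A w i j‖ ≤ K := by
    filter_upwards [hu, hev] with w h1 h2 using hA w h1 h2
  -- the chosen elements accumulate at a matrix `N`, which carries `wedge f g` to the given limit
  let B : Set (Fin 4 → Fin 4 → ℂ) := Set.univ.pi fun _ => Set.univ.pi fun _ => Metric.closedBall 0 K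
  have hB : IsCompact B :=
    isCompact_univ_pi fun _ => isCompact_univ_pi fun _ => isCompact_closedBall 0 K
  let a : ⋀[ℂ]^2 Quadric → (Fin 4 → Fin 4 → ℂ) := fun w i j => A w i j
  obtain ⟨N, -, hN⟩ := hB.ultrafilter_le_nhds (u.map a) (by
    rw [Filter.le_principal_iff]
    refine hgood.mono fun w hw => ?_
    simpa [B, a, Set.mem_pi] using hw.2)
  have hN' : Filter.Tendsto a u (nhds N) := hN
  have hdet : (Matrix.of N).det = 1 := by
    have hc : Continuous fun N : Fin 4 → Fin 4 → ℂ => (Matrix.of N).det :=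
      Continuous.matrix_det continuous_id
    refine tendsto_nhds_unique ((hc.tendsto N).comp hN') ?_
    refine tendsto_const_nhds.congr fun w => ?_
    exact (A w).2.symm
  let A₀ : SL(4, ℂ) := ⟨Matrix.of N, hdet⟩
  refine ⟨A₀, ?_⟩
  have hc (F : Matrix (Fin 4) (Fin 4) ℂ) : Continuous fun N : Fin 4 → Fin 4 → ℂ =>
      (((1 / 2 : ℂ) • ((Matrix.of N).transpose * F * Matrix.of N) :
        Matrix (Fin 4) (Fin 4) ℂ) : Fin 4 → Fin 4 → ℂ) := by
    have h1 : Continuous fun N : Fin 4 → Fin 4 → ℂ => Matrix.of N := continuous_id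
    have h2 : Continuous fun N : Fin 4 → Fin 4 → ℂ =>
        (Matrix.of N).transpose * F * Matrix.of N :=
      (h1.matrix_transpose.matrix_mul continuous_const).matrix_mul h1
    exact h2.const_smul (1 / 2 : ℂ)
  have hlim2 :=
    ((continuous_wedgeQuad.comp ((hc (gram f)).prodMk (hc (gram g)))).tendsto N).comp hN'
  have hlim3 : Filter.Tendsto (fun w => actWedge (A w) (wedge f g)) u (nhds w') := by
    refine Filter.Tendsto.congr' ?_ (show Filter.Tendsto id (u : Filter _) (nhds w') from hlim)
    exact hgood.mono fun w hw => hw.1.symm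
  refine (tendsto_nhds_unique hlim3 ?_).symm
  beta_reduce
  rw [actWedge_eq_wedgeQuad A₀]
  refine hlim2.congr fun w => ?_
  rw [actWedge_eq_wedgeQuad (A w)]
  rfl

/-! ### Stability depends only on the projective equivalence class -/

lemma ProjEquiv.exists_wedge_eq {f g f' g' : Quadric} (h : ProjEquiv f g f' g')
    (hp : IsPencil f g) :
    ∃ (A : SL(4, ℂ)) (c : ℂ), c ≠ 0 ∧ wedge f' g' = c • actWedge A (wedge f g) := by
  obtain ⟨A, hA⟩ := h
  obtain ⟨a, b, c, d, hd, rfl, rfl⟩ :=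
    exists_combination_of_span_eq ((hp.act A).of_span_eq hA) hA.symm
  exact ⟨A, _, hd, by rw [wedge_combination, actWedge_wedge]⟩

lemma orbit_smul_actWedge (A : SL(4, ℂ)) (c : ℂ) (w : ⋀[ℂ]^2 Quadric) :
    orbit (c • actWedge A w) = (fun v => c • v) '' orbit w := by
  ext v
  constructor
  · rintro ⟨B, rfl⟩
    exact ⟨_, ⟨A * B, rfl⟩, by simp [actWedge_actWedge]⟩
  · rintro ⟨_, ⟨B, rfl⟩, rfl⟩
    exact ⟨A⁻¹ * B, by simp [actWedge_actWedge]⟩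

lemma mem_stabilizer_smul_actWedge {A B : SL(4, ℂ)} {c : ℂ} {w : ⋀[ℂ]^2 Quadric} (hc : c ≠ 0)
    (hB : B ∈ stabilizer (c • actWedge A w)) : A * B * A⁻¹ ∈ stabilizer w := by
  have h : c • actWedge B (actWedge A w) = c • actWedge A w := by
    rw [← map_smul]; exact hB
  have h' := smul_right_injective _ hc h
  change actWedge _ w = w
  rw [← actWedge_actWedge, ← actWedge_actWedge, h', actWedge_actWedge, mul_inv_cancel, actWedge_one]

lemma finite_stabilizer_smul_actWedge {A : SL(4, ℂ)} {c : ℂ} {w : ⋀[ℂ]^2 Quadric} (hc : c ≠ 0)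
    (h : (stabilizer w).Finite) : (stabilizer (c • actWedge A w)).Finite := by
  refine Set.Finite.of_injOn (f := fun B : SL(4, ℂ) => A * B * A⁻¹)
    (fun B hB => mem_stabilizer_smul_actWedge hc hB) ?_ h
  intro B _ B' _ hBB
  exact mul_left_cancel (mul_right_cancel hBB)

lemma ProjEquiv.isPolystable {f g f' g' : Quadric} (h : ProjEquiv f g f' g')
    (hs : IsPolystable f g) : IsPolystable f' g' := by
  have hp := (wedge_ne_zero_iff f g).1 hs.1
  refine ⟨(wedge_ne_zero_iff _ _).2 (h.isPencil hp), ?_⟩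
  obtain ⟨A, c, hc, hw⟩ := h.exists_wedge_eq hp
  rw [hw, orbit_smul_actWedge]
  exact (Homeomorph.smulOfNeZero c hc).isClosedMap _ hs.2

lemma ProjEquiv.isStable {f g f' g' : Quadric} (h : ProjEquiv f g f' g')
    (hs : IsStable f g) : IsStable f' g' := by
  refine ⟨h.isPolystable hs.1, ?_⟩
  obtain ⟨A, c, hc, hw⟩ := h.exists_wedge_eq ((wedge_ne_zero_iff f g).1 hs.1.1)
  rw [hw]
  exact finite_stabilizer_smul_actWedge hc hs.2

lemma ProjEquiv.isStrictlyPolystable {f g f' g' : Quadric} (h : ProjEquiv f g f' g')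
    (hs : IsStrictlyPolystable f g) : IsStrictlyPolystable f' g' :=
  ⟨h.isPolystable hs.1, fun hst => hs.2 (h.symm.isStable hst)⟩

/-! ### Small generators of a pencil with small Plücker coordinates -/

/-- If the Plücker coordinates of a pencil are at most `C ^ 2`, then an `SL₂`-change of generators
makes all Gram matrix entries at most `C`: divide out by the largest Plücker coordinate. -/
lemma exists_small_generators {f g : Quadric} (hp : IsPencil f g) {C : ℝ} (hC : 0 < C)
    (h : ∀ c d, ‖plucker (gramEntry c) (gramEntry d) (wedge f g)‖ ≤ C ^ 2) :
    ∃ a b c d : ℂ, a * d - b * c = 1 ∧ ∀ i j,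
      ‖gram (a • f + b • g) i j‖ ≤ C ∧ ‖gram (c • f + d • g) i j‖ ≤ C := by
  simp only [plucker_wedge] at h
  set p : (Fin 4 × Fin 4) × (Fin 4 × Fin 4) → ℂ := fun x =>
    gramEntry x.1 f * gramEntry x.2 g - gramEntry x.2 f * gramEntry x.1 g with hpdef
  obtain ⟨⟨x, y⟩, hxy⟩ := Finite.exists_max fun x => ‖p x‖
  have hpos : p (x, y) ≠ 0 := by
    intro h0
    obtain ⟨c, d, hcd⟩ := hp.exists_minor_ne_zero
    have := hxy (c, d)
    rw [h0, norm_zero, norm_le_zero_iff] at this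
    exact hcd this
  set P : ℝ := ‖p (x, y)‖ with hP
  have hP0 : 0 < P := norm_pos_iff.2 hpos
  have hPC : Real.sqrt P ≤ C := by
    rw [Real.sqrt_le_left hC.le]
    exact h x y
  set s : ℂ := (Real.sqrt P : ℂ) with hs
  have hs0 : s ≠ 0 := by
    rw [hs]; exact_mod_cast (Real.sqrt_pos.2 hP0).ne'
  have hsn : ‖s‖ = Real.sqrt P := by
    rw [hs, Complex.norm_real, Real.norm_of_nonneg (Real.sqrt_nonneg _)]
  -- The new generators have the entries `s * p (z, y) / p (x, y)` and `p (x, z) / s` at `z`, where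
  -- `p (x, y)` is the largest Plücker coordinate and `s ^ 2` its absolute value.
  refine ⟨s * gramEntry y g / p (x, y), -(s * gramEntry y f / p (x, y)),
    -(gramEntry x g / s), gramEntry x f / s, ?_, fun i j => ⟨?_, ?_⟩⟩
  · have : p (x, y) = gramEntry x f * gramEntry y g - gramEntry y f * gramEntry x g := rfl
    field_simp
    rw [this]; ring
  · have : gram ((s * gramEntry y g / p (x, y)) • f + (-(s * gramEntry y f / p (x, y))) • g) i j
        = s * (p ((i, j), y) / p (x, y)) := by
      simp [hpdef, gramEntry_apply]
      ring
    rw [this, norm_mul, norm_div, hsn]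
    have h1 : ‖p ((i, j), y)‖ / ‖p (x, y)‖ ≤ 1 := div_le_one_of_le₀ (hxy _) (norm_nonneg _)
    calc _ ≤ Real.sqrt P * 1 := by gcongr
      _ ≤ C := by simpa using hPC
  · have : gram ((-(gramEntry x g / s)) • f + (gramEntry x f / s) • g) i j
        = p (x, (i, j)) / s := by
      simp [hpdef, gramEntry_apply]
      ring
    rw [this, norm_div, hsn]
    refine le_trans ?_ hPC
    rw [div_le_iff₀ (Real.sqrt_pos.2 hP0), Real.mul_self_sqrt hP0.le]
    exact hxy _

/-! ### The determinant quartic and its quadratic invariant -/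

/-- `φ` is the binary quartic form with coefficients `a, b, c, d, e`. -/
def IsBinaryQuartic (φ : ℂ → ℂ → ℂ) (a b c d e : ℂ) : Prop :=
  ∀ x y, φ x y = a * x ^ 4 + b * x ^ 3 * y + c * x ^ 2 * y ^ 2 + d * x * y ^ 3 + e * y ^ 4

lemma exists_isBinaryQuartic_sum {ι : Type*} (s : Finset ι) (φ : ι → ℂ → ℂ → ℂ)
    (h : ∀ i, ∃ a b c d e, IsBinaryQuartic (φ i) a b c d e) :
    ∃ a b c d e, IsBinaryQuartic (fun x y => ∑ i ∈ s, φ i x y) a b c d e := by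
  choose a b c d e h using h
  refine ⟨∑ i ∈ s, a i, ∑ i ∈ s, b i, ∑ i ∈ s, c i, ∑ i ∈ s, d i, ∑ i ∈ s, e i, fun x y => ?_⟩
  simp only [Finset.sum_mul, ← Finset.sum_add_distrib]
  exact Finset.sum_congr rfl fun i _ => h i x y

lemma exists_isBinaryQuartic_det (F G : Matrix (Fin 4) (Fin 4) ℂ) :
    ∃ a b c d e, IsBinaryQuartic (fun x y => (x • F + y • G).det) a b c d e := by
  simp only [Matrix.det_apply]
  refine exists_isBinaryQuartic_sum _ _ fun σ => ?_
  simp only [Fin.prod_univ_four, Matrix.add_apply, Matrix.smul_apply, smul_eq_mul, Units.smul_def,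
    zsmul_eq_mul]
  set ε : ℂ := ((Equiv.Perm.sign σ : ℤ) : ℂ)
  generalize F (σ 0) 0 = p0, F (σ 1) 1 = p1, F (σ 2) 2 = p2, F (σ 3) 3 = p3,
    G (σ 0) 0 = q0, G (σ 1) 1 = q1, G (σ 2) 2 = q2, G (σ 3) 3 = q3
  refine ⟨ε * (p0 * p1 * p2 * p3),
    ε * (q0 * p1 * p2 * p3 + p0 * q1 * p2 * p3 + p0 * p1 * q2 * p3 + p0 * p1 * p2 * q3),
    ε * (q0 * q1 * p2 * p3 + q0 * p1 * q2 * p3 + q0 * p1 * p2 * q3 + p0 * q1 * q2 * p3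
      + p0 * q1 * p2 * q3 + p0 * p1 * q2 * q3),
    ε * (p0 * q1 * q2 * q3 + q0 * p1 * q2 * q3 + q0 * q1 * p2 * q3 + q0 * q1 * q2 * p3),
    ε * (q0 * q1 * q2 * q3), fun x y => ?_⟩
  ring

/-- The invariant `12 a e - 3 b d + c ^ 2` of the binary quartic
`det (x F + y G) = a x⁴ + b x³ y + c x² y² + d x y³ + e y⁴`, multiplied by `36` and expressed
through the values of the quartic at `(1 : 0), (0 : 1), (1 : 1), (1 : -1), (1 : 2)`. -/
def quarticInvariant {R : Type*} [CommRing R] (F G : Matrix (Fin 4) (Fin 4) R) : R :=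
  432 * F.det * G.det
    - 3 * (4 * ((F + G).det - (F - G).det) - ((F + 2 * G).det - F.det
      - 2 * ((F + G).det + (F - G).det - 2 * F.det - 2 * G.det) - 16 * G.det))
      * (((F + 2 * G).det - F.det
      - 2 * ((F + G).det + (F - G).det - 2 * F.det - 2 * G.det) - 16 * G.det)
        - ((F + G).det - (F - G).det))
    + 9 * ((F + G).det + (F - G).det - 2 * F.det - 2 * G.det) ^ 2

lemma det_values {F G : Matrix (Fin 4) (Fin 4) ℂ} {a b c d e : ℂ}
    (h : IsBinaryQuartic (fun x y => (x • F + y • G).det) a b c d e) :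
    F.det = a ∧ G.det = e ∧ (F + G).det = a + b + c + d + e ∧
      (F - G).det = a - b + c - d + e ∧ (F + 2 * G).det = a + 2 * b + 4 * c + 8 * d + 16 * e := by
  refine ⟨?_, ?_, ?_, ?_, ?_⟩
  · simpa using h 1 0
  · simpa using h 0 1
  · simpa using h 1 1
  · have := h 1 (-1)
    simp only [one_smul, neg_smul, ← sub_eq_add_neg] at this
    rw [this]; ring
  · have := h 1 2
    have h2 : (2 : ℂ) • G = 2 * G := by rw [two_smul, two_mul]
    simp only [one_smul, h2] at this
    rw [this]; ring

lemma quarticInvariant_eq {F G : Matrix (Fin 4) (Fin 4) ℂ} {a b c d e : ℂ}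
    (h : IsBinaryQuartic (fun x y => (x • F + y • G).det) a b c d e) :
    quarticInvariant F G = 36 * (12 * a * e - 3 * b * d + c ^ 2) := by
  obtain ⟨h1, h2, h3, h4, h5⟩ := det_values h
  rw [quarticInvariant, h1, h2, h3, h4, h5]
  ring

lemma quarticInvariant_combination (F G : Matrix (Fin 4) (Fin 4) ℂ) {p q r s : ℂ}
    (hd : p * s - q * r = 1) :
    quarticInvariant (p • F + q • G) (r • F + s • G) = quarticInvariant F G := by
  obtain ⟨a, b, c, d, e, h⟩ := exists_isBinaryQuartic_det F G
  have h' : ∃ a' b' c' d' e', IsBinaryQuartic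
      (fun x y => (x • (p • F + q • G) + y • (r • F + s • G)).det) a' b' c' d' e' ∧
      12 * a' * e' - 3 * b' * d' + c' ^ 2 =
        (p * s - q * r) ^ 4 * (12 * a * e - 3 * b * d + c ^ 2) := by
    refine ⟨a * p ^ 4 + b * p ^ 3 * q + c * p ^ 2 * q ^ 2 + d * p * q ^ 3 + e * q ^ 4,
      4 * a * p ^ 3 * r + b * (3 * p ^ 2 * r * q + p ^ 3 * s)
        + c * (2 * p * r * q ^ 2 + 2 * p ^ 2 * q * s) + d * (r * q ^ 3 + 3 * p * q ^ 2 * s)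
        + 4 * e * q ^ 3 * s,
      6 * a * p ^ 2 * r ^ 2 + b * (3 * p * r ^ 2 * q + 3 * p ^ 2 * r * s)
        + c * (r ^ 2 * q ^ 2 + 4 * p * r * q * s + p ^ 2 * s ^ 2)
        + d * (3 * r * q ^ 2 * s + 3 * p * q * s ^ 2) + 6 * e * q ^ 2 * s ^ 2,
      4 * a * p * r ^ 3 + b * (r ^ 3 * q + 3 * p * r ^ 2 * s)
        + c * (2 * r ^ 2 * q * s + 2 * p * r * s ^ 2) + d * (3 * r * q * s ^ 2 + p * s ^ 3)
        + 4 * e * q * s ^ 3,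
      a * r ^ 4 + b * r ^ 3 * s + c * r ^ 2 * s ^ 2 + d * r * s ^ 3 + e * s ^ 4, ?_, by ring⟩
    intro x y
    have := h (x * p + y * r) (x * q + y * s)
    have e1 : x • (p • F + q • G) + y • (r • F + s • G)
        = (x * p + y * r) • F + (x * q + y * s) • G := by module
    beta_reduce at this ⊢
    rw [e1, this]
    ring
  obtain ⟨a', b', c', d', e', hq, hI⟩ := h'
  rw [quarticInvariant_eq h, quarticInvariant_eq hq, hI, hd]
  ring

lemma det_congruence (A : SL(4, ℂ)) (N : Matrix (Fin 4) (Fin 4) ℂ) :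
    ((A : Matrix (Fin 4) (Fin 4) ℂ).transpose * N * A).det = N.det := by
  rw [Matrix.det_mul, Matrix.det_mul, Matrix.det_transpose, A.2]; simp

lemma det_gram_act_combination (A : SL(4, ℂ)) (f g : Quadric) (x y : ℂ) :
    (x • gram (act A f) + y • gram (act A g)).det = (x • gram f + y • gram g).det := by
  rw [← map_smul gram, ← map_smul gram, ← map_add gram, ← map_smul (act A), ← map_smul (act A),
    ← map_add (act A), gram_act, det_congruence, map_add, map_smul, map_smul]

lemma quarticInvariant_act (A : SL(4, ℂ)) (f g : Quadric) :
    quarticInvariant (gram (act A f)) (gram (act A g)) = quarticInvariant (gram f) (gram g) := by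
  obtain ⟨a, b, c, d, e, h⟩ := exists_isBinaryQuartic_det (gram f) (gram g)
  rw [quarticInvariant_eq h]
  exact quarticInvariant_eq fun x y => (det_gram_act_combination A f g x y).trans (h x y)

lemma quarticInvariant_map {R S : Type*} [CommRing R] [CommRing S] (φ : R →+* S)
    (F G : Matrix (Fin 4) (Fin 4) R) :
    φ (quarticInvariant F G) = quarticInvariant (F.map φ) (G.map φ) := by
  simp only [quarticInvariant, map_add, map_sub, map_mul, map_pow, map_ofNat, RingHom.map_det,
    RingHom.mapMatrix_apply]

/-- A pencil whose determinant quartic has nonzero quadratic invariant is semistable: the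
invariant is constant along orbits and vanishes at the origin of `⋀² W`. -/
lemma isSemistable_of_quarticInvariant_ne_zero {f g : Quadric}
    (h : quarticInvariant (gram f) (gram g) ≠ 0) (hp : IsPencil f g) : IsSemistable f g := by
  intro hcl
  have hcont : Continuous fun p : (Fin 4 → Fin 4 → ℂ) × (Fin 4 → Fin 4 → ℂ) =>
      quarticInvariant (Matrix.of p.1) (Matrix.of p.2) := by
    have h1 : Continuous fun p : (Fin 4 → Fin 4 → ℂ) × (Fin 4 → Fin 4 → ℂ) => Matrix.of p.1 :=
      continuous_fst
    have h2 : Continuous fun p : (Fin 4 → Fin 4 → ℂ) × (Fin 4 → Fin 4 → ℂ) => Matrix.of p.2 :=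
      continuous_snd
    have h3 := h1.matrix_det
    have h4 := h2.matrix_det
    have h5 := (h1.add h2).matrix_det
    have h6 := (h1.sub h2).matrix_det
    have h7 : Continuous fun p : (Fin 4 → Fin 4 → ℂ) × (Fin 4 → Fin 4 → ℂ) =>
        (Matrix.of p.1 + 2 * Matrix.of p.2).det :=
      (h1.add (continuous_const.matrix_mul h2)).matrix_det
    unfold quarticInvariant
    fun_prop
  obtain ⟨δ, hδ, hδ'⟩ := Metric.continuousAt_iff.1 (hcont.continuousAt (x := 0))
    ‖quarticInvariant (gram f) (gram g)‖ (norm_pos_iff.2 h)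
  have hz : quarticInvariant (Matrix.of (0 : Fin 4 → Fin 4 → ℂ)) (Matrix.of 0) = 0 := by
    have : (Matrix.of (0 : Fin 4 → Fin 4 → ℂ)) = 0 := rfl
    simp [quarticInvariant, this]
  -- An element of the orbit close to the origin has small Plücker coordinates, hence small
  -- generators, contradicting the continuity of the invariant.
  obtain ⟨w, hw, A, rfl⟩ := mem_closure_iff.1 hcl
    {w | ∀ c d, ‖plucker (gramEntry c) (gramEntry d) w‖ < (δ / 2) ^ 2}
    (by
      simp only [Set.ofPred_forall]
      exact isOpen_iInter_of_finite fun c => isOpen_iInter_of_finite fun d =>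
        isOpen_lt (continuous_plucker _ _).norm continuous_const)
    (by simp only [Set.mem_ofPred_eq, map_zero, norm_zero]; intros; positivity)
  simp only [actWedge_wedge, Set.mem_ofPred_eq] at hw
  obtain ⟨a, b, c, d, hdet, hsmall⟩ := exists_small_generators (hp.act A) (half_pos hδ)
    fun c d => (hw c d).le
  have := @hδ' (gram (a • act A f + b • act A g), gram (c • act A f + d • act A g)) (by
    rw [dist_zero_right, Prod.norm_def]
    refine lt_of_le_of_lt (max_le ?_ ?_) (half_lt_self hδ)
    · refine (pi_norm_le_iff_of_nonneg (half_pos hδ).le).2 fun i =>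
        (pi_norm_le_iff_of_nonneg (half_pos hδ).le).2 fun j => (hsmall i j).1
    · refine (pi_norm_le_iff_of_nonneg (half_pos hδ).le).2 fun i =>
        (pi_norm_le_iff_of_nonneg (half_pos hδ).le).2 fun j => (hsmall i j).2)
  simp only [Prod.fst_zero, Prod.snd_zero, hz, dist_zero_right] at this
  refine lt_irrefl _ (lt_of_eq_of_lt ?_ this)
  congr 1
  rw [← quarticInvariant_act A, ← quarticInvariant_combination _ _ hdet]
  simp only [map_add, map_smul]
  rfl

/-! ### Adapted bases and coordinate changes -/

lemma linearIndependent_pair_of_span_eq {V : Type*} [AddCommGroup V] [Module ℂ V] {a b c d : V}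
    (hp : LinearIndependent ℂ ![a, b]) (h : Submodule.span ℂ {a, b} = Submodule.span ℂ {c, d}) :
    LinearIndependent ℂ ![c, d] := by
  have e1 := finrank_span_eq_card hp
  rw [linearIndependent_iff_card_eq_finrank_span, Set.finrank]
  rw [Matrix.range_cons_cons_empty] at e1 ⊢
  rw [← h, e1]

lemma exists_snoc_linearIndependent {n : ℕ} {v : Fin n → Vec} (hv : LinearIndependent ℂ v)
    (S : Submodule ℂ Vec) (hS : n < Module.finrank ℂ S) :
    ∃ x ∈ S, LinearIndependent ℂ (Fin.snoc v x : Fin (n + 1) → Vec) := by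
  by_contra! hcon
  have hle : S ≤ Submodule.span ℂ (Set.range v) := by
    intro x hx
    by_contra hx'
    exact hcon x hx (linearIndependent_finSnoc.2 ⟨hv, hx'⟩)
  have h1 := Submodule.finrank_mono hle
  rw [finrank_span_eq_card hv, Fintype.card_fin] at h1
  omega

/-- Up to a scalar, any basis is the image of the standard basis under an element of `SL₄`. -/
lemma exists_SL_of_basis {b : Fin 4 → Vec} (hb : LinearIndependent ℂ b) :
    ∃ (A : SL(4, ℂ)) (d : ℂ), d ≠ 0 ∧
      ∀ i, (A : Matrix (Fin 4) (Fin 4) ℂ).mulVec (e i) = d • b i := by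
  have hdet : (Matrix.of b).transpose.det ≠ 0 := by
    rw [Matrix.det_transpose]
    have := (Matrix.linearIndependent_rows_iff_isUnit (A := Matrix.of b)).1 hb
    exact ((Matrix.isUnit_iff_isUnit_det _).1 this).ne_zero
  obtain ⟨d, hd⟩ := IsAlgClosed.exists_pow_nat_eq ((Matrix.of b).transpose.det)⁻¹
    (n := 4) (by norm_num)
  have hd0 : d ≠ 0 := by
    rintro rfl
    apply hdet
    rw [← inv_eq_zero, ← hd]
    norm_num
  refine ⟨⟨d • (Matrix.of b).transpose, ?_⟩, d, hd0, fun i => ?_⟩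
  · rw [Matrix.det_smul, Fintype.card_fin, hd, inv_mul_cancel₀ hdet]
  · ext j
    simp [e]

lemma gram_act_of_basis {A : SL(4, ℂ)} {d : ℂ} {b : Fin 4 → Vec}
    (h : ∀ i, (A : Matrix (Fin 4) (Fin 4) ℂ).mulVec (e i) = d • b i) (f : Quadric) (i j : Fin 4) :
    gram (act A f) i j = d ^ 2 * f.polarBilin (b i) (b j) := by
  rw [gram_apply, act_polarBilin, h, h]
  simp only [map_smul, LinearMap.smul_apply, smul_eq_mul]
  ring

/-- Diagonal elements of `SL₄`. -/
noncomputable def diag (d : Fin 4 → ℂ) (h : d 0 * d 1 * d 2 * d 3 = 1) : SL(4, ℂ) :=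
  ⟨Matrix.diagonal d, by rw [Matrix.det_diagonal, Fin.prod_univ_four, h]⟩

lemma gram_act_diag (d : Fin 4 → ℂ) (h : d 0 * d 1 * d 2 * d 3 = 1) (f : Quadric) (i j : Fin 4) :
    gram (act (diag d h) f) i j = d i * d j * gram f i j := by
  rw [gram_act, diag]
  simp only [Matrix.diagonal_transpose, Matrix.mul_diagonal, Matrix.diagonal_mul]
  ring

/-! ### Coordinate changes and the singularities of the base locus -/

lemma mulVec_inv_mulVec (A : SL(4, ℂ)) (v : Vec) : (A : Matrix (Fin 4) (Fin 4) ℂ).mulVec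
    (((A⁻¹ : SL(4, ℂ)) : Matrix (Fin 4) (Fin 4) ℂ).mulVec v) = v := by
  rw [Matrix.mulVec_mulVec, ← Matrix.SpecialLinearGroup.coe_mul, mul_inv_cancel]
  simp

lemma inv_mulVec_mulVec (A : SL(4, ℂ)) (v : Vec) :
    ((A⁻¹ : SL(4, ℂ)) : Matrix (Fin 4) (Fin 4) ℂ).mulVec
      ((A : Matrix (Fin 4) (Fin 4) ℂ).mulVec v) = v := by
  rw [Matrix.mulVec_mulVec, ← Matrix.SpecialLinearGroup.coe_mul, inv_mul_cancel]
  simp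

lemma mulVec_injective (A : SL(4, ℂ)) :
    Function.Injective (A : Matrix (Fin 4) (Fin 4) ℂ).mulVec :=
  Function.LeftInverse.injective (inv_mulVec_mulVec A)

lemma mulVec_surjective (A : SL(4, ℂ)) :
    Function.Surjective (A : Matrix (Fin 4) (Fin 4) ℂ).mulVec :=
  Function.RightInverse.surjective (mulVec_inv_mulVec A)

lemma isSingularPoint_act (A : SL(4, ℂ)) (f g : Quadric) (p : Vec) :
    IsSingularPoint (act A f) (act A g) p ↔
      IsSingularPoint f g ((A : Matrix (Fin 4) (Fin 4) ℂ).mulVec p) := by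
  have hinv := mulVec_injective A
  have hsurj := mulVec_surjective A
  have h0 : (A : Matrix (Fin 4) (Fin 4) ℂ).mulVec p = 0 ↔ p = 0 := by
    constructor
    · intro h
      exact hinv (h.trans (Matrix.mulVec_zero _).symm)
    · rintro rfl
      exact Matrix.mulVec_zero _
  refine and_congr (not_congr h0.symm) (and_congr Iff.rfl (not_congr ?_))
  rw [LinearIndependent.pair_iff, LinearIndependent.pair_iff]
  refine forall_congr' fun s => forall_congr' fun t => imp_congr ?_ Iff.rfl
  constructor
  · intro h
    refine LinearMap.ext fun w => ?_
    obtain ⟨w, rfl⟩ := hsurj w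
    have := LinearMap.congr_fun h w
    simp only [LinearMap.add_apply, LinearMap.smul_apply, act_polarBilin] at this ⊢
    exact this
  · intro h
    refine LinearMap.ext fun w => ?_
    have := LinearMap.congr_fun h ((A : Matrix (Fin 4) (Fin 4) ℂ).mulVec w)
    simp only [LinearMap.add_apply, LinearMap.smul_apply, act_polarBilin] at this ⊢
    exact this

lemma mem_baseLocus_iff_span (f g : Quadric) (p : Vec) :
    p ∈ baseLocus f g ↔ ∀ h ∈ Submodule.span ℂ {f, g}, h p = 0 := by
  constructor
  · rintro ⟨hf, hg⟩ h hh
    obtain ⟨a, b, rfl⟩ := Submodule.mem_span_pair.1 hh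
    simp [hf, hg]
  · intro h
    exact ⟨h f (Submodule.subset_span (by simp)), h g (Submodule.subset_span (by simp))⟩

lemma baseLocus_eq_of_span_eq {f g f' g' : Quadric}
    (h : Submodule.span ℂ {f, g} = Submodule.span ℂ {f', g'}) :
    baseLocus f g = baseLocus f' g' := by
  ext p
  rw [mem_baseLocus_iff_span, mem_baseLocus_iff_span, h]

/-- The differential of a quadratic form at `p`, as a linear function of the form. -/
noncomputable def polarAt (p : Vec) : Quadric →ₗ[ℂ] Module.Dual ℂ Vec where
  toFun f := f.polarBilin p
  map_add' f g := by
    refine LinearMap.ext fun w => ?_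
    simp [QuadraticMap.polar_add]
  map_smul' c f := by
    refine LinearMap.ext fun w => ?_
    simp [QuadraticMap.polar_smul]

lemma polarAt_span (p : Vec) (f g : Quadric) :
    (Submodule.span ℂ {f, g}).map (polarAt p) =
      Submodule.span ℂ {f.polarBilin p, g.polarBilin p} := by
  rw [Submodule.map_span, Set.image_pair]; rfl

lemma isSingularPoint_of_span_eq {f g f' g' : Quadric}
    (h : Submodule.span ℂ {f, g} = Submodule.span ℂ {f', g'}) {p : Vec}
    (hp : IsSingularPoint f g p) : IsSingularPoint f' g' p := by
  refine ⟨hp.1, baseLocus_eq_of_span_eq h ▸ hp.2.1, fun hl => hp.2.2 ?_⟩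
  refine linearIndependent_pair_of_span_eq hl ?_
  rw [← polarAt_span, ← polarAt_span, h]

lemma isA1Point_of_span_eq {f g f' g' : Quadric}
    (h : Submodule.span ℂ {f, g} = Submodule.span ℂ {f', g'}) {p : Vec}
    (hp : IsA1Point f g p) : IsA1Point f' g' p := by
  obtain ⟨h0, h1, H, K, hs, h2⟩ := hp
  exact ⟨h0, baseLocus_eq_of_span_eq h ▸ h1, H, K, hs.trans h, h2⟩

lemma IsA1Point.of_act {A : SL(4, ℂ)} {f g : Quadric} {p : Vec}
    (hp : IsA1Point (act A f) (act A g) p) :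
    IsA1Point f g ((A : Matrix (Fin 4) (Fin 4) ℂ).mulVec p) := by
  obtain ⟨h0, h1, H, K, hs, h2, h3, h4⟩ := hp
  have hsurj := mulVec_surjective A
  have hinj := mulVec_injective A
  have key (H : Quadric) (v w : Vec) : (act A⁻¹ H).polarBilin
      ((A : Matrix (Fin 4) (Fin 4) ℂ).mulVec v) ((A : Matrix (Fin 4) (Fin 4) ℂ).mulVec w) =
      H.polarBilin v w := by
    rw [← act_polarBilin, act_act_inv]
  refine ⟨fun h => h0 (hinj (h.trans (Matrix.mulVec_zero _).symm)), h1, act A⁻¹ H, act A⁻¹ K,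
    ?_, ?_, ?_, ?_⟩
  · rw [← map_act_span, hs, map_act_span, act_inv_act, act_inv_act]
  · refine LinearMap.ext fun w => ?_
    obtain ⟨w, rfl⟩ := hsurj w
    rw [key, h2]; rfl
  · intro h
    apply h3
    refine LinearMap.ext fun w => ?_
    rw [← key, h]; rfl
  · intro v hv hw
    obtain ⟨v, rfl⟩ := hsurj v
    rw [key] at hv
    have := h4 v hv (fun w hKw => by
      rw [← key]
      exact hw _ (by rw [key]; exact hKw))
    obtain ⟨c, rfl⟩ := Submodule.mem_span_singleton.1 this
    exact Submodule.mem_span_singleton.2 ⟨c, by rw [Matrix.mulVec_smul]⟩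

lemma hasSingularBaseLocus_of_projEquiv {f g f' g' : Quadric} (h : ProjEquiv f g f' g')
    (hs : HasSingularBaseLocus f' g') : HasSingularBaseLocus f g := by
  obtain ⟨A, hA⟩ := h
  obtain ⟨p, hp⟩ := hs
  exact ⟨_, (isSingularPoint_act A f g p).1 (isSingularPoint_of_span_eq hA.symm hp)⟩

lemma isA1Point_smul {f g : Quadric} {p : Vec} {c : ℂ} (hc : c ≠ 0) (hp : IsA1Point f g p) :
    IsA1Point f g (c • p) := by
  obtain ⟨h0, h1, H, K, hs, h2, h3, h4⟩ := hp
  refine ⟨smul_ne_zero hc h0, ?_, H, K, hs, by rw [map_smul, h2, smul_zero], ?_, ?_⟩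
  · exact ⟨by rw [QuadraticMap.map_smul, h1.1, smul_zero],
      by rw [QuadraticMap.map_smul, h1.2, smul_zero]⟩
  · rw [map_smul]; exact smul_ne_zero hc h3
  · have key (w : Vec) : K.polarBilin (c • p) w = 0 ↔ K.polarBilin p w = 0 := by
      simp only [map_smul, LinearMap.smul_apply, smul_eq_mul, mul_eq_zero, hc, false_or]
    intro v hv hw
    obtain ⟨a, rfl⟩ := Submodule.mem_span_singleton.1
      (h4 v ((key v).1 hv) fun w hKw => hw w ((key w).2 hKw))
    exact Submodule.mem_span_singleton.2 ⟨a / c, by rw [smul_smul, div_mul_cancel₀ _ hc]⟩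

lemma SingularExactlyA1At.of_span_eq {f g f' g' : Quadric} {P : Set Vec}
    (h : SingularExactlyA1At f g P) (hs : Submodule.span ℂ {f, g} = Submodule.span ℂ {f', g'}) :
    SingularExactlyA1At f' g' P :=
  ⟨fun u hu => isA1Point_of_span_eq hs (h.1 u hu),
    fun p hp => h.2 p (isSingularPoint_of_span_eq hs.symm hp)⟩

/-- The singular points may be computed after a coordinate change carrying the set `P'` to scalar
multiples of the set `P`. -/
lemma SingularExactlyA1At.of_projEquiv {A : SL(4, ℂ)} {f g f' g' : Quadric} {P P' : Set Vec}
    (hs : Submodule.span ℂ {act A f, act A g} = Submodule.span ℂ {f', g'})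
    (h : SingularExactlyA1At f' g' P')
    (h1 : ∀ u ∈ P, ∃ u' ∈ P', ∃ c : ℂ, c ≠ 0 ∧
      u = c • (A : Matrix (Fin 4) (Fin 4) ℂ).mulVec u')
    (h2 : ∀ u' ∈ P', ∃ u ∈ P, ∃ c : ℂ,
      (A : Matrix (Fin 4) (Fin 4) ℂ).mulVec u' = c • u) : SingularExactlyA1At f g P := by
  constructor
  · intro u hu
    obtain ⟨u', hu', c, hc, rfl⟩ := h1 u hu
    exact isA1Point_smul hc (isA1Point_of_span_eq hs.symm (h.1 u' hu')).of_act
  · intro p hp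
    have hp' : IsSingularPoint f' g'
        (((A⁻¹ : SL(4, ℂ)) : Matrix (Fin 4) (Fin 4) ℂ).mulVec p) := by
      refine isSingularPoint_of_span_eq hs ((isSingularPoint_act A f g _).2 ?_)
      rwa [mulVec_inv_mulVec]
    obtain ⟨u', hu', hpu⟩ := h.2 _ hp'
    obtain ⟨u, hu, c, hc⟩ := h2 u' hu'
    obtain ⟨a, ha⟩ := Submodule.mem_span_singleton.1 hpu
    refine ⟨u, hu, Submodule.mem_span_singleton.2 ⟨a * c, ?_⟩⟩
    have := congrArg (A : Matrix (Fin 4) (Fin 4) ℂ).mulVec ha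
    rw [mulVec_inv_mulVec, Matrix.mulVec_smul, hc, smul_smul] at this
    exact this

/-! ### The families in terms of Gram matrices -/

lemma family1_iff (f g : Quadric) : Family1 f g ↔ gram f 0 0 = 0 ∧ ∀ i, gram g 0 i = 0 := by
  constructor
  · rintro ⟨l₁, l₂, l₃, q₁, hf, hg⟩
    refine ⟨?_, fun i => ?_⟩
    · simp [gram_apply, QuadraticMap.polar, hf, e]
    · have h0 : q₁ ![0, 0, 0] = 0 := by
        convert q₁.map_zero using 2
        ext i; fin_cases i <;> rfl
      simp [gram_apply, QuadraticMap.polar, hg, e, h0]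
  · rintro ⟨hf, hg⟩
    have hg' (i : Fin 4) : gram g i 0 = 0 := by rw [gram_comm, hg]
    refine ⟨∑ i, (![gram f 0 3, gram f 1 3, gram f 2 3, gram f 3 3 / 2] i) • LinearMap.proj i,
      ∑ i, (![gram f 0 2, gram f 1 2, gram f 2 2 / 2] i) • LinearMap.proj i,
      ∑ i, (![gram f 0 1, gram f 1 1 / 2] i) • LinearMap.proj i,
      ((1 / 2 : ℂ) • (Matrix.of fun i j : Fin 3 => gram g i.succ j.succ)).toQuadraticForm',
      fun x => ?_, fun x => ?_⟩
    · simp [apply_eq_sum, Fin.sum_univ_succ, hf, gram_comm f 1 0, gram_comm f 2 0,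
        gram_comm f 3 0, gram_comm f 2 1, gram_comm f 3 1, gram_comm f 3 2]
      ring
    · simp [apply_eq_sum, Fin.sum_univ_succ, hg, hg', Matrix.toQuadraticForm',
        Matrix.toLinearMap₂'_apply]
      ring

lemma family2_iff (f g : Quadric) :
    Family2 f g ↔ (∀ i, gram g 0 i = 0) ∧ ∀ i, gram g 1 i = 0 := by
  constructor
  · rintro ⟨q₂, q₃, hf, hg⟩
    have h0 : q₃ ![0, 0] = 0 := by
      convert q₃.map_zero using 2
      ext i; fin_cases i <;> rfl
    refine ⟨fun i => ?_, fun i => ?_⟩ <;> simp [gram_apply, QuadraticMap.polar, hg, e, h0]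
  · rintro ⟨hg, hg1⟩
    have hg' (i : Fin 4) : gram g i 0 = 0 := by rw [gram_comm, hg]
    have hg1' (i : Fin 4) : gram g i 1 = 0 := by rw [gram_comm, hg1]
    refine ⟨f, ((1 / 2 : ℂ) • !![gram g 2 2, gram g 2 3; gram g 3 2, gram g 3 3]).toQuadraticForm',
      fun x => ?_, fun x => ?_⟩
    · congr 1; ext i; fin_cases i <;> rfl
    · rw [apply_eq_sum]
      simp [Fin.sum_univ_four, hg, hg', hg1, hg1', Matrix.toQuadraticForm',
        Matrix.toLinearMap₂'_apply]
      ring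

lemma family3_iff (f g : Quadric) :
    Family3 f g ↔ (gram f 0 0 = 0 ∧ gram f 0 1 = 0 ∧ gram f 1 1 = 0) ∧
      (gram g 0 0 = 0 ∧ gram g 0 1 = 0 ∧ gram g 1 1 = 0) := by
  have key (f : Quadric) : (∃ (l : Module.Dual ℂ (Fin 4 → ℂ)) (m : Module.Dual ℂ (Fin 3 → ℂ)),
      ∀ x, f x = x 3 * l ![x 0, x 1, x 2, x 3] + x 2 * m ![x 0, x 1, x 2]) ↔
      (gram f 0 0 = 0 ∧ gram f 0 1 = 0 ∧ gram f 1 1 = 0) := by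
    constructor
    · rintro ⟨l, m, hf⟩
      refine ⟨?_, ?_, ?_⟩ <;> simp [gram_apply, QuadraticMap.polar, hf, e]
    · rintro ⟨h0, h1, h2⟩
      refine ⟨∑ i, (![gram f 0 3, gram f 1 3, gram f 2 3, gram f 3 3 / 2] i) • LinearMap.proj i,
        ∑ i, (![gram f 0 2, gram f 1 2, gram f 2 2 / 2] i) • LinearMap.proj i, fun x => ?_⟩
      simp [apply_eq_sum, Fin.sum_univ_succ, h0, h1, h2, gram_comm f 1 0, gram_comm f 2 0,
        gram_comm f 3 0, gram_comm f 2 1, gram_comm f 3 1, gram_comm f 3 2]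
      ring
  rw [← key, ← key]
  constructor
  · rintro ⟨l₄, l₆, l₅, l₇, hf, hg⟩
    exact ⟨⟨l₄, l₅, hf⟩, ⟨l₆, l₇, hg⟩⟩
  · rintro ⟨⟨l₄, l₅, hf⟩, ⟨l₆, l₇, hg⟩⟩
    exact ⟨l₄, l₆, l₅, l₇, hf, hg⟩

lemma family4_iff (f g : Quadric) :
    Family4 f g ↔ (gram f 0 0 = 0 ∧ gram f 0 1 = 0 ∧ gram f 0 2 = 0) ∧
      (gram g 0 0 = 0 ∧ gram g 0 1 = 0 ∧ gram g 0 2 = 0) := by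
  have key (f : Quadric) : (∃ (l : Module.Dual ℂ (Fin 4 → ℂ)) (q : QuadraticForm ℂ (Fin 2 → ℂ)),
      ∀ x, f x = x 3 * l ![x 0, x 1, x 2, x 3] + q ![x 1, x 2]) ↔
      (gram f 0 0 = 0 ∧ gram f 0 1 = 0 ∧ gram f 0 2 = 0) := by
    constructor
    · rintro ⟨l, q, hf⟩
      have h0 : q ![0, 0] = 0 := by
        convert q.map_zero using 2
        ext i; fin_cases i <;> rfl
      refine ⟨?_, ?_, ?_⟩ <;> simp [gram_apply, QuadraticMap.polar, hf, e, h0]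
    · rintro ⟨h0, h1, h2⟩
      refine ⟨∑ i, (![gram f 0 3, gram f 1 3, gram f 2 3, gram f 3 3 / 2] i) • LinearMap.proj i,
        ((1 / 2 : ℂ) • !![gram f 1 1, gram f 1 2; gram f 2 1, gram f 2 2]).toQuadraticForm',
        fun x => ?_⟩
      simp [apply_eq_sum, Fin.sum_univ_succ, h0, h1, h2, gram_comm f 1 0, gram_comm f 2 0,
        gram_comm f 3 0, gram_comm f 2 1, gram_comm f 3 1, gram_comm f 3 2,
        Matrix.toQuadraticForm', Matrix.toLinearMap₂'_apply]
      ring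
  rw [← key, ← key]
  constructor
  · rintro ⟨l₈, l₉, q₄, q₅, hf, hg⟩
    exact ⟨⟨l₈, q₄, hf⟩, ⟨l₉, q₅, hg⟩⟩
  · rintro ⟨⟨l₈, q₄, hf⟩, ⟨l₉, q₅, hg⟩⟩
    exact ⟨l₈, l₉, q₄, q₅, hf, hg⟩

/-! ### Singular base loci and the four families -/

lemma dual_ext {φ ψ : Module.Dual ℂ Vec} (h : ∀ i, φ (e i) = ψ (e i)) : φ = ψ := by
  refine LinearMap.ext fun v => ?_
  rw [sum_smul_e v]
  simp [h]

lemma polarBilin_apply_e (f : Quadric) (p : Vec) (i : Fin 4) :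
    f.polarBilin p (e i) = ∑ j, p j * gram f j i := by
  rw [polarBilin_eq_sum]
  simp [e, Pi.single_apply]

lemma e_ne_zero (i : Fin 4) : e i ≠ 0 := by
  intro h
  simpa [e] using congrFun h i

lemma apply_e (f : Quadric) (i : Fin 4) : f (e i) = gram f i i / 2 := by
  rw [gram_apply, polarBilin_self]; ring

/-- A binary quadratic form has a nontrivial zero. -/
lemma exists_binary_root (a b c : ℂ) :
    ∃ s t : ℂ, ¬ (s = 0 ∧ t = 0) ∧ a * s ^ 2 + b * s * t + c * t ^ 2 = 0 := by
  by_cases ha : a = 0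
  · exact ⟨1, 0, by simp, by simp [ha]⟩
  · obtain ⟨r, hr⟩ := IsAlgClosed.exists_pow_nat_eq (b ^ 2 - 4 * a * c) (n := 2) (by norm_num)
    refine ⟨(-b + r) / (2 * a), 1, by simp, ?_⟩
    field_simp
    linear_combination hr

lemma not_linearIndependent_of_right_eq_zero {φ ψ : Module.Dual ℂ Vec} (h : ψ = 0) :
    ¬ LinearIndependent ℂ ![φ, ψ] := fun hl => hl.ne_zero 1 h

lemma hasSingularBaseLocus_of_family1 {f g : Quadric} (h : Family1 f g) :
    HasSingularBaseLocus f g := by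
  rw [family1_iff] at h
  refine ⟨e 0, e_ne_zero 0, ⟨by rw [apply_e, h.1, zero_div], by rw [apply_e, h.2, zero_div]⟩, ?_⟩
  refine not_linearIndependent_of_right_eq_zero (dual_ext fun i => ?_)
  exact h.2 i

lemma hasSingularBaseLocus_of_family2 {f g : Quadric} (h : Family2 f g) :
    HasSingularBaseLocus f g := by
  rw [family2_iff] at h
  obtain ⟨s, t, hst, hroot⟩ := exists_binary_root (gram f 0 0) (2 * gram f 0 1) (gram f 1 1)
  have hg : g.polarBilin ![s, t, 0, 0] = 0 := by
    refine dual_ext fun i => ?_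
    rw [polarBilin_apply_e]
    simp [Fin.sum_univ_four, h.1, h.2]
  refine ⟨![s, t, 0, 0], fun h0 => hst ⟨congrFun h0 0, congrFun h0 1⟩, ⟨?_, ?_⟩,
    not_linearIndependent_of_right_eq_zero hg⟩
  · rw [apply_eq_sum]
    simp [Fin.sum_univ_four, gram_comm f 1 0]
    linear_combination hroot
  · rw [apply_eq_zero_iff, hg]; rfl

lemma hasSingularBaseLocus_of_family3 {f g : Quadric} (h : Family3 f g) :
    HasSingularBaseLocus f g := by
  rw [family3_iff] at h
  obtain ⟨⟨f0, f1, f2⟩, ⟨g0, g1, g2⟩⟩ := h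
  -- the Jacobian determinant along the line `x₂ = x₃ = 0`
  obtain ⟨s, t, hst, hroot⟩ := exists_binary_root
    (gram f 0 2 * gram g 0 3 - gram f 0 3 * gram g 0 2)
    (gram f 0 2 * gram g 1 3 + gram f 1 2 * gram g 0 3 - gram f 0 3 * gram g 1 2
      - gram f 1 3 * gram g 0 2)
    (gram f 1 2 * gram g 1 3 - gram f 1 3 * gram g 1 2)
  refine ⟨![s, t, 0, 0], fun h0 => hst ⟨congrFun h0 0, congrFun h0 1⟩, ⟨?_, ?_⟩, ?_⟩
  · rw [apply_eq_sum]
    simp [Fin.sum_univ_four, gram_comm f 1 0, f0, f1, f2]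
  · rw [apply_eq_sum]
    simp [Fin.sum_univ_four, gram_comm g 1 0, g0, g1, g2]
  · intro hl
    rw [LinearIndependent.pair_iff] at hl
    have key (x y : ℂ)
        (h2 : x * (s * gram f 0 2 + t * gram f 1 2) + y * (s * gram g 0 2 + t * gram g 1 2) = 0)
        (h3 : x * (s * gram f 0 3 + t * gram f 1 3) + y * (s * gram g 0 3 + t * gram g 1 3) = 0) :
        x = 0 ∧ y = 0 := by
      refine hl x y (dual_ext fun i => ?_)
      simp only [LinearMap.add_apply, LinearMap.smul_apply, polarBilin_apply_e, Fin.sum_univ_four]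
      fin_cases i
      · simp [f0, f1, g0, g1, gram_comm f 1 0, gram_comm g 1 0]
      · simp [f1, f2, g1, g2]
      · simpa using h2
      · simpa using h3
    obtain ⟨a1, a2⟩ := key (s * gram g 0 2 + t * gram g 1 2) (-(s * gram f 0 2 + t * gram f 1 2))
      (by ring) (by linear_combination -hroot)
    obtain ⟨a3, a4⟩ := key (s * gram g 0 3 + t * gram g 1 3) (-(s * gram f 0 3 + t * gram f 1 3))
      (by linear_combination hroot) (by ring)
    rw [neg_eq_zero] at a2 a4
    have := (key 1 0 (by rw [a2]; ring) (by rw [a4]; ring)).1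
    exact one_ne_zero this

lemma hasSingularBaseLocus_of_family4 {f g : Quadric} (h : Family4 f g) :
    HasSingularBaseLocus f g := by
  rw [family4_iff] at h
  obtain ⟨⟨f0, f1, f2⟩, ⟨g0, g1, g2⟩⟩ := h
  refine ⟨e 0, e_ne_zero 0, ⟨by rw [apply_e, f0, zero_div], by rw [apply_e, g0, zero_div]⟩, ?_⟩
  intro hl
  rw [LinearIndependent.pair_iff] at hl
  have key (x y : ℂ) (hxy : x * gram f 0 3 + y * gram g 0 3 = 0) : x = 0 ∧ y = 0 := by
    refine hl x y (dual_ext fun i => ?_)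
    simp only [LinearMap.add_apply, LinearMap.smul_apply, ← gram_apply]
    fin_cases i
    · simp [f0, g0]
    · simp [f1, g1]
    · simp [f2, g2]
    · simpa using hxy
  obtain ⟨a1, a2⟩ := key (gram g 0 3) (-gram f 0 3) (by ring)
  rw [neg_eq_zero] at a2
  exact one_ne_zero (key 1 0 (by simp [a2])).1

/-- At a singular point of the base locus the differentials of all members of the pencil are
multiples of one linear form. -/
lemma IsSingularPoint.exists_common_tangent {f g : Quadric} {p : Vec}
    (h : IsSingularPoint f g p) :
    ∃ (l : Module.Dual ℂ Vec) (a b : ℂ), l ≠ 0 ∧ l p = 0 ∧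
      f.polarBilin p = a • l ∧ g.polarBilin p = b • l := by
  obtain ⟨hp, ⟨hf, hg⟩, hl⟩ := h
  rw [apply_eq_zero_iff] at hf hg
  by_cases hf0 : f.polarBilin p = 0
  · by_cases hg0 : g.polarBilin p = 0
    · obtain ⟨i, hi⟩ : ∃ i, p i ≠ 0 := by
        by_contra! hcon
        exact hp (funext hcon)
      obtain ⟨j, hj⟩ : ∃ j, j ≠ i := exists_ne i
      refine ⟨p i • LinearMap.proj j - p j • LinearMap.proj i, 0, 0, ?_, ?_, by simpa, by simpa⟩
      · intro h0
        have := LinearMap.congr_fun h0 (e j)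
        simp [e, hi, hj.symm] at this
      · simp [mul_comm]
    · exact ⟨g.polarBilin p, 0, 1, hg0, hg, by simpa, by simp⟩
  · rw [LinearIndependent.pair_iff' hf0] at hl
    push Not at hl
    obtain ⟨a, ha⟩ := hl
    exact ⟨f.polarBilin p, 1, a, hf0, hf, by simp, ha.symm⟩

/-- A vector is the first member of a basis whose next two members lie in a given plane. -/
lemma exists_adapted_basis {p : Vec} (hp : p ≠ 0) {l : Module.Dual ℂ Vec} (hl : l ≠ 0) :
    ∃ b : Fin 4 → Vec, LinearIndependent ℂ b ∧ b 0 = p ∧ l (b 1) = 0 ∧ l (b 2) = 0 := by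
  have hker : Module.finrank ℂ (LinearMap.ker l) = 3 := by
    have h1 := LinearMap.finrank_range_add_finrank_ker l
    have h2 : Module.finrank ℂ (LinearMap.range l) = 1 := by
      rw [LinearMap.range_eq_top.2 (LinearMap.surjective hl)]
      simp
    rw [h2] at h1
    simp only [Module.finrank_fin_fun] at h1
    omega
  have h1 : LinearIndependent ℂ ![p] := by
    rw [linearIndependent_unique_iff]
    exact hp
  obtain ⟨x, hx, h2⟩ := exists_snoc_linearIndependent h1 (LinearMap.ker l) (by omega)
  obtain ⟨y, hy, h3⟩ := exists_snoc_linearIndependent h2 (LinearMap.ker l) (by omega)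
  obtain ⟨z, -, h4⟩ := exists_snoc_linearIndependent h3 ⊤ (by simp)
  exact ⟨_, h4, rfl, hx, hy⟩

/-- Move the singular point to `(1 : 0 : 0 : 0)` and the common tangent plane to `x₃ = 0`. -/
lemma generatedBy_family4_of_singular {f g : Quadric} (h : HasSingularBaseLocus f g) :
    GeneratedBy Family4 f g := by
  obtain ⟨p, hp⟩ := h
  obtain ⟨l, a, b, hl, hlp, hf, hg⟩ := hp.exists_common_tangent
  obtain ⟨v, hv, rfl, h1, h2⟩ := exists_adapted_basis hp.1 hl
  obtain ⟨A, d, hd, hA⟩ := exists_SL_of_basis hv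
  refine ⟨act A f, act A g, ?_, A, rfl⟩
  rw [family4_iff]
  simp [-QuadraticMap.polarBilin_apply_apply, gram_act_of_basis hA, hf, hg, h1, h2, hlp]

/-- Move the singular point to `(1 : 0 : 0 : 0)`; the member of the pencil which is singular there
serves as the second generator. -/
lemma generatedBy_family1_of_singular {f g : Quadric} (h : HasSingularBaseLocus f g) :
    GeneratedBy Family1 f g := by
  obtain ⟨p, hp⟩ := h
  obtain ⟨l, a, b, hl, hlp, hf, hg⟩ := hp.exists_common_tangent
  obtain ⟨v, hv, rfl, -, -⟩ := exists_adapted_basis hp.1 hl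
  obtain ⟨A, d, hd, hA⟩ := exists_SL_of_basis hv
  have hfam (x y : ℂ) (F G : Quadric) (hF : F.polarBilin (v 0) = x • l)
      (hG : G.polarBilin (v 0) = y • l) (hy : y = 0) : Family1 (act A F) (act A G) := by
    rw [family1_iff]
    simp [-QuadraticMap.polarBilin_apply_apply, gram_act_of_basis hA, hF, hG, hlp, hy]
  by_cases ha : a = 0
  · exact ⟨act A g, act A f, hfam b a g f hg hf ha, A, by rw [Set.pair_comm]⟩
  · refine ⟨act A f, act A ((-b) • f + a • g), hfam a (-b * a + a * b) _ _ hf ?_ (by ring), A, ?_⟩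
    · rw [polarBilin_add_smul]
      simp only [LinearMap.add_apply, LinearMap.smul_apply, hf, hg]
      module
    · rw [map_add, map_smul, map_smul]
      have := span_combination_eq (act A f) (act A g) (a := 1) (b := 0) (c := -b) (d := a)
        (by simpa using ha)
      rw [← this]; simp

lemma hasSingularBaseLocus_of_generatedBy {F : Quadric → Quadric → Prop}
    (hF : ∀ f g, F f g → HasSingularBaseLocus f g) {f g : Quadric} (h : GeneratedBy F f g) :
    HasSingularBaseLocus f g := by
  obtain ⟨f', g', h1, h2⟩ := h
  exact hasSingularBaseLocus_of_projEquiv h2 (hF _ _ h1)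

/-! ### One-parameter subgroups and closed orbits -/

/-- A closed orbit contains the limit at `0` of any continuous curve lying in it away from `0`. -/
lemma mem_orbit_of_continuous {w : ⋀[ℂ]^2 Quadric} (hw : IsClosed (orbit w))
    {φ : ℂ → ⋀[ℂ]^2 Quadric} (hφ : Continuous φ) (h : ∀ s ≠ 0, φ s ∈ orbit w) : φ 0 ∈ orbit w := by
  have hcl : IsClosed (φ ⁻¹' orbit w) := hw.preimage hφ
  have hd : Dense ({0}ᶜ : Set ℂ) := dense_compl_singleton 0
  have hsub : closure ({0}ᶜ : Set ℂ) ⊆ φ ⁻¹' orbit w :=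
    closure_minimal (fun s hs => h s hs) hcl
  exact hsub (by rw [hd.closure_eq]; trivial)

/-- If the weights of a one-parameter subgroup on a pair of forms are nonnegative after a shift of
total weight zero, its limit lies in the closed orbit. Here `M s` and `N s` are the
Gram matrices along the subgroup, extended to `s = 0`. -/
lemma limit_mem_orbit {f g : Quadric} (hcl : IsClosed (orbit (wedge f g)))
    {M N : ℂ → Matrix (Fin 4) (Fin 4) ℂ} (hM : Continuous M) (hN : Continuous N)
    (h : ∀ s ≠ 0, ∃ (A : SL(4, ℂ)) (c d : ℂ), c * d = 1 ∧ gram (c • act A f) = M s ∧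
      gram (d • act A g) = N s) :
    wedge (quad ((1 / 2 : ℂ) • M 0)) (quad ((1 / 2 : ℂ) • N 0)) ∈ orbit (wedge f g) := by
  have hM' : Continuous fun s => (1 / 2 : ℂ) • M s := hM.const_smul (1 / 2 : ℂ)
  have hN' : Continuous fun s => (1 / 2 : ℂ) • N s := hN.const_smul (1 / 2 : ℂ)
  have hc : Continuous fun s => wedge (quad ((1 / 2 : ℂ) • M s)) (quad ((1 / 2 : ℂ) • N s)) :=
    Continuous.comp (g := fun p : (Fin 4 → Fin 4 → ℂ) × (Fin 4 → Fin 4 → ℂ) => wedgeQuad p.1 p.2)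
      (f := fun s => ((1 / 2 : ℂ) • M s, (1 / 2 : ℂ) • N s)) continuous_wedgeQuad (hM'.prodMk hN')
  refine mem_orbit_of_continuous
    (φ := fun s => wedge (quad ((1 / 2 : ℂ) • M s)) (quad ((1 / 2 : ℂ) • N s)))
    hcl hc fun s hs => ?_
  obtain ⟨A, c, d, hcd, hf, hg⟩ := h s hs
  refine ⟨A, ?_⟩
  rw [← hf, ← hg, quad_gram, quad_gram, wedge_smul_left, wedge_smul_right, smul_smul, hcd,
    one_smul]
  exact actWedge_wedge A f g

/-- The Plücker coordinates determine the pencil. -/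
lemma span_eq_of_wedge_eq {f g f' g' : Quadric} (hp : IsPencil f g)
    (h : wedge f g = wedge f' g') : Submodule.span ℂ {f, g} = Submodule.span ℂ {f', g'} := by
  have hpl (c d : Fin 4 × Fin 4) : gramEntry c f * gramEntry d g - gramEntry d f * gramEntry c g
      = gramEntry c f' * gramEntry d g' - gramEntry d f' * gramEntry c g' := by
    rw [← plucker_wedge, h, plucker_wedge]
  obtain ⟨x, y, hxy⟩ := hp.exists_minor_ne_zero
  have hxy' := hpl x y ▸ hxy
  have hcomb (z : Fin 4 × Fin 4) : gramEntry z g • f + (-gramEntry z f) • g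
      = gramEntry z g' • f' + (-gramEntry z f') • g' := by
    apply gram_injective
    ext i j
    have := hpl (i, j) z
    simp only [gramEntry_apply] at this ⊢
    simp
    linear_combination this
  rw [← span_combination_eq f g (a := gramEntry y g) (b := -gramEntry y f)
      (c := gramEntry x g) (d := -gramEntry x f) (by
        intro h0; apply hxy; linear_combination -h0),
    ← span_combination_eq f' g' (a := gramEntry y g') (b := -gramEntry y f')
      (c := gramEntry x g') (d := -gramEntry x f') (by
        intro h0; apply hxy'; linear_combination -h0), hcomb, hcomb]

lemma projEquiv_of_wedge_mem_orbit {f g f' g' : Quadric} (hp : IsPencil f g)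
    (h : wedge f' g' ∈ orbit (wedge f g)) : ProjEquiv f g f' g' := by
  obtain ⟨A, hA⟩ := h
  beta_reduce at hA
  rw [actWedge_wedge] at hA
  exact ⟨A, span_eq_of_wedge_eq (hp.act A) hA⟩

lemma zero_not_mem_orbit {f g : Quadric} (hp : IsPencil f g) : 0 ∉ orbit (wedge f g) := by
  rintro ⟨A, hA⟩
  beta_reduce at hA
  rw [actWedge_wedge] at hA
  exact (wedge_ne_zero_iff _ _).2 (hp.act A) hA

/-! ### Degenerations of pencils with singular base locus -/

lemma gram_quad_half {N : Matrix (Fin 4) (Fin 4) ℂ} (h : N.transpose = N) :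
    gram (quad ((1 / 2 : ℂ) • N)) = N := by
  rw [gram_quad, Matrix.transpose_smul, h, ← add_smul]
  norm_num

/-- The Gram matrix of `α x₀ x₃ + (a x₁² + 2 b x₁ x₂ + c x₂²) / 2`. -/
def splitMatrix (α a b c : ℂ) : Matrix (Fin 4) (Fin 4) ℂ :=
  !![0, 0, 0, α; 0, a, b, 0; 0, b, c, 0; α, 0, 0, 0]

lemma splitMatrix_transpose (α a b c : ℂ) :
    (splitMatrix α a b c).transpose = splitMatrix α a b c := by
  ext i j
  fin_cases i <;> fin_cases j <;> rfl

/-- The form `α x₀ x₃ + (a x₁² + 2 b x₁ x₂ + c x₂²) / 2`. -/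
noncomputable def splitForm (α a b c : ℂ) : Quadric :=
  quad ((1 / 2 : ℂ) • splitMatrix α a b c)

lemma gram_splitForm (α a b c : ℂ) : gram (splitForm α a b c) = splitMatrix α a b c :=
  gram_quad_half (splitMatrix_transpose α a b c)

/-- The subgroup with weights `(-1, 0, 0, 1)` degenerates a member of Family 4 to a pair of forms
without mixed terms between `x₀, x₃` and `x₁, x₂`. -/
lemma Family4.split_mem_orbit {f g : Quadric} (h : Family4 f g)
    (hcl : IsClosed (orbit (wedge f g))) :
    wedge (splitForm (gram f 0 3) (gram f 1 1) (gram f 1 2) (gram f 2 2))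
      (splitForm (gram g 0 3) (gram g 1 1) (gram g 1 2) (gram g 2 2)) ∈ orbit (wedge f g) := by
  rw [family4_iff] at h
  obtain ⟨⟨f0, f1, f2⟩, ⟨g0, g1, g2⟩⟩ := h
  -- the Gram matrices after the substitution `x₀ ↦ s⁻¹ x₀`, `x₃ ↦ s x₃`
  let M (F : Quadric) (s : ℂ) : Matrix (Fin 4) (Fin 4) ℂ :=
    !![0, 0, 0, gram F 0 3; 0, gram F 1 1, gram F 1 2, s * gram F 1 3;
      0, gram F 1 2, gram F 2 2, s * gram F 2 3;
      gram F 0 3, s * gram F 1 3, s * gram F 2 3, s ^ 2 * gram F 3 3]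
  have hM (F : Quadric) : Continuous (M F) := by
    refine continuous_matrix fun i j => ?_
    fin_cases i <;> fin_cases j <;> simp [M] <;> fun_prop
  have hM0 (F : Quadric) : M F 0 =
      splitMatrix (gram F 0 3) (gram F 1 1) (gram F 1 2) (gram F 2 2) := by
    ext i j
    fin_cases i <;> fin_cases j <;> simp [M, splitMatrix]
  have key := limit_mem_orbit hcl (hM f) (hM g) fun s hs => by
    refine ⟨diag ![s⁻¹, 1, 1, s] (by simp [hs]), 1, 1, one_mul 1, ?_, ?_⟩
    · rw [one_smul]
      ext i j
      rw [gram_act_diag]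
      fin_cases i <;> fin_cases j <;>
        simp [M, f0, f1, f2, hs, gram_comm f 1 0, gram_comm f 2 0,
        gram_comm f 3 0, gram_comm f 2 1, gram_comm f 3 1, gram_comm f 3 2, sq]
    · rw [one_smul]
      ext i j
      rw [gram_act_diag]
      fin_cases i <;> fin_cases j <;>
        simp [M, g0, g1, g2, hs, gram_comm g 1 0, gram_comm g 2 0,
        gram_comm g 3 0, gram_comm g 2 1, gram_comm g 3 1, gram_comm g 3 2, sq]
  rw [hM0, hM0] at key
  exact key

/-- The one-parameter subgroup with weights `(-1, 0, 0, 1)` stabilises every pair of split forms. -/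
lemma not_isStable_splitForm (α a b c α' a' b' c' : ℂ) :
    ¬ IsStable (splitForm α a b c) (splitForm α' a' b' c') := by
  rintro ⟨-, hfin⟩
  have hs (n : ℕ) : ((n : ℂ) + 1) ≠ 0 := by exact_mod_cast Nat.succ_ne_zero n
  refine Set.infinite_of_injective_forall_mem
    (f := fun n : ℕ => diag ![((n : ℂ) + 1)⁻¹, 1, 1, (n : ℂ) + 1] (by simp [hs])) ?_ ?_ hfin
  · intro m n hmn
    have := congrArg (fun A : SL(4, ℂ) => (A : Matrix (Fin 4) (Fin 4) ℂ) 3 3) hmn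
    simpa [diag] using this
  · intro n
    change actWedge _ _ = _
    have key (α a b c : ℂ) : act (diag ![((n : ℂ) + 1)⁻¹, 1, 1, (n : ℂ) + 1] (by simp [hs]))
        (splitForm α a b c) = splitForm α a b c := by
      apply gram_injective
      ext i j
      rw [gram_act_diag, gram_splitForm]
      have := hs n
      fin_cases i <;> fin_cases j <;> simp [splitMatrix, this]
    rw [actWedge_wedge, key, key]

/-- A stable pencil with singular base locus would be equivalent to its degeneration to split forms,
whose stabiliser is infinite. -/
lemma not_isStable_of_singular {f g : Quadric} (h : HasSingularBaseLocus f g) :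
    ¬ IsStable f g := by
  intro hst
  obtain ⟨f', g', hF, he⟩ := generatedBy_family4_of_singular h
  have hst' := he.isStable hst
  have hp := (wedge_ne_zero_iff _ _).1 hst'.1.1
  exact not_isStable_splitForm _ _ _ _ _ _ _ _
    ((projEquiv_of_wedge_mem_orbit hp (hF.split_mem_orbit hst'.1.2)).isStable hst')

lemma continuous_splitMatrix {α a b c : ℂ → ℂ} (hα : Continuous α) (ha : Continuous a)
    (hb : Continuous b) (hc : Continuous c) :
    Continuous fun s => splitMatrix (α s) (a s) (b s) (c s) := by
  refine continuous_matrix fun i j => ?_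
  fin_cases i <;> fin_cases j <;> simp [splitMatrix] <;> fun_prop

lemma splitForm_zero : splitForm 0 0 0 0 = 0 := by
  apply gram_injective
  rw [gram_splitForm, map_zero]
  ext i j
  fin_cases i <;> fin_cases j <;> rfl

/-- Degeneration of split forms along a diagonal one-parameter subgroup. -/
lemma splitForm_limit_mem_orbit {α a b c α' a' b' c' : ℂ}
    (hcl : IsClosed (orbit (wedge (splitForm α a b c) (splitForm α' a' b' c'))))
    {φ₀ φ₁ φ₂ φ₃ ψ₀ ψ₁ ψ₂ ψ₃ : ℂ → ℂ} (h₀ : Continuous φ₀) (h₁ : Continuous φ₁)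
    (h₂ : Continuous φ₂) (h₃ : Continuous φ₃) (k₀ : Continuous ψ₀) (k₁ : Continuous ψ₁)
    (k₂ : Continuous ψ₂) (k₃ : Continuous ψ₃)
    (h : ∀ s ≠ 0, ∃ x y z t u v : ℂ, x * y * z * t = 1 ∧ u * v = 1 ∧
      u * (x * t * α) = φ₀ s ∧ u * (y * y * a) = φ₁ s ∧ u * (y * z * b) = φ₂ s ∧
      u * (z * z * c) = φ₃ s ∧
      v * (x * t * α') = ψ₀ s ∧ v * (y * y * a') = ψ₁ s ∧ v * (y * z * b') = ψ₂ s ∧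
      v * (z * z * c') = ψ₃ s) :
    wedge (splitForm (φ₀ 0) (φ₁ 0) (φ₂ 0) (φ₃ 0)) (splitForm (ψ₀ 0) (ψ₁ 0) (ψ₂ 0) (ψ₃ 0)) ∈
      orbit (wedge (splitForm α a b c) (splitForm α' a' b' c')) := by
  refine limit_mem_orbit (M := fun s => splitMatrix (φ₀ s) (φ₁ s) (φ₂ s) (φ₃ s))
    (N := fun s => splitMatrix (ψ₀ s) (ψ₁ s) (ψ₂ s) (ψ₃ s)) hcl
    (continuous_splitMatrix h₀ h₁ h₂ h₃) (continuous_splitMatrix k₀ k₁ k₂ k₃) fun s hs => ?_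
  obtain ⟨x, y, z, t, u, v, hdet, huv, e0, e1, e2, e3, e4, e5, e6, e7⟩ := h s hs
  refine ⟨diag ![x, y, z, t] (by simpa using hdet), u, v, huv, ?_, ?_⟩
  · ext i j
    rw [map_smul, Matrix.smul_apply, gram_act_diag, gram_splitForm, ← e0, ← e1,
      ← e2, ← e3]
    fin_cases i <;> fin_cases j <;> simp [splitMatrix, mul_comm]
  · ext i j
    rw [map_smul, Matrix.smul_apply, gram_act_diag, gram_splitForm, ← e4, ← e5,
      ← e6, ← e7]
    fin_cases i <;> fin_cases j <;> simp [splitMatrix, mul_comm]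

/-- Two forms whose Gram matrices in a basis `b` are multiples of those of `f'` and `g'` generate a
pencil equivalent to the one generated by `f'` and `g'`. -/
lemma projEquiv_of_basis {f g f' g' : Quadric} {b : Fin 4 → Vec} (hb : LinearIndependent ℂ b)
    {x y : ℂ} (hx : x ≠ 0) (hy : y ≠ 0)
    (hf : ∀ i j, f.polarBilin (b i) (b j) = x * gram f' i j)
    (hg : ∀ i j, g.polarBilin (b i) (b j) = y * gram g' i j) :
    ∃ (A : SL(4, ℂ)) (d : ℂ), d ≠ 0 ∧
      (∀ i, (A : Matrix (Fin 4) (Fin 4) ℂ).mulVec (e i) = d • b i) ∧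
      (∃ x' : ℂ, x' ≠ 0 ∧ act A f = x' • f') ∧ (∃ y' : ℂ, y' ≠ 0 ∧ act A g = y' • g') ∧
      Submodule.span ℂ {act A f, act A g} = Submodule.span ℂ {f', g'} := by
  obtain ⟨A, d, hd, hA⟩ := exists_SL_of_basis hb
  have e1 : act A f = (d ^ 2 * x) • f' := by
    apply gram_injective
    ext i j
    rw [gram_act_of_basis hA, hf, map_smul, Matrix.smul_apply, smul_eq_mul]; ring
  have e2 : act A g = (d ^ 2 * y) • g' := by
    apply gram_injective
    ext i j
    rw [gram_act_of_basis hA, hg, map_smul, Matrix.smul_apply, smul_eq_mul]; ring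
  have hx' : d ^ 2 * x ≠ 0 := mul_ne_zero (pow_ne_zero 2 hd) hx
  have hy' : d ^ 2 * y ≠ 0 := mul_ne_zero (pow_ne_zero 2 hd) hy
  refine ⟨A, d, hd, hA, ⟨d ^ 2 * x, hx', e1⟩, ⟨d ^ 2 * y, hy', e2⟩, ?_⟩
  rw [e1, e2, ← span_combination_eq f' g' (a := d ^ 2 * x) (b := 0) (c := 0) (d := d ^ 2 * y)
    (by simpa using ⟨⟨hd, hx⟩, hd, hy⟩)]
  simp

lemma linearIndependent_of_det {b : Fin 4 → Vec} (h : (Matrix.of b).det ≠ 0) :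
    LinearIndependent ℂ b :=
  (Matrix.linearIndependent_rows_iff_isUnit (A := Matrix.of b)).2
    ((Matrix.isUnit_iff_isUnit_det _).2 h.isUnit)

lemma polarBilin_splitForm (α a b c : ℂ) (v w : Vec) : (splitForm α a b c).polarBilin v w =
    α * (v 0 * w 3 + v 3 * w 0) + a * v 1 * w 1 + b * (v 1 * w 2 + v 2 * w 1) + c * v 2 * w 2 := by
  rw [polarBilin_eq_sum, gram_splitForm]
  simp [Fin.sum_univ_four, splitMatrix]
  ring

/-- A pencil generated by `x₀ x₃` and a degenerate form in `x₁, x₂` is not polystable: after moving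
the kernel of the binary form to the `x₂`-axis, a one-parameter subgroup contracts it to zero. -/
lemma not_isPolystable_of_degenerate {α a b c : ℂ}
    (hp : IsPencil (splitForm α 0 0 0) (splitForm 0 a b c)) (h : a * c - b ^ 2 = 0) :
    ¬ IsPolystable (splitForm α 0 0 0) (splitForm 0 a b c) := by
  intro hps
  -- `(u, v)` spans the kernel of the binary form, and `(x, y)` completes it to a basis
  obtain ⟨u, v, huv, h1, h2⟩ : ∃ u v : ℂ, ¬ (u = 0 ∧ v = 0) ∧ a * u + b * v = 0 ∧
      b * u + c * v = 0 := by
    by_cases hb : a = 0 ∧ b = 0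
    · by_cases hc : c = 0
      · exact ⟨1, 0, by simp, by simp [hb], by simp [hb]⟩
      · exact ⟨1, 0, by simp, by simp [hb], by simp [hb]⟩
    · exact ⟨-b, a, by simpa [and_comm] using hb, by ring, by linear_combination h⟩
  obtain ⟨x, y, hxy⟩ : ∃ x y : ℂ, x * v - y * u = 1 := by
    by_cases hv : v = 0
    · have hu : u ≠ 0 := fun hu => huv ⟨hu, hv⟩
      exact ⟨0, -u⁻¹, by field_simp; simp⟩
    · exact ⟨v⁻¹, 0, by field_simp; simp⟩
  obtain ⟨A, -, -, -, -, -, hA⟩ := projEquiv_of_basis (f := splitForm α 0 0 0)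
    (g := splitForm 0 a b c) (f' := splitForm α 0 0 0)
    (g' := splitForm 0 (a * x ^ 2 + 2 * b * x * y + c * y ^ 2) 0 0)
    (b := ![![1, 0, 0, 0], ![0, x, y, 0], ![0, u, v, 0], ![0, 0, 0, 1]])
    (linearIndependent_of_det (by
      simp [Matrix.det_succ_row_zero, Fin.sum_univ_succ, Fin.succAbove]
      intro h0
      rw [← sub_eq_add_neg, hxy] at h0
      exact one_ne_zero h0)) one_ne_zero one_ne_zero
    (by
      intro i j
      rw [gram_splitForm, polarBilin_splitForm]
      fin_cases i <;> fin_cases j <;> simp [splitMatrix])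
    (by
      intro i j
      rw [gram_splitForm, polarBilin_splitForm]
      fin_cases i <;> fin_cases j <;> simp [splitMatrix]
      · ring
      · linear_combination x * h1 + y * h2
      · linear_combination x * h1 + y * h2
      · linear_combination u * h1 + v * h2)
  have hE : ProjEquiv (splitForm α 0 0 0) (splitForm 0 a b c) (splitForm α 0 0 0)
    (splitForm 0 (a * x ^ 2 + 2 * b * x * y + c * y ^ 2) 0 0) := ⟨A, hA⟩
  have hps' := hE.isPolystable hps
  refine zero_not_mem_orbit (hE.isPencil hp) ?_
  -- the substitution `x₁ ↦ s x₁`, `x₂ ↦ s⁻¹ x₂`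
  have := splitForm_limit_mem_orbit hps'.2 (φ₀ := fun _ => α) (φ₁ := fun _ => 0)
    (φ₂ := fun _ => 0) (φ₃ := fun _ => 0) (ψ₀ := fun _ => 0)
    (ψ₁ := fun s => s ^ 2 * (a * x ^ 2 + 2 * b * x * y + c * y ^ 2)) (ψ₂ := fun _ => 0)
    (ψ₃ := fun _ => 0)
    (by fun_prop) (by fun_prop) (by fun_prop) (by fun_prop) (by fun_prop) (by fun_prop)
    (by fun_prop) (by fun_prop) (fun s hs => ⟨1, s, s⁻¹, 1, 1, 1, by field_simp, by ring, by ring,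
      by ring, by ring, by ring, by ring, by ring, by ring, by ring⟩)
  simp only [ne_eq, OfNat.ofNat_ne_zero, not_false_eq_true, zero_pow, zero_mul,
    splitForm_zero] at this
  rwa [← zero_smul ℂ (0 : Quadric), wedge_smul_right, zero_smul] at this

/-- A polystable pencil with singular base locus is equivalent to one generated by `x₀ x₃` and a
nondegenerate form in `x₁, x₂`. -/
lemma exists_splitForm_of_polystable_of_singular {f g : Quadric} (hps : IsPolystable f g)
    (h : HasSingularBaseLocus f g) : ∃ α a b c : ℂ, α ≠ 0 ∧ a * c - b ^ 2 ≠ 0 ∧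
      ProjEquiv f g (splitForm α 0 0 0) (splitForm 0 a b c) := by
  have hp := (wedge_ne_zero_iff _ _).1 hps.1
  -- the case of a pair of split forms, the first of which involves `x₀ x₃`
  have key (α a b c α' a' b' c' : ℂ) (hα : α ≠ 0)
      (he : ProjEquiv f g (splitForm α a b c) (splitForm α' a' b' c')) :
      ∃ α a b c : ℂ, α ≠ 0 ∧ a * c - b ^ 2 ≠ 0 ∧
      ProjEquiv f g (splitForm α 0 0 0) (splitForm 0 a b c) := by
    -- subtract a multiple of the first form in order to remove `x₀ x₃` from the second one
    set t := -(α' / α) with ht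
    have e1 : t • splitForm α a b c + (1 : ℂ) • splitForm α' a' b' c' =
        splitForm 0 (t * a + a') (t * b + b') (t * c + c') := by
      apply gram_injective
      rw [map_add, map_smul, map_smul, gram_splitForm, gram_splitForm, gram_splitForm]
      have h0 : t * α + α' = 0 := by rw [ht]; field_simp; ring
      ext i j
      fin_cases i <;> fin_cases j <;> simp [splitMatrix, h0]
    have he2 : ProjEquiv f g (splitForm α a b c)
        (splitForm 0 (t * a + a') (t * b + b') (t * c + c')) := by
      refine he.trans (ProjEquiv.of_span_eq ?_)
      rw [← e1, ← span_combination_eq (splitForm α a b c) (splitForm α' a' b' c') (a := 1) (b := 0)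
        (c := t) (d := 1) (by simp)]
      simp
    have hps2 := he2.isPolystable hps
    have hp2 := he2.isPencil hp
    -- weights `(-1, 1, 1, -1)`, with a shift by `±2` on the two forms, remove `x₁, x₂` from the
    -- first
    have hlim := splitForm_limit_mem_orbit hps2.2 (φ₀ := fun _ => α) (φ₁ := fun s => s ^ 4 * a)
      (φ₂ := fun s => s ^ 4 * b) (φ₃ := fun s => s ^ 4 * c) (ψ₀ := fun _ => 0)
      (ψ₁ := fun _ => t * a + a') (ψ₂ := fun _ => t * b + b')
      (ψ₃ := fun _ => t * c + c')
      (by fun_prop) (by fun_prop) (by fun_prop) (by fun_prop) (by fun_prop) (by fun_prop)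
      (by fun_prop) (by fun_prop) (fun s hs => ⟨s⁻¹, s, s, s⁻¹, s ^ 2, (s ^ 2)⁻¹, by field_simp,
        by field_simp, by field_simp, by ring, by ring, by ring, by ring, by field_simp,
        by field_simp, by field_simp⟩)
    simp only [ne_eq, OfNat.ofNat_ne_zero, not_false_eq_true, zero_pow, zero_mul] at hlim
    have he3 := he2.trans (projEquiv_of_wedge_mem_orbit hp2 hlim)
    refine ⟨α, _, _, _, hα, fun hdeg => ?_, he3⟩
    exact not_isPolystable_of_degenerate (he3.isPencil hp) hdeg (he3.isPolystable hps)
  obtain ⟨f', g', hF, he⟩ := generatedBy_family4_of_singular h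
  have he' := he.trans (projEquiv_of_wedge_mem_orbit (he.isPencil hp)
    (hF.split_mem_orbit (he.isPolystable hps).2))
  by_cases h0 : gram f' 0 3 = 0
  · by_cases h1 : gram g' 0 3 = 0
    -- both forms involve `x₁, x₂` only and are contracted to zero by the weights `(-1, 1, 1, -1)`
    · exfalso
      rw [h0, h1] at he'
      refine zero_not_mem_orbit (he'.isPencil hp) ?_
      have hlim := splitForm_limit_mem_orbit (he'.isPolystable hps).2 (φ₀ := fun _ => 0)
        (φ₁ := fun s => s ^ 2 * gram f' 1 1)
        (φ₂ := fun s => s ^ 2 * gram f' 1 2) (φ₃ := fun s => s ^ 2 * gram f' 2 2) (ψ₀ := fun _ => 0)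
        (ψ₁ := fun s => s ^ 2 * gram g' 1 1)
        (ψ₂ := fun s => s ^ 2 * gram g' 1 2) (ψ₃ := fun s => s ^ 2 * gram g' 2 2)
        (by fun_prop) (by fun_prop) (by fun_prop) (by fun_prop) (by fun_prop) (by fun_prop)
        (by fun_prop) (by fun_prop) (fun s hs => ⟨s⁻¹, s, s, s⁻¹, 1, 1, by field_simp,
          by ring, by ring, by ring, by ring, by ring, by ring, by ring, by ring, by ring⟩)
      simp only [ne_eq, OfNat.ofNat_ne_zero, not_false_eq_true, zero_pow, zero_mul,
        splitForm_zero, wedge_self] at hlim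
      exact hlim
    · exact key _ _ _ _ _ _ _ _ h1 (he'.trans (ProjEquiv.of_span_eq (by rw [Set.pair_comm])))
  · exact key _ _ _ _ _ _ _ _ h0 he'

/-! ### The quadrangle pencil -/

/-- A nondegenerate binary quadratic form has two independent isotropic vectors. -/
lemma exists_isotropic_pair {a b c : ℂ} (h : a * c - b ^ 2 ≠ 0) :
    ∃ s t s' t' : ℂ, s * t' - t * s' ≠ 0 ∧ a * s ^ 2 + 2 * b * s * t + c * t ^ 2 = 0 ∧
      a * s' ^ 2 + 2 * b * s' * t' + c * t' ^ 2 = 0 ∧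
      a * s * s' + b * (s * t' + t * s') + c * t * t' ≠ 0 := by
  by_cases ha : a = 0
  · have hb : b ≠ 0 := by
      rintro rfl
      simp [ha] at h
    refine ⟨1, 0, -c, 2 * b, by simpa using hb, by simp [ha], ?_, ?_⟩
    · rw [ha]; ring
    · rw [ha]; simp [hb]
  · obtain ⟨r, hr⟩ := IsAlgClosed.exists_pow_nat_eq (b ^ 2 - a * c) (n := 2) (by norm_num)
    have hr0 : r ≠ 0 := by
      rintro rfl
      apply h
      linear_combination hr
    refine ⟨-b + r, a, -b - r, a, ?_, ?_, ?_, ?_⟩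
    · have : (-b + r) * a - a * (-b - r) = 2 * (a * r) := by ring
      rw [this]
      exact mul_ne_zero two_ne_zero (mul_ne_zero ha hr0)
    · linear_combination a * hr
    · linear_combination a * hr
    · have : a * (-b + r) * (-b - r) + b * ((-b + r) * a + a * (-b - r)) + c * a * a
          = 2 * a * (a * c - b ^ 2) := by linear_combination -a * hr
      rw [this]
      exact mul_ne_zero (mul_ne_zero two_ne_zero ha) h

/-- The form `x₀ x₁`. -/
noncomputable def quadrangleF : Quadric := quad (Matrix.single 0 1 1)

/-- The form `x₂ x₃`. -/
noncomputable def quadrangleG : Quadric := quad (Matrix.single 2 3 1)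

lemma gram_quadrangleF : gram quadrangleF = !![0, 1, 0, 0; 1, 0, 0, 0; 0, 0, 0, 0; 0, 0, 0, 0] := by
  rw [quadrangleF, gram_quad]
  ext i j
  fin_cases i <;> fin_cases j <;> simp [Matrix.single]

lemma gram_quadrangleG : gram quadrangleG = !![0, 0, 0, 0; 0, 0, 0, 0; 0, 0, 0, 1; 0, 0, 1, 0] := by
  rw [quadrangleG, gram_quad]
  ext i j
  fin_cases i <;> fin_cases j <;> simp [Matrix.single]

lemma splitForm_projEquiv_quadrangle {α a b c : ℂ} (hα : α ≠ 0) (h : a * c - b ^ 2 ≠ 0) :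
    ProjEquiv (splitForm α 0 0 0) (splitForm 0 a b c) quadrangleF quadrangleG := by
  obtain ⟨s, t, s', t', hdet, h1, h2, h3⟩ := exists_isotropic_pair h
  obtain ⟨A, -, -, -, -, -, hA⟩ := projEquiv_of_basis (f := splitForm α 0 0 0)
    (g := splitForm 0 a b c) (f' := quadrangleF) (g' := quadrangleG)
    (b := ![![1, 0, 0, 0], ![0, 0, 0, 1], ![0, s, t, 0], ![0, s', t', 0]])
    (linearIndependent_of_det (by
      simp [Matrix.det_succ_row_zero, Fin.sum_univ_succ, Fin.succAbove]
      intro h0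
      apply hdet
      linear_combination h0)) hα h3
    (by
      intro i j
      rw [gram_quadrangleF, polarBilin_splitForm]
      fin_cases i <;> fin_cases j <;> simp)
    (by
      intro i j
      rw [gram_quadrangleG, polarBilin_splitForm]
      fin_cases i <;> fin_cases j <;> simp
      · linear_combination h1
      · ring
      · linear_combination h2)
  exact ⟨A, hA⟩

/-! ### Properness of the orbit of the quadrangle pencil -/

lemma gram_act_quadrangleF (A : SL(4, ℂ)) (j k : Fin 4) :
    gram (act A quadrangleF) j k = A 0 j * A 1 k + A 1 j * A 0 k := by
  rw [gram_act, gram_quadrangleF, Matrix.mul_apply]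
  simp [Matrix.mul_apply, Fin.sum_univ_four, Matrix.transpose_apply]
  ring

lemma gram_act_quadrangleG (A : SL(4, ℂ)) (j k : Fin 4) :
    gram (act A quadrangleG) j k = A 2 j * A 3 k + A 3 j * A 2 k := by
  rw [gram_act, gram_quadrangleG, Matrix.mul_apply]
  simp [Matrix.mul_apply, Fin.sum_univ_four, Matrix.transpose_apply]
  ring

lemma det_quadrangle (x y : ℂ) :
    (x • gram quadrangleF + y • gram quadrangleG).det = x ^ 2 * y ^ 2 := by
  rw [gram_quadrangleF, gram_quadrangleG]
  simp [Matrix.det_succ_row_zero, Fin.sum_univ_succ, Fin.succAbove]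
  ring

lemma isPencil_quadrangle : IsPencil quadrangleF quadrangleG := by
  rw [isPencil_iff]
  intro a b h
  have h' := congrArg gram h
  rw [map_add, map_smul, map_smul, gram_quadrangleF, gram_quadrangleG, map_zero] at h'
  have h1 := congrFun (congrFun h' 0) 1
  have h2 := congrFun (congrFun h' 2) 3
  simp at h1 h2
  exact ⟨h1, h2⟩

/-- The coefficients of two vectors are controlled by those of their symmetrised product. -/
lemma norm_mul_le_of_symm {y z : Fin 4 → ℂ} {L : ℝ} (hL : 0 ≤ L)
    (h : ∀ j k, ‖y j * z k + z j * y k‖ ≤ L) (j k : Fin 4) : ‖y j * z k‖ ≤ 2 * L := by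
  by_contra! hcon
  have hj : 2 * ‖y j * z j‖ ≤ L := by
    have := h j j
    rwa [mul_comm (z j), ← two_mul, norm_mul, Complex.norm_ofNat] at this
  have hk : 2 * ‖y k * z k‖ ≤ L := by
    have := h k k
    rwa [mul_comm (z k), ← two_mul, norm_mul, Complex.norm_ofNat] at this
  have h1 : ‖y j * z k‖ - ‖z j * y k‖ ≤ L := by
    have h2 := norm_sub_norm_le (y j * z k) (-(z j * y k))
    rw [norm_neg, sub_neg_eq_add] at h2
    exact h2.trans (h j k)
  have h3 : ‖y j * z k‖ * ‖z j * y k‖ = ‖y j * z j‖ * ‖y k * z k‖ := by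
    simp only [norm_mul]; ring
  have h4 : L < ‖z j * y k‖ := by linarith
  nlinarith [norm_nonneg (y j * z j), norm_nonneg (y k * z k)]

/-- Two vectors with bounded symmetrised product become bounded after rescaling them by inverse
factors. -/
lemma exists_balanced_rescaling {y z : Fin 4 → ℂ} (hy : y ≠ 0) {n L : ℝ} (hn : 0 < n) (hL : 0 < L)
    (h : ∀ j k, ‖y j * z k + z j * y k‖ ≤ n * L) :
    ∃ x t : ℂ, x * t = (n : ℂ)⁻¹ ∧ ∀ j, ‖x * y j‖ ≤ Real.sqrt (2 * L) ∧
      ‖t * z j‖ ≤ Real.sqrt (2 * L) := by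
  obtain ⟨m, hm⟩ := Finite.exists_max fun j => ‖y j‖
  have hm0 : 0 < ‖y m‖ := by
    rw [norm_pos_iff]
    intro h0
    apply hy
    ext j
    have := hm j
    rw [h0, norm_zero, norm_le_zero_iff] at this
    exact this
  set r := Real.sqrt (2 * L) with hr
  have hr0 : 0 < r := Real.sqrt_pos.2 (by linarith)
  have hrr : r * r = 2 * L := Real.mul_self_sqrt (by linarith)
  have hb := norm_mul_le_of_symm (by positivity) h
  refine ⟨((r / ‖y m‖ : ℝ) : ℂ), ((‖y m‖ / (n * r) : ℝ) : ℂ), ?_, fun j => ⟨?_, ?_⟩⟩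
  · rw [← Complex.ofReal_mul, ← Complex.ofReal_inv]
    congr 1
    field_simp
  · rw [norm_mul, Complex.norm_real, Real.norm_of_nonneg (by positivity), div_mul_eq_mul_div,
      div_le_iff₀ hm0]
    exact mul_le_mul_of_nonneg_left (hm j) hr0.le
  · rw [norm_mul, Complex.norm_real, Real.norm_of_nonneg (by positivity), div_mul_eq_mul_div,
      div_le_iff₀ (by positivity), ← norm_mul]
    refine (hb m j).trans (le_of_eq ?_)
    calc 2 * (n * L) = n * (2 * L) := by ring
      _ = r * (n * r) := by rw [← hrr]; ring

lemma norm_det_le {N : Matrix (Fin 4) (Fin 4) ℂ} {x : ℝ} (h : ∀ i j, ‖N i j‖ ≤ x) :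
    ‖N.det‖ ≤ 24 * x ^ 4 := by
  have := Matrix.det_le (A := N) (abv := NormedField.toAbsoluteValue ℂ) (x := x) h
  simp [Nat.factorial] at this
  exact this

lemma row_ne_zero (A : SL(4, ℂ)) (i : Fin 4) : (A : Matrix (Fin 4) (Fin 4) ℂ) i ≠ 0 := by
  intro h
  have h1 : (A : Matrix (Fin 4) (Fin 4) ℂ).det = 0 :=
    Matrix.det_eq_zero_of_row_eq_zero i fun j => congrFun h j
  rw [A.2] at h1
  exact one_ne_zero h1

/-- If a pencil in the orbit of the quadrangle pencil has generators with bounded coefficients,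
its members of rank two can be scaled by inverse factors so as to be bounded. -/
lemma quadrangle_bounded_generators {c₀ : ℝ} (hc : 0 < c₀) {A : SL(4, ℂ)} {a b c d : ℂ}
    (hdet : a * d - b * c = 1)
    (h : ∀ i j, ‖gram (a • act A quadrangleF + b • act A quadrangleG) i j‖ ≤ c₀ ∧
      ‖gram (c • act A quadrangleF + d • act A quadrangleG) i j‖ ≤ c₀) :
    ∃ n : ℝ, 0 < n ∧ (∀ i j, ‖gram (act A quadrangleF) i j‖ ≤ n * (2 * c₀)) ∧
      ∀ i j, ‖gram (act A quadrangleG) i j‖ ≤ n⁻¹ * (2 * (30 * c₀ ^ 2 + 1) * c₀) := by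
  -- The determinants of the two generators and of their sum bound `a b`, `c d` and
  -- `(a + c) (b + d)`; together with `a d - b c = 1` this bounds all four products.
  have hD (x y : ℂ) : (gram (x • act A quadrangleF + y • act A quadrangleG)).det
      = (x * y) ^ 2 := by
    rw [map_add, map_smul, map_smul, det_gram_act_combination, det_quadrangle]; ring
  have hab : ‖a * b‖ ≤ 5 * c₀ ^ 2 := by
    have h1 := norm_det_le fun i j => (h i j).1
    rw [hD, norm_pow] at h1
    refine le_of_sq_le_sq ?_ (by positivity)
    nlinarith [sq_nonneg (c₀ ^ 2)]
  have hcd : ‖c * d‖ ≤ 5 * c₀ ^ 2 := by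
    have h1 := norm_det_le fun i j => (h i j).2
    rw [hD, norm_pow] at h1
    refine le_of_sq_le_sq ?_ (by positivity)
    nlinarith [sq_nonneg (c₀ ^ 2)]
  have hs : ‖(a + c) * (b + d)‖ ≤ 20 * c₀ ^ 2 := by
    have e1 : (a + c) • act A quadrangleF + (b + d) • act A quadrangleG =
        (a • act A quadrangleF + b • act A quadrangleG) +
          (c • act A quadrangleF + d • act A quadrangleG) := by module
    have h1 := norm_det_le (N := gram ((a + c) • act A quadrangleF + (b + d) • act A quadrangleG))
      (x := 2 * c₀) fun i j => by
        rw [e1, map_add, Matrix.add_apply]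
        refine (norm_add_le _ _).trans ?_
        linarith [(h i j).1, (h i j).2]
    rw [hD, norm_pow] at h1
    refine le_of_sq_le_sq ?_ (by positivity)
    nlinarith [sq_nonneg (c₀ ^ 2)]
  have hsum : ‖a * d + b * c‖ ≤ 30 * c₀ ^ 2 := by
    have : a * d + b * c = (a + c) * (b + d) - a * b - c * d := by ring
    rw [this]
    refine (norm_sub_le _ _).trans ?_
    have := norm_sub_le ((a + c) * (b + d)) (a * b)
    linarith
  have had : ‖a * d‖ ≤ 30 * c₀ ^ 2 + 1 := by
    have : a * d = ((a * d + b * c) + 1) / 2 := by rw [← hdet]; ring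
    rw [this, norm_div, Complex.norm_ofNat]
    have := norm_add_le (a * d + b * c) 1
    rw [norm_one] at this
    nlinarith [sq_nonneg c₀]
  have hbc : ‖b * c‖ ≤ 30 * c₀ ^ 2 + 1 := by
    have : b * c = ((a * d + b * c) - 1) / 2 := by rw [← hdet]; ring
    rw [this, norm_div, Complex.norm_ofNat]
    have := norm_sub_le (a * d + b * c) 1
    rw [norm_one] at this
    nlinarith [sq_nonneg c₀]
  have hab' : ‖a * b‖ ≤ 30 * c₀ ^ 2 + 1 := by nlinarith [sq_nonneg c₀]
  have hcd' : ‖c * d‖ ≤ 30 * c₀ ^ 2 + 1 := by nlinarith [sq_nonneg c₀]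
  -- the scaling factor: `act A quadrangleF` is the combination of the generators with
  -- coefficients `d` and `-b`
  set n := max ‖b‖ ‖d‖ with hn
  have hn0 : 0 < n := by
    rw [hn, lt_max_iff, norm_pos_iff, norm_pos_iff]
    by_contra! hcon
    rw [hcon.1, hcon.2] at hdet
    simp at hdet
  have hna : n * ‖a‖ ≤ 30 * c₀ ^ 2 + 1 := by
    rw [hn, max_mul_of_nonneg _ _ (norm_nonneg a), ← norm_mul, ← norm_mul]
    exact max_le (by rwa [mul_comm]) (by rwa [mul_comm])
  have hnc : n * ‖c‖ ≤ 30 * c₀ ^ 2 + 1 := by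
    rw [hn, max_mul_of_nonneg _ _ (norm_nonneg c), ← norm_mul, ← norm_mul]
    exact max_le hbc (by rwa [mul_comm])
  set f' := a • act A quadrangleF + b • act A quadrangleG with hf'
  set g' := c • act A quadrangleF + d • act A quadrangleG with hg'
  have eF : act A quadrangleF = d • f' + (-b) • g' := by
    have : d • f' + (-b) • g' = (a * d - b * c) • act A quadrangleF := by
      rw [hf', hg']; module
    rw [this, hdet, one_smul]
  have eG : act A quadrangleG = (-c) • f' + a • g' := by
    have : (-c) • f' + a • g' = (a * d - b * c) • act A quadrangleG := by
      rw [hf', hg']; module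
    rw [this, hdet, one_smul]
  refine ⟨n, hn0, fun i j => ?_, fun i j => ?_⟩
  · have : gram (act A quadrangleF) i j = d * gram f' i j + (-b) * gram g' i j := by
      rw [eF]; simp
    rw [this]
    refine (norm_add_le _ _).trans ?_
    rw [norm_mul, norm_mul, norm_neg]
    have h1 : ‖d‖ * ‖gram f' i j‖ ≤ n * c₀ := by
      gcongr
      · exact le_max_right _ _
      · exact (h i j).1
    have h2 : ‖b‖ * ‖gram g' i j‖ ≤ n * c₀ := by
      gcongr
      · exact le_max_left _ _
      · exact (h i j).2
    linarith
  · have : gram (act A quadrangleG) i j = (-c) * gram f' i j + a * gram g' i j := by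
      rw [eG]; simp
    rw [this, inv_mul_eq_div, le_div_iff₀ hn0]
    have h0 := norm_add_le ((-c) * gram f' i j) (a * gram g' i j)
    rw [norm_mul, norm_mul, norm_neg] at h0
    have h1 : n * ‖c‖ * ‖gram f' i j‖ ≤ (30 * c₀ ^ 2 + 1) * c₀ := by
      gcongr
      exact (h i j).1
    have h2 : n * ‖a‖ * ‖gram g' i j‖ ≤ (30 * c₀ ^ 2 + 1) * c₀ := by
      gcongr
      exact (h i j).2
    nlinarith [mul_le_mul_of_nonneg_left h0 hn0.le]

lemma act_diag_quadrangleF (d : Fin 4 → ℂ) (h : d 0 * d 1 * d 2 * d 3 = 1) :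
    act (diag d h) quadrangleF = (d 0 * d 1) • quadrangleF := by
  apply gram_injective
  ext i j
  rw [gram_act_diag, map_smul, Matrix.smul_apply, gram_quadrangleF]
  fin_cases i <;> fin_cases j <;> simp [mul_comm (d 1)]

lemma act_diag_quadrangleG (d : Fin 4 → ℂ) (h : d 0 * d 1 * d 2 * d 3 = 1) :
    act (diag d h) quadrangleG = (d 2 * d 3) • quadrangleG := by
  apply gram_injective
  ext i j
  rw [gram_act_diag, map_smul, Matrix.smul_apply, gram_quadrangleG]
  fin_cases i <;> fin_cases j <;> simp [mul_comm]

/-- The rows of `A` are the linear forms `xᵢ ∘ A`. Up to the torus stabilising `x₀ x₁ ∧ x₂ x₃` they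
are bounded once the products `(x₀ x₁) ∘ A` and `(x₂ x₃) ∘ A` are. -/
lemma isPolystable_quadrangle : IsPolystable quadrangleF quadrangleG := by
  refine ⟨(wedge_ne_zero_iff _ _).2 isPencil_quadrangle, isClosed_orbit_of_proper _ _ fun C hC => ?_⟩
  set c₀ := Real.sqrt C with hc
  have hc0 : 0 < c₀ := Real.sqrt_pos.2 hC
  set L := max (2 * c₀) (2 * (30 * c₀ ^ 2 + 1) * c₀) with hL
  have hL0 : 0 < L := lt_max_of_lt_left (by linarith)
  refine ⟨Real.sqrt (2 * L), fun A hA => ?_⟩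
  simp only [actWedge_wedge] at hA
  obtain ⟨a, b, c, d, hdet, h⟩ := exists_small_generators (isPencil_quadrangle.act A) hc0
    (by rwa [hc, Real.sq_sqrt hC.le])
  obtain ⟨n, hn, hF, hG⟩ := quadrangle_bounded_generators hc0 hdet h
  obtain ⟨x, t, hxt, h1⟩ := exists_balanced_rescaling (y := A 0) (z := A 1) (row_ne_zero A 0) hn hL0
    fun j k => by
      rw [← gram_act_quadrangleF]
      exact (hF j k).trans (mul_le_mul_of_nonneg_left (le_max_left _ _) hn.le)
  obtain ⟨z, w, hzw, h2⟩ := exists_balanced_rescaling (y := A 2) (z := A 3) (row_ne_zero A 2)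
    (inv_pos.2 hn) hL0
    fun j k => by
      rw [← gram_act_quadrangleG]
      exact (hG j k).trans (mul_le_mul_of_nonneg_left (le_max_right _ _) (inv_pos.2 hn).le)
  have hn' : (n : ℂ) ≠ 0 := by exact_mod_cast hn.ne'
  have h1234 : x * t * (z * w) = 1 := by
    rw [hxt, hzw, Complex.ofReal_inv, inv_inv, inv_mul_cancel₀ hn']
  -- `D` stabilises the wedge product and makes the rows of `D * A` bounded
  let D : SL(4, ℂ) := diag ![x, t, z, w] (by simpa [mul_assoc] using h1234)
  refine ⟨D * A, ?_, ?_⟩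
  · rw [← actWedge_actWedge, actWedge_wedge D, act_diag_quadrangleF, act_diag_quadrangleG,
      wedge_smul_left, wedge_smul_right, smul_smul]
    have : ![x, t, z, w] 0 * ![x, t, z, w] 1 * (![x, t, z, w] 2 * ![x, t, z, w] 3) = 1 := h1234
    rw [this, one_smul]
  · intro i j
    have : (D * A) i j = ![x, t, z, w] i * A i j := by
      change (Matrix.diagonal ![x, t, z, w] * (A : Matrix (Fin 4) (Fin 4) ℂ)) i j = _
      rw [Matrix.diagonal_mul]
    rw [this]
    fin_cases i
    · exact (h1 j).1
    · exact (h1 j).2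
    · exact (h2 j).1
    · exact (h2 j).2

/-! ### The geometry of strictly polystable pencils -/

lemma quadrangleF_apply (v : Vec) : quadrangleF v = v 0 * v 1 := by
  rw [apply_eq_sum, gram_quadrangleF]
  simp [Fin.sum_univ_four]
  ring

lemma quadrangleG_apply (v : Vec) : quadrangleG v = v 2 * v 3 := by
  rw [apply_eq_sum, gram_quadrangleG]
  simp [Fin.sum_univ_four]
  ring

lemma quadrangleF_polar (v w : Vec) : quadrangleF.polarBilin v w = v 0 * w 1 + v 1 * w 0 := by
  rw [polarBilin_eq_sum, gram_quadrangleF]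
  simp [Fin.sum_univ_four]

lemma quadrangleG_polar (v w : Vec) : quadrangleG.polarBilin v w = v 2 * w 3 + v 3 * w 2 := by
  rw [polarBilin_eq_sum, gram_quadrangleG]
  simp [Fin.sum_univ_four]

lemma IsSingularPoint.exists_relation {f g : Quadric} {p : Vec} (h : IsSingularPoint f g p) :
    ∃ x y : ℂ, ¬ (x = 0 ∧ y = 0) ∧ ∀ w, x * f.polarBilin p w + y * g.polarBilin p w = 0 := by
  have := h.2.2
  rw [LinearIndependent.pair_iff] at this
  push Not at this
  obtain ⟨x, y, hxy, h0⟩ := this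
  exact ⟨x, y, fun h => h0 h.1 h.2, fun w => LinearMap.congr_fun hxy w⟩

lemma mem_span_of_eq {p u : Vec} (c : ℂ) (h : ∀ i, p i = c * u i) : p ∈ Submodule.span ℂ {u} :=
  Submodule.mem_span_singleton.2 ⟨c, by ext i; simp [h]⟩

lemma singularExactlyA1At_quadrangle :
    SingularExactlyA1At quadrangleF quadrangleG (Set.range e) := by
  constructor
  · rintro _ ⟨i, rfl⟩
    refine ⟨e_ne_zero i, ?_, ?_⟩
    · refine ⟨?_, ?_⟩
      · rw [quadrangleF_apply]; fin_cases i <;> simp [e]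
      · rw [quadrangleG_apply]; fin_cases i <;> simp [e]
    · have hsw : Submodule.span ℂ {quadrangleF, quadrangleG} =
          Submodule.span ℂ {quadrangleG, quadrangleF} := by rw [Set.pair_comm]
      have h01 (i : Fin 4) (hi : i = 0 ∨ i = 1) : ∃ h k : Quadric,
          Submodule.span ℂ {h, k} = Submodule.span ℂ {quadrangleF, quadrangleG} ∧
          h.polarBilin (e i) = 0 ∧ k.polarBilin (e i) ≠ 0 ∧
          ∀ v : Vec, k.polarBilin (e i) v = 0 →
            (∀ w : Vec, k.polarBilin (e i) w = 0 → h.polarBilin v w = 0) →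
            v ∈ Submodule.span ℂ {e i} := by
        refine ⟨quadrangleG, quadrangleF, hsw.symm, ?_, ?_, ?_⟩
        · refine LinearMap.ext fun w => ?_
          rw [quadrangleG_polar]
          rcases hi with rfl | rfl <;> simp [e]
        · intro h0
          rcases hi with rfl | rfl
          · have := LinearMap.congr_fun h0 (e 1)
            rw [quadrangleF_polar] at this
            simp [e] at this
          · have := LinearMap.congr_fun h0 (e 0)
            rw [quadrangleF_polar] at this
            simp [e] at this
        · intro v hv hw
          have h2 := hw (e 3) (by rw [quadrangleF_polar]; rcases hi with rfl | rfl <;> simp [e])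
          have h3 := hw (e 2) (by rw [quadrangleF_polar]; rcases hi with rfl | rfl <;> simp [e])
          rw [quadrangleF_polar] at hv
          rw [quadrangleG_polar] at h2 h3
          rcases hi with rfl | rfl
          · refine mem_span_of_eq (v 0) fun i => ?_
            fin_cases i <;> simp_all [e]
          · refine mem_span_of_eq (v 1) fun i => ?_
            fin_cases i <;> simp_all [e]
      have h23 (i : Fin 4) (hi : i = 2 ∨ i = 3) : ∃ h k : Quadric,
          Submodule.span ℂ {h, k} = Submodule.span ℂ {quadrangleF, quadrangleG} ∧
          h.polarBilin (e i) = 0 ∧ k.polarBilin (e i) ≠ 0 ∧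
          ∀ v : Vec, k.polarBilin (e i) v = 0 →
            (∀ w : Vec, k.polarBilin (e i) w = 0 → h.polarBilin v w = 0) →
            v ∈ Submodule.span ℂ {e i} := by
        refine ⟨quadrangleF, quadrangleG, rfl, ?_, ?_, ?_⟩
        · refine LinearMap.ext fun w => ?_
          rw [quadrangleF_polar]
          rcases hi with rfl | rfl <;> simp [e]
        · intro h0
          rcases hi with rfl | rfl
          · have := LinearMap.congr_fun h0 (e 3)
            rw [quadrangleG_polar] at this
            simp [e] at this
          · have := LinearMap.congr_fun h0 (e 2)
            rw [quadrangleG_polar] at this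
            simp [e] at this
        · intro v hv hw
          have h2 := hw (e 1) (by rw [quadrangleG_polar]; rcases hi with rfl | rfl <;> simp [e])
          have h3 := hw (e 0) (by rw [quadrangleG_polar]; rcases hi with rfl | rfl <;> simp [e])
          rw [quadrangleG_polar] at hv
          rw [quadrangleF_polar] at h2 h3
          rcases hi with rfl | rfl
          · refine mem_span_of_eq (v 2) fun i => ?_
            fin_cases i <;> simp_all [e]
          · refine mem_span_of_eq (v 3) fun i => ?_
            fin_cases i <;> simp_all [e]
      fin_cases i
      · exact h01 0 (Or.inl rfl)
      · exact h01 1 (Or.inr rfl)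
      · exact h23 2 (Or.inl rfl)
      · exact h23 3 (Or.inr rfl)
  · intro p hp
    obtain ⟨x, y, hxy, hrel⟩ := hp.exists_relation
    obtain ⟨-, ⟨hf, hg⟩, -⟩ := hp
    have h0 := hrel (e 0)
    have h1 := hrel (e 1)
    have h2 := hrel (e 2)
    have h3 := hrel (e 3)
    rw [quadrangleF_polar, quadrangleG_polar] at h0 h1 h2 h3
    simp [e] at h0 h1 h2 h3
    rw [quadrangleF_apply, mul_eq_zero] at hf
    rw [quadrangleG_apply, mul_eq_zero] at hg
    have fin (i : Fin 4) (hi : ∀ j, j ≠ i → p j = 0) :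
        ∃ u ∈ Set.range e, p ∈ Submodule.span ℂ {u} := by
      refine ⟨e i, ⟨i, rfl⟩, mem_span_of_eq (p i) fun j => ?_⟩
      by_cases hj : j = i
      · subst hj; simp [e]
      · rw [hi j hj]; simp [e, hj]
    by_cases hx : x = 0
    · have hy : y ≠ 0 := fun hy => hxy ⟨hx, hy⟩
      simp only [hy, false_or] at h2 h3
      rcases hf with hf | hf
      · exact fin 1 fun j hj => by fin_cases j <;> simp_all
      · exact fin 0 fun j hj => by fin_cases j <;> simp_all
    · simp only [hx, false_or] at h0 h1
      rcases hg with hg | hg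
      · exact fin 3 fun j hj => by fin_cases j <;> simp_all
      · exact fin 2 fun j hj => by fin_cases j <;> simp_all

lemma not_isStable_quadrangle : ¬ IsStable quadrangleF quadrangleG := by
  refine not_isStable_of_singular ⟨e 0, e_ne_zero 0, ?_, ?_⟩
  · exact (singularExactlyA1At_quadrangle.1 _ ⟨0, rfl⟩).2.1
  · refine not_linearIndependent_of_right_eq_zero (LinearMap.ext fun w => ?_)
    rw [quadrangleG_polar]
    simp [e]

/-- The vertices in cyclic order: consecutive ones are joined by a line of the base locus. -/
def quadrangleOrder : Fin 4 → Fin 4 := ![0, 2, 1, 3]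

lemma mem_span_e_pair {i j : Fin 4} {v : Vec} (hij : i ≠ j) :
    v ∈ (Submodule.span ℂ {e i, e j} : Set Vec) ↔ ∀ k, k ≠ i → k ≠ j → v k = 0 := by
  rw [SetLike.mem_coe, Submodule.mem_span_pair]
  constructor
  · rintro ⟨a, b, rfl⟩ k hk hk'
    simp [e, hk, hk']
  · intro h
    refine ⟨v i, v j, ?_⟩
    ext k
    by_cases hk : k = i
    · subst hk; simp [e, hij]
    · by_cases hk' : k = j
      · subst hk'; simp [e, hk]
      · simp [e, hk, hk', h k hk hk']

lemma baseLocus_quadrangle : baseLocus quadrangleF quadrangleG =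
    ⋃ i : Fin 4, (Submodule.span ℂ {e (quadrangleOrder i), e (quadrangleOrder (i + 1))} :
      Set Vec) := by
  have hne : ∀ i : Fin 4, quadrangleOrder i ≠ quadrangleOrder (i + 1) := by decide
  ext v
  simp only [Set.mem_iUnion, mem_span_e_pair (hne _)]
  change quadrangleF v = 0 ∧ quadrangleG v = 0 ↔ _
  rw [quadrangleF_apply, quadrangleG_apply, mul_eq_zero, mul_eq_zero]
  constructor
  · rintro ⟨h | h, h' | h'⟩
    · exact ⟨2, fun k h1 h2 => by fin_cases k <;> simp_all [quadrangleOrder]⟩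
    · exact ⟨1, fun k h1 h2 => by fin_cases k <;> simp_all [quadrangleOrder]⟩
    · exact ⟨3, fun k h1 h2 => by fin_cases k <;> simp_all [quadrangleOrder]⟩
    · exact ⟨0, fun k h1 h2 => by fin_cases k <;> simp_all [quadrangleOrder]⟩
  · rintro ⟨i, hi⟩
    fin_cases i
    · exact ⟨Or.inr (hi 1 (by decide) (by decide)), Or.inr (hi 3 (by decide) (by decide))⟩
    · exact ⟨Or.inl (hi 0 (by decide) (by decide)), Or.inr (hi 3 (by decide) (by decide))⟩
    · exact ⟨Or.inl (hi 0 (by decide) (by decide)), Or.inl (hi 2 (by decide) (by decide))⟩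
    · exact ⟨Or.inr (hi 1 (by decide) (by decide)), Or.inl (hi 2 (by decide) (by decide))⟩

lemma mem_baseLocus_act (A : SL(4, ℂ)) (f g : Quadric) (v : Vec) :
    (A : Matrix (Fin 4) (Fin 4) ℂ).mulVec v ∈ baseLocus f g ↔ v ∈ baseLocus (act A f) (act A g) :=
  Iff.rfl

lemma exists_quadrangle_of_projEquiv {f g : Quadric} (h : ProjEquiv f g quadrangleF quadrangleG) :
    ∃ b : Fin 4 → Vec, IsQuadrangle (baseLocus f g) b ∧ SingularExactlyA1At f g (Set.range b) := by
  obtain ⟨A, hA⟩ := h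
  have hLI : LinearIndependent ℂ fun i => e (quadrangleOrder i) :=
    linearIndependent_of_det (by
      have : (Matrix.of fun i => e (quadrangleOrder i)) =
          !![1, 0, 0, 0; 0, 0, 1, 0; 0, 1, 0, 0; 0, 0, 0, 1] := by
        ext i j
        fin_cases i <;> fin_cases j <;> simp [e, quadrangleOrder]
      rw [this]
      simp [Matrix.det_succ_row_zero, Fin.sum_univ_succ, Fin.succAbove])
  have hker : LinearMap.ker (Matrix.toLin' (A : Matrix (Fin 4) (Fin 4) ℂ)) = ⊥ :=
    LinearMap.ker_eq_bot.2 (mulVec_injective A)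
  have hord : ∀ j, ∃ i, quadrangleOrder i = j := by decide
  refine ⟨fun i => (A : Matrix (Fin 4) (Fin 4) ℂ).mulVec (e (quadrangleOrder i)),
    ⟨hLI.map' (Matrix.toLin' (A : Matrix (Fin 4) (Fin 4) ℂ)) hker, ?_⟩, ?_⟩
  · ext v
    obtain ⟨v, rfl⟩ := mulVec_surjective A v
    rw [mem_baseLocus_act, baseLocus_eq_of_span_eq hA, baseLocus_quadrangle, Set.mem_iUnion,
      Set.mem_iUnion]
    refine exists_congr fun i => ?_
    simp only [SetLike.mem_coe, Submodule.mem_span_pair, ← Matrix.mulVec_smul, ← Matrix.mulVec_add,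
      (mulVec_injective A).eq_iff]
  · refine SingularExactlyA1At.of_projEquiv hA singularExactlyA1At_quadrangle ?_ ?_
    · rintro _ ⟨i, rfl⟩
      exact ⟨_, ⟨quadrangleOrder i, rfl⟩, 1, one_ne_zero, (one_smul _ _).symm⟩
    · rintro _ ⟨j, rfl⟩
      obtain ⟨i, rfl⟩ := hord j
      exact ⟨_, ⟨i, rfl⟩, 1, (one_smul _ _).symm⟩

/-! ### Pairs of nondegenerate binary forms -/

lemma binary_polar (q : QuadraticForm ℂ (Fin 2 → ℂ)) (v w : Fin 2 → ℂ) :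
    q.polarBilin v w = q.polarBilin ![1, 0] ![1, 0] * v 0 * w 0 +
      q.polarBilin ![1, 0] ![0, 1] * (v 0 * w 1 + v 1 * w 0) +
      q.polarBilin ![0, 1] ![0, 1] * v 1 * w 1 := by
  have hv (v : Fin 2 → ℂ) : v = v 0 • ![1, 0] + v 1 • ![0, 1] := by
    ext i; fin_cases i <;> simp
  have hs : q.polarBilin ![0, 1] ![1, 0] = q.polarBilin ![1, 0] ![0, 1] := by
    simp only [QuadraticMap.polarBilin_apply_apply]
    exact QuadraticMap.polar_comm _ _ _
  conv_lhs => rw [hv v, hv w]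
  simp only [map_add, map_smul, LinearMap.add_apply, LinearMap.smul_apply, smul_eq_mul, hs]
  ring

lemma IsNondegenerateBinary.det_ne_zero {q : QuadraticForm ℂ (Fin 2 → ℂ)}
    (h : IsNondegenerateBinary q) : q.polarBilin ![1, 0] ![1, 0] * q.polarBilin ![0, 1] ![0, 1]
      - q.polarBilin ![1, 0] ![0, 1] ^ 2 ≠ 0 := by
  intro h0
  set a := q.polarBilin ![1, 0] ![1, 0] with ha
  set b := q.polarBilin ![1, 0] ![0, 1] with hb
  set c := q.polarBilin ![0, 1] ![0, 1] with hc
  have key (u v : ℂ) (h1 : a * u + b * v = 0) (h2 : b * u + c * v = 0) : u = 0 ∧ v = 0 := by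
    have := h ![u, v] fun w => by
      rw [binary_polar, ← ha, ← hb, ← hc]
      simp
      linear_combination w 0 * h1 + w 1 * h2
    exact ⟨congrFun this 0, congrFun this 1⟩
  obtain ⟨h1, h2⟩ := key (-b) a (by ring) (by linear_combination h0)
  obtain ⟨h3, -⟩ := key c (-b) (by linear_combination h0) (by ring)
  rw [neg_eq_zero] at h1
  exact one_ne_zero (key 1 0 (by rw [h1, h2]; ring) (by rw [h1, h3]; ring)).1

/-- The isotropic vectors of the two binary forms are coordinate vectors in which these forms become
multiples of `x₀ x₁` and `x₂ x₃`. -/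
lemma PolystableFamily.exists_normalForm {f g : Quadric} (h : PolystableFamily f g) :
    ∃ A : SL(4, ℂ), (∃ x : ℂ, x ≠ 0 ∧ act A f = x • quadrangleF) ∧
      (∃ y : ℂ, y ≠ 0 ∧ act A g = y • quadrangleG) ∧
      Submodule.span ℂ {act A f, act A g} = Submodule.span ℂ {quadrangleF, quadrangleG} := by
  obtain ⟨q, q', hq, hq', hf, hg⟩ := h
  have hfp (v w : Vec) : f.polarBilin v w = q.polarBilin ![v 0, v 1] ![w 0, w 1] := by
    simp [QuadraticMap.polar, hf]
  have hgp (v w : Vec) : g.polarBilin v w = q'.polarBilin ![v 2, v 3] ![w 2, w 3] := by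
    simp [QuadraticMap.polar, hg]
  obtain ⟨s, t, s', t', hdet, h1, h2, h3⟩ := exists_isotropic_pair hq.det_ne_zero
  obtain ⟨u, v, u', v', hdet', k1, k2, k3⟩ := exists_isotropic_pair hq'.det_ne_zero
  obtain ⟨A, -, -, -, hx, hy, hA⟩ := projEquiv_of_basis (f := f) (g := g)
    (f' := quadrangleF) (g' := quadrangleG)
    (b := ![![s, t, 0, 0], ![s', t', 0, 0], ![0, 0, u, v], ![0, 0, u', v']])
    (linearIndependent_of_det (by
      simp [Matrix.det_succ_row_zero, Fin.sum_univ_succ, Fin.succAbove]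
      intro h0
      apply mul_ne_zero hdet hdet'
      linear_combination h0)) h3 k3
    (by
      intro i j
      rw [gram_quadrangleF, hfp, binary_polar]
      generalize q.polarBilin ![1, 0] ![1, 0] = a at *
      generalize q.polarBilin ![1, 0] ![0, 1] = b at *
      generalize q.polarBilin ![0, 1] ![0, 1] = c at *
      fin_cases i <;> fin_cases j <;> simp
      · linear_combination h1
      · ring
      · linear_combination h2)
    (by
      intro i j
      rw [gram_quadrangleG, hgp, binary_polar]
      generalize q'.polarBilin ![1, 0] ![1, 0] = a at *
      generalize q'.polarBilin ![1, 0] ![0, 1] = b at *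
      generalize q'.polarBilin ![0, 1] ![0, 1] = c at *
      fin_cases i <;> fin_cases j <;> simp
      · linear_combination k1
      · ring
      · linear_combination k2)
  exact ⟨A, hx, hy, hA⟩

lemma polystableFamily_quadrangle : PolystableFamily quadrangleF quadrangleG := by
  let q : QuadraticForm ℂ (Fin 2 → ℂ) := (Matrix.single 0 1 1).toQuadraticForm'
  have hq (v : Fin 2 → ℂ) : q v = v 0 * v 1 := by
    simp [q, Matrix.toQuadraticForm', Matrix.toLinearMap₂'_apply, Matrix.single]
  have hn : IsNondegenerateBinary q := by
    intro v hv
    have h0 := hv ![0, 1]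
    have h1 := hv ![1, 0]
    simp only [QuadraticMap.polarBilin_apply_apply, QuadraticMap.polar, hq, Pi.add_apply] at h0 h1
    simp at h0 h1
    ext i
    fin_cases i
    · simp; linear_combination h0
    · simp; linear_combination h1
  exact ⟨q, q, hn, hn, fun x => by rw [quadrangleF_apply, hq]; rfl,
    fun x => by rw [quadrangleG_apply, hq]; rfl⟩

lemma generatedBy_polystableFamily_iff {f g : Quadric} :
    GeneratedBy PolystableFamily f g ↔ ProjEquiv f g quadrangleF quadrangleG := by
  constructor
  · rintro ⟨f', g', h, he⟩
    obtain ⟨A, -, -, hA⟩ := h.exists_normalForm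
    exact he.trans ⟨A, hA⟩
  · intro h
    exact ⟨_, _, polystableFamily_quadrangle, h⟩

lemma IsReducibleQuadric.act {f : Quadric} (h : IsReducibleQuadric f) (A : SL(4, ℂ)) :
    IsReducibleQuadric (act A f) := by
  obtain ⟨l, m, h⟩ := h
  exact ⟨l ∘ₗ Matrix.toLin' (A : Matrix (Fin 4) (Fin 4) ℂ),
    m ∘ₗ Matrix.toLin' (A : Matrix (Fin 4) (Fin 4) ℂ), fun x => h _⟩

lemma PolystableFamily.reducible_singular {f g : Quadric} (h : PolystableFamily f g) :
    (IsReducibleQuadric f ∧ ¬ IsSmoothQuadric f) ∧ (IsReducibleQuadric g ∧ ¬ IsSmoothQuadric g) := by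
  obtain ⟨A, ⟨x, hx, hxf⟩, ⟨y, hy, hyg⟩, -⟩ := h.exists_normalForm
  have h1 : IsReducibleQuadric (x • quadrangleF) :=
    ⟨x • LinearMap.proj 0, LinearMap.proj 1, fun v => by
      simp [quadrangleF_apply, mul_assoc]⟩
  have h2 : IsReducibleQuadric (y • quadrangleG) :=
    ⟨y • LinearMap.proj 2, LinearMap.proj 3, fun v => by
      simp [quadrangleG_apply, mul_assoc]⟩
  obtain ⟨q, q', -, -, hf, hg⟩ := h
  have hq0 (q : QuadraticForm ℂ (Fin 2 → ℂ)) : q ![0, 0] = 0 := by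
    convert q.map_zero using 2
    ext i; fin_cases i <;> rfl
  refine ⟨⟨?_, fun hs => ?_⟩, ⟨?_, fun hs => ?_⟩⟩
  · rw [← act_inv_act A f, hxf]; exact h1.act _
  · refine hs (e 2) (e_ne_zero 2) (by rw [hf]; simp [e, hq0]) (LinearMap.ext fun w => ?_)
    simp [QuadraticMap.polar, hf, e, hq0]
  · rw [← act_inv_act A g, hyg]; exact h2.act _
  · refine hs (e 0) (e_ne_zero 0) (by rw [hg]; simp [e, hq0]) (LinearMap.ext fun w => ?_)
    simp [QuadraticMap.polar, hg, e, hq0]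

/-! ### Smooth base loci: diagonalisation -/

/-- The form `(∑ aᵢ xᵢ²) / 2`. -/
noncomputable def diagForm (a : Fin 4 → ℂ) : Quadric := quad ((1 / 2 : ℂ) • Matrix.diagonal a)

lemma gram_diagForm (a : Fin 4 → ℂ) : gram (diagForm a) = Matrix.diagonal a :=
  gram_quad_half (Matrix.diagonal_transpose a)

open Polynomial in
/-- If all members of the pencil were singular, a kernel vector of `F + t G` depending polynomially
on `t` would trace out singular points of the base locus. -/
lemma exists_det_ne_zero_of_smooth {f g : Quadric} (hs : HasSmoothBaseLocus f g) :
    ∃ t : ℂ, (gram (f + t • g)).det ≠ 0 := by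
  set F := gram f with hF
  set G := gram g with hG
  let M : Matrix (Fin 4) (Fin 4) ℂ[X] := Matrix.of fun i j => C (F i j) + X * C (G i j)
  have hev (t : ℂ) : M.map (evalRingHom t) = F + t • G := by
    ext i j; simp [M]; ring
  have hgram (t : ℂ) : gram (f + t • g) = F + t • G := by rw [map_add, map_smul]
  by_cases hM : M.det = 0
  · exfalso
    obtain ⟨v, hv, hMv⟩ := Matrix.exists_mulVec_eq_zero_iff.2 hM
    obtain ⟨i, hi⟩ : ∃ i, v i ≠ 0 := by
      by_contra! hcon
      exact hv (funext hcon)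
    obtain ⟨t, ht⟩ : ∃ t : ℂ, (v i).eval t ≠ 0 := by
      by_contra! hcon
      exact hi (Polynomial.funext fun t => by rw [hcon t, eval_zero])
    set p : Vec := fun j => (v j).eval t with hp
    set p' : Vec := fun j => (derivative (v j)).eval t with hp'
    have hrow (i : Fin 4) : ∑ j, (C (F i j) + X * C (G i j)) * v j = 0 := congrFun hMv i
    have h1 (i : Fin 4) : ∑ j, (F i j + t * G i j) * p j = 0 := by
      have := congrArg (eval t) (hrow i)
      simpa [eval_finsetSum, mul_comm t] using this
    have h2 (i : Fin 4) : ∑ j, (G i j * p j + (F i j + t * G i j) * p' j) = 0 := by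
      have := congrArg (fun q => eval t (derivative q)) (hrow i)
      simpa [eval_finsetSum, mul_comm t] using this
    have hker : (f + t • g).polarBilin p = 0 := by
      rw [polarBilin_apply_eq_zero_iff, hgram]
      ext i
      exact h1 i
    -- pairing the differentiated equation with `p` kills the second summand by symmetry
    have hg : g p = 0 := by
      rw [apply_eq_zero_iff, polarBilin_eq_sum, ← hG]
      have h3 : ∑ i, p i * ∑ j, (G i j * p j + (F i j + t * G i j) * p' j) = 0 := by
        simp [h2]
      have h4 : ∑ j, p' j * ∑ i, (F j i + t * G j i) * p i = 0 := by simp [h1]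
      simp only [Fin.sum_univ_four] at h3 h4 ⊢
      simp only [hF, hG, gram_comm f 1 0, gram_comm f 2 0, gram_comm f 3 0, gram_comm f 2 1,
        gram_comm f 3 1, gram_comm f 3 2, gram_comm g 1 0, gram_comm g 2 0, gram_comm g 3 0,
        gram_comm g 2 1, gram_comm g 3 1, gram_comm g 3 2] at h3 h4 ⊢
      linear_combination h3 - h4
    have hf : f p = 0 := by
      have : (f + t • g) p = 0 := by rw [apply_eq_zero_iff, hker]; rfl
      simpa [hg] using this
    refine hs ⟨p, fun h0 => ht (congrFun h0 i), ⟨hf, hg⟩, fun hl => ?_⟩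
    rw [LinearIndependent.pair_iff] at hl
    have := polarBilin_add_smul f g 1 t
    rw [one_smul] at this
    rw [this] at hker
    exact one_ne_zero (hl 1 t hker).1
  · obtain ⟨t, ht⟩ : ∃ t : ℂ, M.det.eval t ≠ 0 := by
      by_contra! hcon
      exact hM (Polynomial.funext fun t => by rw [hcon t, eval_zero])
    refine ⟨t, ?_⟩
    rw [hgram, ← hev]
    have := (RingHom.map_det (evalRingHom t) M).symm
    rw [RingHom.mapMatrix_apply] at this
    rw [this]
    exact ht

/-- An endomorphism which is selfadjoint for a quadratic form and has no isotropic eigenvector is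
diagonalisable: for `u = (T - μ) v` in the kernel of `T - μ`, the vector `u` is isotropic. -/
lemma exists_eigenbasis_of_no_isotropic {h : Quadric} {T : Module.End ℂ Vec}
    (hsymm : ∀ v w, h.polarBilin (T v) w = h.polarBilin v (T w))
    (hiso : ∀ (μ : ℂ) v, T v = μ • v → h.polarBilin v v = 0 → v = 0) :
    ∃ b : Module.Basis (Fin 4) ℂ Vec, ∀ i, ∃ μ : ℂ, T (b i) = μ • b i := by
  -- generalised eigenvectors are eigenvectors
  have hgen (μ : ℂ) : T.maxGenEigenspace μ ≤ T.eigenspace μ := by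
    intro v hv
    rw [Module.End.mem_maxGenEigenspace] at hv
    obtain ⟨k, hk⟩ := hv
    have hstep : ∀ k (v : Vec), ((T - μ • (1 : Module.End ℂ Vec)) ^ k) v = 0 →
        (T - μ • (1 : Module.End ℂ Vec)) v = 0 := by
      intro k
      induction k with
      | zero => intro v hv; rw [pow_zero] at hv; change v = 0 at hv; rw [hv, map_zero]
      | succ k ih =>
        intro v hv
        rw [pow_succ] at hv
        have h1 := ih _ hv
        set u := (T - μ • (1 : Module.End ℂ Vec)) v with hu
        have hu' : u = T v - μ • v := rfl
        have h1' : T u - μ • u = 0 := h1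
        refine hiso μ u (sub_eq_zero.1 h1') ?_
        have : h.polarBilin u u = h.polarBilin v (T u - μ • u) := by
          have h2 (w : Vec) : h.polarBilin u w = h.polarBilin v (T w - μ • w) := by
            rw [hu', map_sub, map_sub, LinearMap.sub_apply, hsymm, map_smul, map_smul,
              LinearMap.smul_apply]
          exact h2 u
        rw [this, h1', map_zero]
    rw [Module.End.mem_eigenspace_iff]
    exact sub_eq_zero.1 (hstep k v hk)
  have htop : ⨆ μ, T.eigenspace μ = ⊤ := by
    rw [eq_top_iff, ← Module.End.iSup_maxGenEigenspace_eq_top T]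
    exact iSup_mono hgen
  have hint : DirectSum.IsInternal T.eigenspace :=
    DirectSum.isInternal_submodule_of_iSupIndep_of_iSup_eq_top T.eigenspaces_iSupIndep htop
  let B := hint.collectedBasis fun μ => Module.finBasis ℂ (T.eigenspace μ)
  refine ⟨B.reindex (B.indexEquiv (Pi.basisFun ℂ (Fin 4))), fun i =>
    ⟨((B.indexEquiv (Pi.basisFun ℂ (Fin 4))).symm i).1, ?_⟩⟩
  rw [Module.Basis.reindex_apply]
  exact Module.End.mem_eigenspace_iff.1 (DirectSum.IsInternal.collectedBasis_mem hint _ _)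

/-- A pencil with smooth base locus is equivalent to one generated by `∑ xᵢ²` and `∑ aᵢ xᵢ²` with
distinct `aᵢ`. The operator relating two of the forms has no isotropic eigenvectors, because these
would be singular points; hence it is semisimple with simple spectrum. -/
lemma exists_diagForm_of_smooth {f g : Quadric} (hs : HasSmoothBaseLocus f g) :
    ∃ a : Fin 4 → ℂ, Function.Injective a ∧ ProjEquiv f g (diagForm fun _ => 1) (diagForm a) := by
  obtain ⟨t, ht⟩ := exists_det_ne_zero_of_smooth hs
  set h := f + t • g with hh
  have hspan : Submodule.span ℂ {h, g} = Submodule.span ℂ {f, g} := by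
    rw [← span_combination_eq f g (a := 1) (b := t) (c := 0) (d := 1) (by simp)]
    simp [hh]
  have hs' : HasSmoothBaseLocus h g := fun ⟨p, hp⟩ => hs ⟨p, isSingularPoint_of_span_eq hspan hp⟩
  set H := gram h with hH
  set T : Module.End ℂ Vec := Matrix.toLin' (H⁻¹ * gram g) with hT
  have hunit : IsUnit H.det := ht.isUnit
  have hpol (v w : Vec) : g.polarBilin v w = h.polarBilin v (T w) := by
    rw [polarBilin_eq, polarBilin_eq, hT, Matrix.toLin'_apply, Matrix.mulVec_mulVec,
      ← Matrix.mul_assoc, Matrix.mul_nonsing_inv _ hunit, Matrix.one_mul]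
  have hsymm (v w : Vec) : h.polarBilin (T v) w = h.polarBilin v (T w) := by
    rw [← hpol, polarBilin_comm h, ← hpol, polarBilin_comm g]
  have hiso (μ : ℂ) (v : Vec) (hv : T v = μ • v) (h0 : h.polarBilin v v = 0) : v = 0 := by
    by_contra hv0
    refine hs' ⟨v, hv0, ⟨(apply_eq_zero_iff _ _).2 h0, (apply_eq_zero_iff _ _).2 ?_⟩, fun hl => ?_⟩
    · rw [hpol, hv, map_smul, h0, smul_zero]
    · rw [LinearIndependent.pair_iff] at hl
      refine one_ne_zero (hl (-μ) 1 (LinearMap.ext fun w => ?_)).2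
      have : g.polarBilin v w = μ * h.polarBilin v w := by
        rw [hpol, ← hsymm, hv, map_smul]; rfl
      simp only [LinearMap.add_apply, LinearMap.smul_apply, this, LinearMap.zero_apply, smul_eq_mul]
      ring
  obtain ⟨b, hb⟩ := exists_eigenbasis_of_no_isotropic hsymm hiso
  choose a ha using hb
  -- a two-dimensional eigenspace would contain an isotropic vector
  have hinj : Function.Injective a := by
    intro i j hij
    by_contra hne
    obtain ⟨s, t, hst, hroot⟩ := exists_binary_root (h.polarBilin (b i) (b i))
      (2 * h.polarBilin (b i) (b j)) (h.polarBilin (b j) (b j))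
    have h0 := hiso (a i) (s • b i + t • b j) (by
        rw [map_add, map_smul, map_smul, ha, ha, ← hij, smul_add, smul_comm, smul_comm t]) (by
        simp only [map_add, map_smul, LinearMap.add_apply, LinearMap.smul_apply, smul_eq_mul,
          polarBilin_comm h (b j) (b i)]
        linear_combination hroot)
    refine hst ⟨?_, ?_⟩
    · have h1 := congrArg (fun v => b.repr v i) h0
      simpa [Finsupp.single_apply, hne, Ne.symm hne] using h1
    · have h1 := congrArg (fun v => b.repr v j) h0
      simpa [Finsupp.single_apply, hne, Ne.symm hne] using h1
  have horth (i j : Fin 4) (hij : i ≠ j) : h.polarBilin (b i) (b j) = 0 := by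
    have h1 := hsymm (b i) (b j)
    rw [ha, ha, map_smul, map_smul, LinearMap.smul_apply, smul_eq_mul, smul_eq_mul] at h1
    have h2 : (a i - a j) * h.polarBilin (b i) (b j) = 0 := by linear_combination h1
    exact (mul_eq_zero.1 h2).resolve_left (sub_ne_zero.2 (hinj.ne hij))
  have hdiag (i : Fin 4) : h.polarBilin (b i) (b i) ≠ 0 := fun h0 =>
    b.ne_zero i (hiso (a i) _ (ha i) h0)
  -- normalise the orthogonal eigenbasis
  have hroot (i : Fin 4) : ∃ r : ℂ, r ^ 2 = (h.polarBilin (b i) (b i))⁻¹ :=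
    IsAlgClosed.exists_pow_nat_eq _ (by norm_num)
  choose r hr using hroot
  have hr0 (i : Fin 4) : r i ≠ 0 := by
    intro h0
    have := hr i
    rw [h0, zero_pow two_ne_zero] at this
    exact hdiag i (inv_eq_zero.1 this.symm)
  have hLI : LinearIndependent ℂ fun i => r i • b i := by
    have := b.linearIndependent.units_smul fun i => Units.mk0 (r i) (hr0 i)
    exact this
  have hval (i j : Fin 4) : h.polarBilin (r i • b i) (r j • b j) = if i = j then 1 else 0 := by
    rw [map_smul, map_smul, LinearMap.smul_apply, smul_eq_mul, smul_eq_mul]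
    split_ifs with hij
    · subst hij
      have := mul_inv_cancel₀ (hdiag i)
      rw [← hr] at this
      linear_combination this
    · rw [horth i j hij]; ring
  obtain ⟨A, -, -, -, -, -, hA⟩ := projEquiv_of_basis (f := h) (g := g)
    (f' := diagForm fun _ => 1) (g' := diagForm a) hLI one_ne_zero one_ne_zero
    (by
      intro i j
      rw [gram_diagForm, hval, Matrix.diagonal_apply, one_mul])
    (by
      intro i j
      have hT' : T (r j • b j) = a j • (r j • b j) := by rw [map_smul, ha, smul_comm]
      rw [gram_diagForm, hpol, hT', map_smul, hval, Matrix.diagonal_apply, one_mul, smul_eq_mul]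
      split_ifs with hij
      · rw [hij, mul_one]
      · rw [mul_zero])
  exact ⟨a, hinj, (ProjEquiv.of_span_eq hspan.symm).trans ⟨A, hA⟩⟩

/-! ### Diagonal pencils: closedness of the orbit -/

/-- Boundedness of a complex valued function. -/
def IsBddFun {X : Type*} (φ : X → ℂ) : Prop := ∃ K : ℝ, ∀ x, ‖φ x‖ ≤ K

namespace IsBddFun

variable {X : Type*} {φ ψ : X → ℂ}

lemma const (z : ℂ) : IsBddFun fun _ : X => z := ⟨‖z‖, fun _ => le_rfl⟩

lemma add : IsBddFun φ → IsBddFun ψ → IsBddFun fun x => φ x + ψ x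
  | ⟨K, hK⟩, ⟨L, hL⟩ => ⟨K + L, fun x => (norm_add_le _ _).trans (add_le_add (hK x) (hL x))⟩

lemma mul : IsBddFun φ → IsBddFun ψ → IsBddFun fun x => φ x * ψ x
  | ⟨K, hK⟩, ⟨L, hL⟩ => ⟨K * L, fun x => by
      rw [norm_mul]
      exact mul_le_mul (hK x) (hL x) (norm_nonneg _) ((norm_nonneg _).trans (hK x))⟩

lemma sub (h : IsBddFun φ) (h' : IsBddFun ψ) : IsBddFun fun x => φ x - ψ x := by
  simpa [sub_eq_add_neg] using h.add ((const (-1)).mul h')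

lemma sum {ι : Type*} (s : Finset ι) {φ : ι → X → ℂ} (h : ∀ i, IsBddFun (φ i)) :
    IsBddFun fun x => ∑ i ∈ s, φ i x := by
  classical
  induction s using Finset.induction_on with
  | empty => simpa using const 0
  | insert i s hi ih => simpa [Finset.sum_insert hi] using (h i).add ih

lemma prod {ι : Type*} (s : Finset ι) {φ : ι → X → ℂ} (h : ∀ i, IsBddFun (φ i)) :
    IsBddFun fun x => ∏ i ∈ s, φ i x := by
  classical
  induction s using Finset.induction_on with
  | empty => simpa using const 1
  | insert i s hi ih => simpa [Finset.prod_insert hi] using (h i).mul ih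

lemma det {N : X → Matrix (Fin 4) (Fin 4) ℂ} (h : ∀ i j, IsBddFun fun x => N x i j) :
    IsBddFun fun x => (N x).det := by
  simp only [Matrix.det_apply']
  exact sum _ fun σ => (const _).mul (prod _ fun i => h _ _)

lemma adjugate {N : X → Matrix (Fin 4) (Fin 4) ℂ} (h : ∀ i j, IsBddFun fun x => N x i j)
    (i j : Fin 4) : IsBddFun fun x => (N x).adjugate i j := by
  simp only [Matrix.adjugate_apply]
  refine det fun k l => ?_
  by_cases hk : k = j
  · subst hk
    simpa using const _
  · simpa [Matrix.updateRow_ne hk] using h k l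

lemma matrix_mul {N N' : X → Matrix (Fin 4) (Fin 4) ℂ} (h : ∀ i j, IsBddFun fun x => N x i j)
    (h' : ∀ i j, IsBddFun fun x => N' x i j) (i j : Fin 4) :
    IsBddFun fun x => (N x * N' x) i j := by
  simp only [Matrix.mul_apply]
  exact sum _ fun k => (h i k).mul (h' k j)

lemma of_sq (h : IsBddFun fun x => φ x ^ 2) : IsBddFun φ := by
  obtain ⟨K, hK⟩ := h
  refine ⟨1 + K, fun x => ?_⟩
  have := hK x
  rw [norm_pow] at this
  nlinarith [sq_nonneg (‖φ x‖ - 1), norm_nonneg (φ x)]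

end IsBddFun

/-- Among the five points `t = 0, …, 4`, each of four linear forms `u + t v` can be small at one
point only, so that at some point none of them is small. -/
lemma exists_all_large (u v : Fin 4 → ℂ) :
    ∃ t : Fin 5, ∀ i, ‖u i‖ + ‖v i‖ ≤ 11 * ‖u i + ((t : ℕ) : ℂ) * v i‖ := by
  by_contra! hcon
  choose k hk using hcon
  obtain ⟨s, t, hst, hk'⟩ := Fintype.exists_ne_map_eq_of_card_lt k (by simp)
  have hs := hk s
  have ht := hk t
  rw [← hk'] at ht
  generalize u (k s) = x at *
  generalize v (k s) = y at *
  have hst1 : 1 ≤ ‖((s : ℕ) : ℂ) - ((t : ℕ) : ℂ)‖ := by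
    have h1 : (1 : ℤ) ≤ |((s : ℕ) : ℤ) - ((t : ℕ) : ℤ)| := by
      refine Int.one_le_abs (sub_ne_zero.2 ?_)
      exact_mod_cast fun h => hst (Fin.ext h)
    have h2 : ((s : ℕ) : ℂ) - ((t : ℕ) : ℂ) = (((s : ℕ) : ℤ) - ((t : ℕ) : ℤ) : ℤ) := by
      push_cast; rfl
    rw [h2, Complex.norm_intCast]
    exact_mod_cast h1
  have hy : ‖y‖ ≤ ‖x + ((s : ℕ) : ℂ) * y‖ + ‖x + ((t : ℕ) : ℂ) * y‖ := by
    calc ‖y‖ ≤ ‖((s : ℕ) : ℂ) - ((t : ℕ) : ℂ)‖ * ‖y‖ := le_mul_of_one_le_left (norm_nonneg _) hst1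
      _ = ‖(x + ((s : ℕ) : ℂ) * y) - (x + ((t : ℕ) : ℂ) * y)‖ := by
        rw [← norm_mul]; congr 1; ring
      _ ≤ _ := norm_sub_le _ _
  have hx : ‖x‖ ≤ ‖x + ((s : ℕ) : ℂ) * y‖ + 4 * ‖y‖ := by
    calc ‖x‖ = ‖(x + ((s : ℕ) : ℂ) * y) - ((s : ℕ) : ℂ) * y‖ := by congr 1; ring
      _ ≤ ‖x + ((s : ℕ) : ℂ) * y‖ + ‖((s : ℕ) : ℂ) * y‖ := norm_sub_le _ _
      _ ≤ _ := by
        rw [norm_mul, Complex.norm_natCast]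
        have : ((s : ℕ) : ℝ) ≤ 4 := by exact_mod_cast Nat.le_of_lt_succ s.2
        gcongr
  linarith

/-- If the products of any two of four numbers are bounded below, each of the numbers is bounded in
terms of the product of all four. -/
lemma sq_le_of_prod_le {n : Fin 4 → ℝ} {P δ : ℝ} (hn : ∀ i, 0 ≤ n i) (hδ : 0 < δ)
    (h : ∀ i j, i ≠ j → δ ≤ n i * n j) (hP : ∏ i, n i ≤ P) (i : Fin 4) :
    n i ^ 2 ≤ P ^ 2 / δ ^ 3 := by
  rw [le_div_iff₀ (by positivity)]
  rw [Fin.prod_univ_four] at hP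
  have key (i j k l : Fin 4) (hjk : j ≠ k) (hkl : k ≠ l) (hjl : j ≠ l)
      (hprod : n i * n j * n k * n l ≤ P) : n i ^ 2 * δ ^ 3 ≤ P ^ 2 := by
    have h1 : n i * n j * δ ≤ P := by
      have := mul_le_mul_of_nonneg_left (h k l hkl) (mul_nonneg (hn i) (hn j))
      linarith
    have h2 : n i * n k * δ ≤ P := by
      have := mul_le_mul_of_nonneg_left (h j l hjl) (mul_nonneg (hn i) (hn k))
      linarith
    have h3 : 0 ≤ n i * n j * δ := mul_nonneg (mul_nonneg (hn i) (hn j)) hδ.le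
    have h4 : 0 ≤ n i * n k * δ := mul_nonneg (mul_nonneg (hn i) (hn k)) hδ.le
    have h5 : (n i * n j * δ) * (n i * n k * δ) ≤ P * P := mul_le_mul h1 h2 h4 (h3.trans h1)
    have h6 : n i ^ 2 * δ ^ 2 * δ ≤ n i ^ 2 * δ ^ 2 * (n j * n k) :=
      mul_le_mul_of_nonneg_left (h j k hjk) (by positivity)
    linarith
  fin_cases i
  · exact key 0 1 2 3 (by decide) (by decide) (by decide) hP
  · exact key 1 0 2 3 (by decide) (by decide) (by decide) (by linarith)
  · exact key 2 0 1 3 (by decide) (by decide) (by decide) (by linarith)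
  · exact key 3 0 1 2 (by decide) (by decide) (by decide) (by linarith)

/-- Four pairwise independent linear forms in two variables with given pairwise determinants are
bounded in terms of a bound for their product. -/
lemma exists_bound_of_prod_le {a : Fin 4 → ℂ} (ha : Function.Injective a) (c₀ : ℝ) :
    ∃ K : ℝ, ∀ u v : Fin 4 → ℂ, (∀ i j, u i * v j - u j * v i = a j - a i) →
      (∀ t : ℕ, t ≤ 4 → ‖∏ i, (u i + (t : ℂ) * v i)‖ ≤ c₀) → ∀ i, ‖u i‖ ≤ K ∧ ‖v i‖ ≤ K := by
  obtain ⟨δ, hδ, hδa⟩ : ∃ δ : ℝ, 0 < δ ∧ ∀ i j, i ≠ j → δ ≤ ‖a j - a i‖ := by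
    have : Nonempty {x : Fin 4 × Fin 4 // x.1 ≠ x.2} := ⟨⟨(0, 1), by decide⟩⟩
    obtain ⟨⟨⟨i, j⟩, hij⟩, hmin⟩ := Finite.exists_min
      (fun x : {x : Fin 4 × Fin 4 // x.1 ≠ x.2} => ‖a x.1.2 - a x.1.1‖)
    exact ⟨‖a j - a i‖, norm_pos_iff.2 (sub_ne_zero.2 (ha.ne (Ne.symm hij))),
      fun i j hij => hmin ⟨(i, j), hij⟩⟩
  refine ⟨1 + (11 ^ 4 * c₀) ^ 2 / δ ^ 3, fun u v huv hprod i => ?_⟩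
  obtain ⟨t, ht⟩ := exists_all_large u v
  set n : Fin 4 → ℝ := fun i => ‖u i‖ + ‖v i‖ with hn
  have hn0 (i : Fin 4) : 0 ≤ n i := by positivity
  have hP : ∏ i, n i ≤ 11 ^ 4 * c₀ := by
    calc ∏ i, n i ≤ ∏ i, (11 * ‖u i + ((t : ℕ) : ℂ) * v i‖) :=
          Finset.prod_le_prod (fun i _ => hn0 i) fun i _ => ht i
      _ = 11 ^ 4 * ‖∏ i, (u i + ((t : ℕ) : ℂ) * v i)‖ := by
        rw [Finset.prod_mul_distrib, norm_prod]; simp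
      _ ≤ _ := by gcongr; exact hprod t (Nat.le_of_lt_succ t.2)
  have h2 := sq_le_of_prod_le hn0 hδ (fun i j hij => by
    refine (hδa i j hij).trans ?_
    rw [← huv i j]
    refine (norm_sub_le _ _).trans ?_
    rw [norm_mul, norm_mul]
    simp only [hn]
    nlinarith [mul_nonneg (norm_nonneg (u i)) (norm_nonneg (u j)),
      mul_nonneg (norm_nonneg (v i)) (norm_nonneg (v j))]) hP i
  have h3 : n i ≤ 1 + (11 ^ 4 * c₀) ^ 2 / δ ^ 3 := by nlinarith [sq_nonneg (n i - 1), hn0 i]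
  have h4 : n i = ‖u i‖ + ‖v i‖ := rfl
  constructor <;> linarith [norm_nonneg (u i), norm_nonneg (v i)]

lemma isPencil_diagForm {a : Fin 4 → ℂ} (ha : Function.Injective a) :
    IsPencil (diagForm fun _ => 1) (diagForm a) := by
  rw [isPencil_iff]
  intro x y hxy
  have h1 := congrArg gram hxy
  rw [map_add, map_smul, map_smul, gram_diagForm, gram_diagForm, map_zero] at h1
  have h2 (i : Fin 4) : x + y * a i = 0 := by simpa using congrFun (congrFun h1 i) i
  have h3 : y * (a 0 - a 1) = 0 := by linear_combination h2 0 - h2 1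
  have hy := (mul_eq_zero.1 h3).resolve_right (sub_ne_zero.2 (ha.ne (by decide)))
  refine ⟨?_, hy⟩
  have := h2 0
  rwa [hy, zero_mul, add_zero] at this

lemma gram_act_diagForm (A : SL(4, ℂ)) (a : Fin 4 → ℂ) : gram (act A (diagForm a)) =
    (A : Matrix (Fin 4) (Fin 4) ℂ).transpose * Matrix.diagonal a * A := by
  rw [gram_act, gram_diagForm]

/-- The matrices `Aᵀ Dᵏ A` are polynomials in `Aᵀ A` and `Aᵀ D A`; interpolation then expresses
the squares of the entries of `A` by these. -/
lemma isBddFun_entries {X : Type*} {A : X → SL(4, ℂ)} {a : Fin 4 → ℂ} (ha : Function.Injective a)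
    (h0 : ∀ i j, IsBddFun fun x => gram (act (A x) (diagForm fun _ => 1)) i j)
    (h1 : ∀ i j, IsBddFun fun x => gram (act (A x) (diagForm a)) i j) (i j : Fin 4) :
    IsBddFun fun x => A x i j := by
  have hk (k : ℕ) : ∀ i j, IsBddFun fun x => gram (act (A x) (diagForm fun i => a i ^ k)) i j := by
    induction k with
    | zero => simpa using h0
    | succ k ih =>
      intro i j
      have hrec (x : X) : gram (act (A x) (diagForm fun i => a i ^ (k + 1))) =
          gram (act (A x) (diagForm fun i => a i ^ k)) *
            ((gram (act (A x) (diagForm fun _ => 1))).adjugate *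
              gram (act (A x) (diagForm a))) := by
        have hdet : (A x : Matrix (Fin 4) (Fin 4) ℂ).det = 1 := (A x).2
        simp only [gram_act_diagForm]
        generalize (A x : Matrix (Fin 4) (Fin 4) ℂ) = N at *
        have hN : N * N.adjugate = 1 := by rw [Matrix.mul_adjugate, hdet, one_smul]
        have hN' : N.transpose.adjugate * N.transpose = 1 := by
          rw [Matrix.adjugate_mul, Matrix.det_transpose, hdet, one_smul]
        have hone : Matrix.diagonal (fun _ : Fin 4 => (1 : ℂ)) = 1 := Matrix.diagonal_one
        have hD : Matrix.diagonal (fun i => a i ^ (k + 1)) =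
            Matrix.diagonal (fun i => a i ^ k) * Matrix.diagonal a := by
          rw [Matrix.diagonal_mul_diagonal]
          congr 1
        rw [hone, Matrix.mul_one, Matrix.adjugate_mul_distrib, hD]
        calc _ = N.transpose * Matrix.diagonal (fun i => a i ^ k) * 1 * 1 * Matrix.diagonal a
              * N := by simp only [Matrix.mul_one, Matrix.mul_assoc]
          _ = N.transpose * Matrix.diagonal (fun i => a i ^ k) * (N * N.adjugate) *
              (N.transpose.adjugate * N.transpose) * Matrix.diagonal a * N := by rw [hN, hN']
          _ = _ := by simp only [Matrix.mul_assoc]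
      simp only [hrec]
      exact IsBddFun.matrix_mul ih (IsBddFun.matrix_mul (IsBddFun.adjugate h0) h1) i j
  -- the diagonal entries of `Aᵀ Dᵏ A` are the moments `∑ m, aₘ ^ k * A m j ^ 2`, from which the
  -- squares are recovered by inverting a Vandermonde matrix
  have hV : IsUnit (Matrix.vandermonde a).det :=
    (Matrix.det_vandermonde_ne_zero_iff.2 ha).isUnit
  have hsq (x : X) : A x i j ^ 2 = ∑ k : Fin 4, (Matrix.vandermonde a)⁻¹ k i *
      gram (act (A x) (diagForm fun i => a i ^ (k : ℕ))) j j := by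
    have hgr (k : Fin 4) : gram (act (A x) (diagForm fun i => a i ^ (k : ℕ))) j j =
        ∑ m, Matrix.vandermonde a m k * A x m j ^ 2 := by
      rw [gram_act_diagForm, Matrix.mul_apply]
      refine Finset.sum_congr rfl fun m _ => ?_
      rw [Matrix.mul_diagonal, Matrix.transpose_apply, Matrix.vandermonde_apply]
      ring
    have hinv (m : Fin 4) : ∑ k, Matrix.vandermonde a m k * (Matrix.vandermonde a)⁻¹ k i =
        if m = i then 1 else 0 := by
      rw [← Matrix.mul_apply, Matrix.mul_nonsing_inv _ hV, Matrix.one_apply]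
    simp only [hgr, Finset.mul_sum]
    rw [Finset.sum_comm]
    have (m : Fin 4) : ∑ k, (Matrix.vandermonde a)⁻¹ k i * (Matrix.vandermonde a m k * A x m j ^ 2)
        = if m = i then A x m j ^ 2 else 0 := by
      have h2 := congrArg (· * A x m j ^ 2) (hinv m)
      simp only [Finset.sum_mul, ite_mul, one_mul, zero_mul] at h2
      rw [← h2]
      exact Finset.sum_congr rfl fun k _ => by ring
    simp only [this, Finset.sum_ite_eq', Finset.mem_univ, if_true]
  refine IsBddFun.of_sq ?_
  simp only [hsq]
  exact IsBddFun.sum _ fun k => (IsBddFun.const _).mul (hk k j j)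

/-- If `act A F ∧ act A G` is bounded, so are suitable generators of the pencil; as the roots of its
determinant are distinct, the coefficients relating these to `act A F` and `act A G` are bounded,
hence so are `act A F` and `act A G`, and finally `A`. -/
lemma isClosed_orbit_diagForm {a : Fin 4 → ℂ} (ha : Function.Injective a) :
    IsClosed (orbit (wedge (diagForm fun _ => 1) (diagForm a))) := by
  refine isClosed_orbit_of_proper _ _ fun C hC => ?_
  set F := diagForm fun _ => 1 with hF
  set G := diagForm a with hG
  set c₀ := Real.sqrt C with hc
  have hc0 : 0 < c₀ := Real.sqrt_pos.2 hC
  let X := {A : SL(4, ℂ) // ∀ c d, ‖plucker (gramEntry c) (gramEntry d)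
    (actWedge A (wedge F G))‖ ≤ C}
  have hgen (x : X) := exists_small_generators ((isPencil_diagForm ha).act x.1) hc0
    (by
      have := x.2
      simp only [actWedge_wedge] at this
      rwa [hc, Real.sq_sqrt hC.le])
  choose p q r s hdet hsmall using hgen
  -- the linear forms `(p + q aᵢ) + t (r + s aᵢ)` are the factors of the determinant along the
  -- pencil
  have hprod (x : X) (t : ℂ) : ∏ i, (p x + q x * a i + t * (r x + s x * a i)) =
      (gram ((p x • act x.1 F + q x • act x.1 G) +
        t • (r x • act x.1 F + s x • act x.1 G))).det := by
    have : (p x • act x.1 F + q x • act x.1 G) + t • (r x • act x.1 F + s x • act x.1 G) =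
        (p x + t * r x) • act x.1 F + (q x + t * s x) • act x.1 G := by module
    rw [this, map_add, map_smul, map_smul, det_gram_act_combination, hF, hG, gram_diagForm,
      gram_diagForm, Matrix.smul_eq_diagonal_mul, Matrix.smul_eq_diagonal_mul,
      Matrix.diagonal_mul_diagonal, Matrix.diagonal_mul_diagonal, Matrix.diagonal_add,
      Matrix.det_diagonal]
    refine Finset.prod_congr rfl fun i _ => ?_
    ring
  obtain ⟨K, hK⟩ := exists_bound_of_prod_le ha (24 * (5 * c₀) ^ 4)
  have huv (x : X) := hK (fun i => p x + q x * a i) (fun i => r x + s x * a i)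
    (fun i j => by linear_combination (a j - a i) * hdet x) (fun t ht => by
      rw [hprod]
      refine norm_det_le fun i j => ?_
      rw [map_add, map_smul, Matrix.add_apply, Matrix.smul_apply]
      refine (norm_add_le _ _).trans ?_
      rw [norm_smul, Complex.norm_natCast]
      have h1 := (hsmall x i j).1
      have h2 := (hsmall x i j).2
      have h3 : (t : ℝ) ≤ 4 := by exact_mod_cast ht
      have h4 : (t : ℝ) * ‖gram (r x • act x.1 F + s x • act x.1 G) i j‖ ≤ 4 * c₀ := by gcongr
      linarith)
  have hab : a 0 - a 1 ≠ 0 := sub_ne_zero.2 (ha.ne (by decide))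
  have hu (i : Fin 4) : IsBddFun fun x => p x + q x * a i := ⟨K, fun x => (huv x i).1⟩
  have hv (i : Fin 4) : IsBddFun fun x => r x + s x * a i := ⟨K, fun x => (huv x i).2⟩
  have hq : IsBddFun q := by
    have := ((hu 0).sub (hu 1)).mul (IsBddFun.const (a 0 - a 1)⁻¹)
    convert this using 2 with x
    field_simp
    ring
  have hs : IsBddFun s := by
    have := ((hv 0).sub (hv 1)).mul (IsBddFun.const (a 0 - a 1)⁻¹)
    convert this using 2 with x
    field_simp
    ring
  have hp : IsBddFun p := by
    simpa using (hu 0).sub (hq.mul (IsBddFun.const (a 0)))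
  have hr : IsBddFun r := by
    simpa using (hv 0).sub (hs.mul (IsBddFun.const (a 0)))
  have hf (i j : Fin 4) : IsBddFun fun x => gram (p x • act x.1 F + q x • act x.1 G) i j :=
    ⟨c₀, fun x => (hsmall x i j).1⟩
  have hg (i j : Fin 4) : IsBddFun fun x => gram (r x • act x.1 F + s x • act x.1 G) i j :=
    ⟨c₀, fun x => (hsmall x i j).2⟩
  have h0 (i j : Fin 4) : IsBddFun fun x : X => gram (act x.1 F) i j := by
    have := (hs.mul (hf i j)).sub (hq.mul (hg i j))
    convert this using 2 with x
    simp only [map_add, map_smul, Matrix.add_apply, Matrix.smul_apply, smul_eq_mul]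
    linear_combination -(gram (act x.1 F) i j) * hdet x
  have h1 (i j : Fin 4) : IsBddFun fun x : X => gram (act x.1 G) i j := by
    have := (hp.mul (hg i j)).sub (hr.mul (hf i j))
    convert this using 2 with x
    simp only [map_add, map_smul, Matrix.add_apply, Matrix.smul_apply, smul_eq_mul]
    linear_combination -(gram (act x.1 G) i j) * hdet x
  have hA (i j : Fin 4) := isBddFun_entries (A := fun x : X => x.1) ha h0 h1 i j
  choose L hL using hA
  refine ⟨∑ i, ∑ j, |L i j|, fun A hA => ⟨A, rfl, fun i j => (hL i j ⟨A, hA⟩).trans ?_⟩⟩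
  refine (le_abs_self _).trans ?_
  calc |L i j| ≤ ∑ j, |L i j| :=
        Finset.single_le_sum (f := fun j => |L i j|) (fun _ _ => abs_nonneg _) (Finset.mem_univ j)
    _ ≤ _ := Finset.single_le_sum (f := fun i => ∑ j, |L i j|)
        (fun _ _ => Finset.sum_nonneg fun _ _ => abs_nonneg _) (Finset.mem_univ i)

/-! ### Diagonal pencils: finiteness of the stabiliser -/

lemma finite_setOf_pow_four_mem {R : Set ℂ} (hR : R.Finite) : {z : ℂ | z ^ 4 ∈ R}.Finite := by
  refine hR.preimage' (f := fun z : ℂ => z ^ 4) fun b _ => ?_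
  refine (Polynomial.nthRoots 4 b).toFinset.finite_toSet.subset fun z hz => ?_
  simpa [Polynomial.mem_nthRoots] using hz

/-- An element of the stabiliser of a diagonal pencil permutes the singular members of the pencil,
hence is a monomial matrix. -/
lemma exists_perm_of_mem_stabilizer {a : Fin 4 → ℂ} (ha : Function.Injective a) {A : SL(4, ℂ)}
    (hA : A ∈ stabilizer (wedge (diagForm fun _ => 1) (diagForm a))) :
    ∃ σ : Fin 4 → Fin 4, Function.Injective σ ∧ ∀ i j, j ≠ i → A j (σ i) = 0 := by
  set F := diagForm fun _ => 1 with hF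
  set G := diagForm a with hG
  have hw : wedge (act A F) (act A G) = wedge F G := by rw [← actWedge_wedge]; exact hA
  have hspan := span_eq_of_wedge_eq ((isPencil_diagForm ha).act A) hw
  have hgram (x y : ℂ) : gram (x • F + y • G) = Matrix.diagonal fun j => x + y * a j := by
    rw [map_add, map_smul, map_smul, hF, hG, gram_diagForm, gram_diagForm]
    ext j k
    by_cases h : j = k
    · subst h; simp
    · simp [h]
  -- The member `-aᵢ F + G`, which is singular at `e i`, is carried to a singular member `x F + y
  -- G`, with `x + y aₖ = 0` for some `k`. Hence `A` carries `e k` to a multiple of `e i`.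
  have hmem (i : Fin 4) : ∃ k, ∀ j, j ≠ i → A j k = 0 := by
    obtain ⟨x, y, hxy⟩ : ∃ x y : ℂ, x • F + y • G = act A ((-a i) • F + (1 : ℂ) • G) := by
      rw [← Submodule.mem_span_pair, ← hspan, map_add, map_smul, map_smul]
      exact Submodule.mem_span_pair.2 ⟨-a i, 1, rfl⟩
    have hdet := congrArg (fun f => (gram f).det) hxy
    simp only [map_add, map_smul] at hdet
    rw [det_gram_act_combination, ← map_smul, ← map_smul, ← map_add, hgram, ← map_smul,
      ← map_smul, ← map_add, hgram, Matrix.det_diagonal, Matrix.det_diagonal,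
      Finset.prod_eq_zero (i := i) (f := fun j => -a i + 1 * a j) (Finset.mem_univ i) (by ring),
      Finset.prod_eq_zero_iff] at hdet
    obtain ⟨k, -, hk⟩ := hdet
    refine ⟨k, fun j hj => ?_⟩
    have h1 : ((-a i) • F + (1 : ℂ) • G).polarBilin
        ((A : Matrix (Fin 4) (Fin 4) ℂ).mulVec (e k)) = 0 := by
      refine LinearMap.ext fun w => ?_
      obtain ⟨w, rfl⟩ := mulVec_surjective A w
      rw [← act_polarBilin, ← hxy, polarBilin_eq, hgram, LinearMap.zero_apply, e,
        single_dotProduct, Matrix.mulVec_diagonal, hk]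
      ring
    rw [polarBilin_apply_eq_zero_iff, hgram] at h1
    have h2 := congrFun h1 j
    rw [Matrix.mulVec_diagonal, e, Matrix.mulVec_single_one, Matrix.col_apply, Pi.zero_apply] at h2
    refine (mul_eq_zero.1 h2).resolve_left fun h3 => hj (ha ?_)
    linear_combination h3
  choose σ hσ using hmem
  refine ⟨σ, fun i j hij => ?_, hσ⟩
  by_contra hne
  have hdet : (A : Matrix (Fin 4) (Fin 4) ℂ).det = 0 := by
    refine Matrix.det_eq_zero_of_column_eq_zero (σ i) fun k => ?_
    by_cases hk : k = i
    · rw [hij]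
      exact hσ j k fun h => hne (hk ▸ h)
    · exact hσ i k hk
  exact one_ne_zero (A.2.symm.trans hdet)

/-- The fourth powers of the nonzero entries of an element of the stabiliser, a monomial matrix, are
determined by its permutation: the Plücker coordinates of the pencil fix the products of the
squares of any two of them. -/
lemma finite_stabilizer_diagForm {a : Fin 4 → ℂ} (ha : Function.Injective a) :
    (stabilizer (wedge (diagForm fun _ => 1) (diagForm a))).Finite := by
  let ρ (σ : Fin 4 → Fin 4) (i j : Fin 4) : ℂ := (a (σ j) - a (σ i)) / (a j - a i)
  set R : Set ℂ := insert 0 (Set.range fun x : (Fin 4 → Fin 4) × Fin 4 × Fin 4 × Fin 4 =>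
    ρ x.1 x.2.1 x.2.2.1 * ρ x.1 x.2.1 x.2.2.2 / ρ x.1 x.2.2.1 x.2.2.2) with hR
  have hfin : {z : ℂ | z ^ 4 ∈ R}.Finite :=
    finite_setOf_pow_four_mem ((Set.finite_range _).insert 0)
  have hpi := Set.Finite.pi fun _ : Fin 4 => Set.Finite.pi fun _ : Fin 4 => hfin
  refine Set.Finite.of_finite_image (f := fun A : SL(4, ℂ) => (A : Matrix (Fin 4) (Fin 4) ℂ))
    (hpi.subset ?_) Subtype.val_injective.injOn
  rintro _ ⟨A, hA, rfl⟩ j _ k _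
  obtain ⟨σ, hinj, hσ⟩ := exists_perm_of_mem_stabilizer ha hA
  have hw : wedge (act A (diagForm fun _ => 1)) (act A (diagForm a)) =
    wedge (diagForm fun _ => 1) (diagForm a) := by rw [← actWedge_wedge]; exact hA
  -- the diagonal entries of the two forms in the new coordinates
  have hentry (b : Fin 4 → ℂ) (i : Fin 4) :
      gramEntry (σ i, σ i) (act A (diagForm b)) = b i * A i (σ i) ^ 2 := by
    rw [gramEntry_apply, gram_act_diagForm, Matrix.mul_apply, Finset.sum_eq_single i]
    · rw [Matrix.mul_diagonal, Matrix.transpose_apply]; ring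
    · intro j _ hj
      rw [hσ i j hj, mul_zero]
    · simp
  have hratio (i j : Fin 4) (hij : i ≠ j) : (A i (σ i) * A j (σ j)) ^ 2 = ρ σ i j := by
    have h1 := congrArg (plucker (gramEntry (σ i, σ i)) (gramEntry (σ j, σ j))) hw
    rw [plucker_wedge, plucker_wedge, hentry, hentry, hentry, hentry] at h1
    simp only [gramEntry_apply, gram_diagForm, Matrix.diagonal_apply_eq] at h1
    rw [eq_div_iff (sub_ne_zero.2 (ha.ne (Ne.symm hij)))]
    linear_combination h1
  obtain ⟨i, rfl⟩ := (Finite.injective_iff_surjective.1 hinj) k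
  by_cases hji : j = i
  · subst hji
    have hother : ∀ j : Fin 4, ∃ l m : Fin 4, j ≠ l ∧ j ≠ m ∧ l ≠ m := by decide
    obtain ⟨l, m, hjl, hjm, hlm⟩ := hother j
    refine Or.inr ⟨(σ, j, l, m), ?_⟩
    have hlm' : ρ σ l m ≠ 0 := div_ne_zero (sub_ne_zero.2 (ha.ne (hinj.ne (Ne.symm hlm))))
      (sub_ne_zero.2 (ha.ne (Ne.symm hlm)))
    change ρ σ j l * ρ σ j m / ρ σ l m = A j (σ j) ^ 4
    rw [div_eq_iff hlm', ← hratio j l hjl, ← hratio j m hjm, ← hratio l m hlm]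
    ring
  · left
    change A j (σ i) ^ 4 = 0
    rw [hσ i j hji, zero_pow (by norm_num)]

lemma isStable_of_smooth {f g : Quadric} (hs : HasSmoothBaseLocus f g) : IsStable f g := by
  obtain ⟨a, ha, h⟩ := exists_diagForm_of_smooth hs
  exact h.symm.isStable ⟨⟨(wedge_ne_zero_iff _ _).2 (isPencil_diagForm ha),
    isClosed_orbit_diagForm ha⟩, finite_stabilizer_diagForm ha⟩

/-! ### Stability and singularities -/

lemma not_isStable_iff_hasSingularBaseLocus {f g : Quadric} :
    ¬ IsStable f g ↔ HasSingularBaseLocus f g := by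
  constructor
  · intro h
    by_contra hs
    exact h (isStable_of_smooth hs)
  · exact not_isStable_of_singular

lemma generatedBy_family1_iff (f g : Quadric) :
    GeneratedBy Family1 f g ↔ HasSingularBaseLocus f g :=
  ⟨hasSingularBaseLocus_of_generatedBy fun _ _ => hasSingularBaseLocus_of_family1,
    generatedBy_family1_of_singular⟩

lemma generatedBy_family4_iff (f g : Quadric) :
    GeneratedBy Family4 f g ↔ HasSingularBaseLocus f g :=
  ⟨hasSingularBaseLocus_of_generatedBy fun _ _ => hasSingularBaseLocus_of_family4,
    generatedBy_family4_of_singular⟩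

lemma tfae_not_isStable (f g : Quadric) :
    List.TFAE [¬ IsStable f g, HasSingularBaseLocus f g,
      GeneratedBy Family1 f g ∨ GeneratedBy Family2 f g ∨
        GeneratedBy Family3 f g ∨ GeneratedBy Family4 f g] := by
  tfae_have 1 ↔ 2 := not_isStable_iff_hasSingularBaseLocus
  tfae_have 2 → 3 := fun h => Or.inl (generatedBy_family1_of_singular h)
  tfae_have 3 → 2
    | .inl h => (generatedBy_family1_iff f g).1 h
    | .inr (.inl h) =>
      hasSingularBaseLocus_of_generatedBy (fun _ _ => hasSingularBaseLocus_of_family2) h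
    | .inr (.inr (.inl h)) =>
      hasSingularBaseLocus_of_generatedBy (fun _ _ => hasSingularBaseLocus_of_family3) h
    | .inr (.inr (.inr h)) => (generatedBy_family4_iff f g).1 h
  tfae_finish

lemma isStrictlyPolystable_quadrangle : IsStrictlyPolystable quadrangleF quadrangleG :=
  ⟨isPolystable_quadrangle, not_isStable_quadrangle⟩

lemma isStrictlyPolystable_iff {f g : Quadric} :
    IsStrictlyPolystable f g ↔ ProjEquiv f g quadrangleF quadrangleG := by
  constructor
  · rintro ⟨hps, hst⟩
    obtain ⟨α, a, b, c, hα, hdet, he⟩ := exists_splitForm_of_polystable_of_singular hps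
      (not_isStable_iff_hasSingularBaseLocus.1 hst)
    exact he.trans (splitForm_projEquiv_quadrangle hα hdet)
  · intro h
    exact h.symm.isStrictlyPolystable isStrictlyPolystable_quadrangle

/-! ### Invariants of the determinant quartic as polynomials in the coefficients -/

/-- The matrix of the coefficients of the `k`-th form, as indeterminates. -/
noncomputable def genericMatrix (k : Fin 2) :
    Matrix (Fin 4) (Fin 4) (MvPolynomial (Fin 2 × Fin 4 × Fin 4) ℂ) :=
  Matrix.of fun i j => MvPolynomial.X (k, i, j)

lemma genericMatrix_zero_map (f g : Quadric) :
    (genericMatrix 0).map (MvPolynomial.eval (coeffs f g)) = gram f := by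
  ext i j
  simp [genericMatrix, coeffs, gram_apply]

lemma genericMatrix_one_map (f g : Quadric) :
    (genericMatrix 1).map (MvPolynomial.eval (coeffs f g)) = gram g := by
  ext i j
  simp [genericMatrix, coeffs, gram_apply]

/-- Twice the coefficient of `x² y²` in `det (x F + y G)`. -/
def middleInvariant {R : Type*} [CommRing R] (F G : Matrix (Fin 4) (Fin 4) R) : R :=
  (F + G).det + (F - G).det - 2 * F.det - 2 * G.det

/-- Four times the discriminant of `det (x F + y G) / x²`, when the coefficients of `x y³` and `y⁴`
vanish. -/
def residualDiscriminant {R : Type*} [CommRing R] (F G : Matrix (Fin 4) (Fin 4) R) : R :=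
  ((F + G).det - (F - G).det) ^ 2 - 8 * F.det * middleInvariant F G

lemma middleInvariant_map {R S : Type*} [CommRing R] [CommRing S] (φ : R →+* S)
    (F G : Matrix (Fin 4) (Fin 4) R) :
    φ (middleInvariant F G) = middleInvariant (F.map φ) (G.map φ) := by
  simp only [middleInvariant, map_add, map_sub, map_mul, map_ofNat, RingHom.map_det,
    RingHom.mapMatrix_apply]

lemma residualDiscriminant_map {R S : Type*} [CommRing R] [CommRing S] (φ : R →+* S)
    (F G : Matrix (Fin 4) (Fin 4) R) :
    φ (residualDiscriminant F G) = residualDiscriminant (F.map φ) (G.map φ) := by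
  simp only [residualDiscriminant, middleInvariant_map, map_add, map_sub, map_mul, map_pow,
    map_ofNat, RingHom.map_det, RingHom.mapMatrix_apply]

lemma det_gram_act (A : SL(4, ℂ)) (f : Quadric) : (gram (act A f)).det = (gram f).det := by
  rw [gram_act, det_congruence]

lemma middleInvariant_act (A : SL(4, ℂ)) (f g : Quadric) :
    middleInvariant (gram (act A f)) (gram (act A g)) = middleInvariant (gram f) (gram g) := by
  simp only [middleInvariant, ← map_add, ← map_sub, det_gram_act]

lemma residualDiscriminant_act (A : SL(4, ℂ)) (f g : Quadric) :
    residualDiscriminant (gram (act A f)) (gram (act A g)) =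
      residualDiscriminant (gram f) (gram g) := by
  simp only [residualDiscriminant, middleInvariant_act, ← map_add, ← map_sub, det_gram_act]

/-- The determinant quartic of the span of a single form is a fourth power, and its quadratic
invariant vanishes. -/
lemma isPencil_of_quarticInvariant_ne_zero {f g : Quadric}
    (h : quarticInvariant (gram f) (gram g) ≠ 0) : IsPencil f g := by
  rw [isPencil_iff]
  intro a b hab
  by_contra hne
  apply h
  obtain ⟨q, x, y, hF, hG⟩ : ∃ (q : Matrix (Fin 4) (Fin 4) ℂ) (x y : ℂ),
      gram f = x • q ∧ gram g = y • q := by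
    have h1 := congrArg gram hab
    rw [map_add, map_smul, map_smul, map_zero] at h1
    by_cases ha : a = 0
    · have hb : b ≠ 0 := fun hb => hne ⟨ha, hb⟩
      refine ⟨gram f, 1, 0, (one_smul _ _).symm, ?_⟩
      rw [ha, zero_smul, zero_add] at h1
      rw [zero_smul]
      exact (smul_eq_zero.1 h1).resolve_left hb
    · refine ⟨gram g, -b / a, 1, ?_, (one_smul _ _).symm⟩
      rw [neg_div, neg_smul, eq_neg_iff_add_eq_zero, ← smul_right_injective _ ha |>.eq_iff,
        smul_zero, smul_add, smul_smul, mul_div_cancel₀ _ ha, h1]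
  have hdet : IsBinaryQuartic (fun s t => (s • gram f + t • gram g).det) (x ^ 4 * q.det)
      (4 * x ^ 3 * y * q.det) (6 * x ^ 2 * y ^ 2 * q.det) (4 * x * y ^ 3 * q.det)
      (y ^ 4 * q.det) := by
    intro s t
    simp only [hF, hG]
    rw [smul_smul, smul_smul, ← add_smul, Matrix.det_smul, Fintype.card_fin]
    ring
  rw [quarticInvariant_eq hdet]
  ring

lemma isStrictlySemistable_of_quarticInvariant_ne_zero {f g : Quadric}
    (h : quarticInvariant (gram f) (gram g) ≠ 0) (hs : HasSingularBaseLocus f g) :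
    IsStrictlySemistable f g :=
  ⟨isSemistable_of_quarticInvariant_ne_zero h (isPencil_of_quarticInvariant_ne_zero h),
    not_isStable_of_singular hs⟩

/-! ### Smooth and irreducible quadrics -/

lemma isSmoothQuadric_of_det_ne_zero {f : Quadric} (h : (gram f).det ≠ 0) :
    IsSmoothQuadric f := by
  intro p hp _ h0
  rw [polarBilin_apply_eq_zero_iff] at h0
  exact h (Matrix.exists_mulVec_eq_zero_iff.1 ⟨p, hp, h0⟩)

/-- A product of two linear forms is singular along a line, which meets every plane. -/
lemma IsReducibleQuadric.exists_singular_point {f : Quadric} (h : IsReducibleQuadric f)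
    (n : Module.Dual ℂ Vec) : ∃ p, p ≠ 0 ∧ n p = 0 ∧ f p = 0 ∧ f.polarBilin p = 0 := by
  obtain ⟨l, m, hf⟩ := h
  obtain ⟨p, hp, h0⟩ : ∃ p, p ≠ 0 ∧ (LinearMap.pi ![n, l, m] : Vec →ₗ[ℂ] Fin 3 → ℂ) p = 0 := by
    have := LinearMap.ker_ne_bot_of_finrank_lt
      (f := (LinearMap.pi ![n, l, m] : Vec →ₗ[ℂ] Fin 3 → ℂ)) (by simp)
    obtain ⟨p, hp, hp0⟩ := Submodule.exists_mem_ne_zero_of_ne_bot this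
    exact ⟨p, hp0, hp⟩
  have hn : n p = 0 := congrFun h0 0
  have hl : l p = 0 := congrFun h0 1
  have hm : m p = 0 := congrFun h0 2
  refine ⟨p, hp, hn, by rw [hf, hl, zero_mul], LinearMap.ext fun w => ?_⟩
  simp [QuadraticMap.polar, hf, hl, hm]

lemma IsSmoothQuadric.not_isReducibleQuadric {f : Quadric} (h : IsSmoothQuadric f) :
    ¬ IsReducibleQuadric f := fun hr =>
  let ⟨p, hp, _, h0, h1⟩ := hr.exists_singular_point 0
  h p hp h0 h1

/-! ### Irreducibility of parametrised base loci -/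

/-- The Zariski closure of the image of a polynomial map from an affine space is irreducible. -/
lemma isPrime_vanishingIdeal_range (P : Fin 4 → MvPolynomial (Fin 2) ℂ) :
    (MvPolynomial.vanishingIdeal ℂ
      (Set.range fun (s : Fin 2 → ℂ) i => MvPolynomial.eval s (P i))).IsPrime := by
  have : MvPolynomial.vanishingIdeal ℂ
      (Set.range fun (s : Fin 2 → ℂ) i => MvPolynomial.eval s (P i)) =
      RingHom.ker (MvPolynomial.aeval P : MvPolynomial (Fin 4) ℂ →ₐ[ℂ] _) := by
    ext q
    rw [MvPolynomial.mem_vanishingIdeal_iff, RingHom.mem_ker]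
    have key (s : Fin 2 → ℂ) : MvPolynomial.aeval (fun i => MvPolynomial.eval s (P i)) q =
        MvPolynomial.eval s (MvPolynomial.aeval P q) := by
      have := MvPolynomial.comp_aeval_apply (f := P) (MvPolynomial.aeval (R := ℂ) s) q
      simpa [MvPolynomial.aeval_eq_eval] using this.symm
    constructor
    · intro h
      refine MvPolynomial.funext fun s => ?_
      rw [← key, h _ ⟨s, rfl⟩, map_zero]
    · rintro h _ ⟨s, rfl⟩
      rw [key, h, map_zero]
  rw [this]
  exact RingHom.ker_isPrime _

lemma baseLocus_eq_image {A : SL(4, ℂ)} {f g f' g' : Quadric}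
    (hs : Submodule.span ℂ {act A f, act A g} = Submodule.span ℂ {f', g'}) :
    baseLocus f g = (A : Matrix (Fin 4) (Fin 4) ℂ).mulVec '' baseLocus f' g' := by
  rw [← baseLocus_eq_of_span_eq hs]
  ext p
  constructor
  · intro hp
    obtain ⟨q, rfl⟩ := mulVec_surjective A p
    exact ⟨q, (mem_baseLocus_act A f g q).1 hp, rfl⟩
  · rintro ⟨q, hq, rfl⟩
    exact hq

lemma hasIrreducibleBaseLocus_of_parametrisation {A : SL(4, ℂ)} {f g f' g' : Quadric}
    (hs : Submodule.span ℂ {act A f, act A g} = Submodule.span ℂ {f', g'})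
    {P : Fin 4 → MvPolynomial (Fin 2) ℂ}
    (hP : baseLocus f' g' = Set.range fun (s : Fin 2 → ℂ) i => MvPolynomial.eval s (P i)) :
    HasIrreducibleBaseLocus f g := by
  rw [HasIrreducibleBaseLocus, baseLocus_eq_image hs, hP, ← Set.range_comp]
  have := isPrime_vanishingIdeal_range
    fun i => ∑ j, MvPolynomial.C ((A : Matrix (Fin 4) (Fin 4) ℂ) i j) * P j
  convert this using 3
  funext s
  ext i
  simp [Matrix.mulVec, dotProduct]

/-! ### Nodal pencils -/

lemma polarBilin_expand (f : Quadric) (v w : Vec) : f.polarBilin v w =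
    gram f 0 0 * (v 0 * w 0) + gram f 1 1 * (v 1 * w 1) + gram f 2 2 * (v 2 * w 2) +
    gram f 3 3 * (v 3 * w 3) + gram f 0 1 * (v 0 * w 1 + v 1 * w 0) +
    gram f 0 2 * (v 0 * w 2 + v 2 * w 0) + gram f 0 3 * (v 0 * w 3 + v 3 * w 0) +
    gram f 1 2 * (v 1 * w 2 + v 2 * w 1) + gram f 1 3 * (v 1 * w 3 + v 3 * w 1) +
    gram f 2 3 * (v 2 * w 3 + v 3 * w 2) := by
  rw [polarBilin_eq_sum]
  simp only [Fin.sum_univ_four, gram_comm f 1 0, gram_comm f 2 0, gram_comm f 3 0,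
    gram_comm f 2 1, gram_comm f 3 1, gram_comm f 3 2]
  ring

/-- The form `x₀ x₃ + (x₁² + x₂²) / 2`. -/
noncomputable def nodeF : Quadric :=
  quad ((1 / 2 : ℂ) • !![0, 0, 0, 1; 0, 1, 0, 0; 0, 0, 1, 0; 1, 0, 0, 0])

/-- The form `x₁ x₂ + x₃² / 2`. -/
noncomputable def nodeG : Quadric :=
  quad ((1 / 2 : ℂ) • !![0, 0, 0, 0; 0, 0, 1, 0; 0, 1, 0, 0; 0, 0, 0, 1])

lemma gram_nodeF : gram nodeF = !![0, 0, 0, 1; 0, 1, 0, 0; 0, 0, 1, 0; 1, 0, 0, 0] :=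
  gram_quad_half (by ext i j; fin_cases i <;> fin_cases j <;> rfl)

lemma gram_nodeG : gram nodeG = !![0, 0, 0, 0; 0, 0, 1, 0; 0, 1, 0, 0; 0, 0, 0, 1] :=
  gram_quad_half (by ext i j; fin_cases i <;> fin_cases j <;> rfl)

lemma nodeF_polar (v w : Vec) : nodeF.polarBilin v w =
    v 1 * w 1 + v 2 * w 2 + (v 0 * w 3 + v 3 * w 0) := by
  rw [polarBilin_expand, gram_nodeF]
  simp

lemma nodeG_polar (v w : Vec) : nodeG.polarBilin v w = v 3 * w 3 + (v 1 * w 2 + v 2 * w 1) := by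
  rw [polarBilin_expand, gram_nodeG]
  simp

lemma mem_baseLocus_iff_polar (f g : Quadric) (p : Vec) :
    p ∈ baseLocus f g ↔ f.polarBilin p p = 0 ∧ g.polarBilin p p = 0 := by
  rw [← apply_eq_zero_iff, ← apply_eq_zero_iff]; rfl

lemma singularExactlyA1At_node : SingularExactlyA1At nodeF nodeG {e 0} := by
  constructor
  · rintro _ rfl
    refine ⟨e_ne_zero 0, ?_, nodeG, nodeF, by rw [Set.pair_comm], ?_, ?_, ?_⟩
    · rw [mem_baseLocus_iff_polar, nodeF_polar, nodeG_polar]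
      simp [e]
    · refine LinearMap.ext fun w => ?_
      rw [nodeG_polar]
      simp [e]
    · intro h
      have := LinearMap.congr_fun h (e 3)
      rw [nodeF_polar] at this
      simp [e] at this
    · intro v hv hw
      simp only [nodeF_polar, nodeG_polar] at hv hw
      have h3 : v 3 = 0 := by simpa [e] using hv
      have h1 : v 1 = 0 := by simpa [e] using hw (e 2) (by simp [e])
      have h2 : v 2 = 0 := by simpa [e] using hw (e 1) (by simp [e])
      refine mem_span_of_eq (v 0) fun i => ?_
      fin_cases i <;> simp [e, h1, h2, h3]
  · intro p hp
    refine ⟨e 0, rfl, ?_⟩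
    obtain ⟨x, y, hxy, h⟩ := hp.exists_relation
    have hb := (mem_baseLocus_iff_polar _ _ _).1 hp.2.1
    simp only [nodeF_polar, nodeG_polar] at h hb
    have e0 : x * p 3 = 0 := by simpa [e] using h (e 0)
    have e1 : x * p 1 + y * p 2 = 0 := by simpa [e] using h (e 1)
    have e2 : x * p 2 + y * p 1 = 0 := by simpa [e] using h (e 2)
    have e3 : x * p 0 + y * p 3 = 0 := by simpa [e] using h (e 3)
    have h123 : p 1 = 0 ∧ p 2 = 0 ∧ p 3 = 0 := by
      by_cases hx : x = 0
      · have hy : y ≠ 0 := fun hy => hxy ⟨hx, hy⟩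
        simp only [hx, zero_mul, zero_add, mul_eq_zero, hy, false_or] at e1 e2 e3
        exact ⟨e2, e1, e3⟩
      · have h3 : p 3 = 0 := (mul_eq_zero.1 e0).resolve_left hx
        have h12 : p 1 * p 2 = 0 := by linear_combination hb.2 / 2 - p 3 / 2 * h3
        have h1122 : p 1 ^ 2 + p 2 ^ 2 = 0 := by linear_combination hb.1 - 2 * p 0 * h3
        rcases mul_eq_zero.1 h12 with h1 | h2
        · rw [h1] at h1122
          exact ⟨h1, by simpa using h1122, h3⟩
        · rw [h2] at h1122
          exact ⟨by simpa using h1122, h2, h3⟩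
    refine mem_span_of_eq (p 0) fun i => ?_
    fin_cases i <;> simp [e, h123.1, h123.2.1, h123.2.2]

open MvPolynomial in
/-- The nodal quartic is the image of the line under
`(s : t) ↦ (-(s⁴ + t⁴ / 4) / 2 : s³ t : -s t³ / 2 : s² t²)`. -/
lemma baseLocus_node : baseLocus nodeF nodeG = Set.range fun (s : Fin 2 → ℂ) i => eval s
    ((![C (-1 / 2) * X 0 ^ 4 + C (-1 / 8) * X 1 ^ 4, X 0 ^ 3 * X 1, C (-1 / 2) * X 0 * X 1 ^ 3,
      X 0 ^ 2 * X 1 ^ 2] : Fin 4 → MvPolynomial (Fin 2) ℂ) i) := by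
  ext p
  rw [mem_baseLocus_iff_polar, nodeF_polar, nodeG_polar, Set.mem_range]
  constructor
  · rintro ⟨hF, hG⟩
    -- the points with `p 3 = 0` are the multiples of the node, with parameters `(s : 0)`
    by_cases h3 : p 3 = 0
    · have h12 : p 1 * p 2 = 0 := by linear_combination hG / 2 - p 3 / 2 * h3
      have h1122 : p 1 ^ 2 + p 2 ^ 2 = 0 := by linear_combination hF - 2 * p 0 * h3
      have h1 : p 1 = 0 ∧ p 2 = 0 := by
        rcases mul_eq_zero.1 h12 with h1 | h2
        · rw [h1] at h1122
          exact ⟨h1, by simpa using h1122⟩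
        · rw [h2] at h1122
          exact ⟨by simpa using h1122, h2⟩
      obtain ⟨s, hs⟩ := IsAlgClosed.exists_pow_nat_eq (-2 * p 0) (n := 4) (by norm_num)
      refine ⟨![s, 0], ?_⟩
      ext i
      fin_cases i
      · simp [hs]; ring
      all_goals simp [h1.1, h1.2, h3]
    · obtain ⟨r, hr⟩ := IsAlgClosed.exists_pow_nat_eq (p 3) (n := 2) (by norm_num)
      have hr0 : r ≠ 0 := by rintro rfl; exact h3 (by rw [← hr]; simp)
      obtain ⟨s, hs⟩ := IsAlgClosed.exists_pow_nat_eq (p 1 / r) (n := 2) (by norm_num)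
      have h1 : p 1 ≠ 0 := by
        intro h1
        rw [h1] at hG
        exact h3 (by simpa using hG)
      have hs0 : s ≠ 0 := by
        rintro rfl
        exact div_ne_zero h1 hr0 (by rw [← hs]; simp)
      have e1 : p 1 = s ^ 2 * r := by rw [hs, div_mul_cancel₀ _ hr0]
      rw [← hr, e1] at hG hF
      have e2 : p 2 = - r ^ 3 / (2 * s ^ 2) := by
        rw [eq_div_iff (mul_ne_zero two_ne_zero (pow_ne_zero 2 hs0))]
        refine mul_left_cancel₀ hr0 ?_
        linear_combination hG
      rw [e2] at hF
      refine ⟨![s, r / s], ?_⟩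
      ext i
      fin_cases i
      · field_simp at hF
        have hF' := (mul_eq_zero.1 (hF.trans (mul_zero _))).resolve_left (pow_ne_zero 2 hr0)
        simp
        field_simp
        linear_combination -2 * hF'
      · simp [e1]; field_simp
      · simp [e2]; field_simp
      · simp [← hr]; field_simp
  · rintro ⟨s, rfl⟩
    simp
    constructor <;> ring

/-! ### Normal form of nodal pencils -/

lemma span_add_smul_eq (f g : Quadric) (c : ℂ) :
    Submodule.span ℂ {f + c • g, g} = Submodule.span ℂ {f, g} := by
  have := span_combination_eq f g (a := 1) (b := c) (c := 0) (d := 1) (by simp)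
  simpa using this

lemma span_act_add_smul_eq (A : SL(4, ℂ)) (f g : Quadric) (c : ℂ) :
    Submodule.span ℂ {act A (f + c • g), act A g} = Submodule.span ℂ {act A f, act A g} := by
  rw [map_add, map_smul, span_add_smul_eq]

/-- Successive coordinate changes fixing the point `(1 : 0 : 0 : 0)`. -/
lemma exists_node_of_act {f g f₁ g₁ : Quadric} {B : SL(4, ℂ)} {d : ℂ} (hd : d ≠ 0)
    (hB : (B : Matrix (Fin 4) (Fin 4) ℂ).mulVec (e 0) = d • e 0)
    (hs : Submodule.span ℂ {act B f, act B g} = Submodule.span ℂ {f₁, g₁})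
    (h : ∃ (A : SL(4, ℂ)) (c : ℂ), c ≠ 0 ∧ (A : Matrix (Fin 4) (Fin 4) ℂ).mulVec (e 0) = c • e 0 ∧
      Submodule.span ℂ {act A f₁, act A g₁} = Submodule.span ℂ {nodeF, nodeG}) :
    ∃ (A : SL(4, ℂ)) (c : ℂ), c ≠ 0 ∧ (A : Matrix (Fin 4) (Fin 4) ℂ).mulVec (e 0) = c • e 0 ∧
      Submodule.span ℂ {act A f, act A g} = Submodule.span ℂ {nodeF, nodeG} := by
  obtain ⟨A, c, hc, hA, hA'⟩ := h
  refine ⟨B * A, c * d, mul_ne_zero hc hd, ?_, ?_⟩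
  · rw [Matrix.SpecialLinearGroup.coe_mul, ← Matrix.mulVec_mulVec, hA, Matrix.mulVec_smul, hB,
      smul_smul]
  · rw [← act_act, ← act_act, ← map_act_span, hs, map_act_span, hA']

/-- Rescaling the coordinates and removing the remaining terms with `x₃` from `f`, which `x₀`
absorbs, leads to the standard pair. -/
lemma exists_node_of_gram {f g : Quadric}
    (f00 : gram f 0 0 = 0) (f01 : gram f 0 1 = 0) (f02 : gram f 0 2 = 0) (f03 : gram f 0 3 ≠ 0)
    (f11 : gram f 1 1 ≠ 0) (f22 : gram f 2 2 ≠ 0) (f12 : gram f 1 2 = 0)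
    (g0 : ∀ i, gram g 0 i = 0) (g11 : gram g 1 1 = 0) (g22 : gram g 2 2 = 0)
    (g12 : gram g 1 2 ≠ 0) (g13 : gram g 1 3 = 0) (g23 : gram g 2 3 = 0) (g33 : gram g 3 3 ≠ 0) :
    ∃ (A : SL(4, ℂ)) (c : ℂ), c ≠ 0 ∧ (A : Matrix (Fin 4) (Fin 4) ℂ).mulVec (e 0) = c • e 0 ∧
      Submodule.span ℂ {act A f, act A g} = Submodule.span ℂ {nodeF, nodeG} := by
  set α := gram f 0 3 with hα
  obtain ⟨r₁, h1⟩ := IsAlgClosed.exists_pow_nat_eq (gram f 1 1)⁻¹ (n := 2) (by norm_num)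
  obtain ⟨r₂, h2⟩ := IsAlgClosed.exists_pow_nat_eq (gram f 2 2)⁻¹ (n := 2) (by norm_num)
  have h1' : r₁ ≠ 0 := by rintro rfl; exact inv_ne_zero f11 (by rw [← h1]; simp)
  have h2' : r₂ ≠ 0 := by rintro rfl; exact inv_ne_zero f22 (by rw [← h2]; simp)
  set y := r₁ * r₂ * gram g 1 2 with hy
  have hy0 : y ≠ 0 := mul_ne_zero (mul_ne_zero h1' h2') g12
  obtain ⟨r₃, h3⟩ := IsAlgClosed.exists_pow_nat_eq (y / gram g 3 3) (n := 2) (by norm_num)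
  have h3' : r₃ ≠ 0 := by rintro rfl; exact div_ne_zero hy0 g33 (by rw [← h3]; simp)
  have k1 : gram f 1 1 * r₁ ^ 2 = 1 := by rw [h1, mul_inv_cancel₀ f11]
  have k2 : gram f 2 2 * r₂ ^ 2 = 1 := by rw [h2, mul_inv_cancel₀ f22]
  have k3 : gram g 3 3 * r₃ ^ 2 = y := by rw [h3, mul_div_cancel₀ _ g33]
  have hα' : gram f 0 3 * α⁻¹ = 1 := mul_inv_cancel₀ f03
  have hr3 : r₃ * r₃⁻¹ = 1 := mul_inv_cancel₀ h3'
  obtain ⟨A, d, hd, hA, -, -, hs⟩ := projEquiv_of_basis (f := f) (g := g) (f' := nodeF)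
    (g' := nodeG) (x := 1) (y := y)
    (b := ![![α⁻¹ * r₃⁻¹, 0, 0, 0], ![-r₁ * gram f 1 3 * α⁻¹, r₁, 0, 0],
      ![-r₂ * gram f 2 3 * α⁻¹, 0, r₂, 0], ![-r₃ * gram f 3 3 * α⁻¹ / 2, 0, 0, r₃]])
    (linearIndependent_of_det (by
      simp [Matrix.det_succ_row_zero, Fin.sum_univ_succ, Fin.succAbove, h1', h2', h3', f03]))
    one_ne_zero hy0
    (by
      intro i j
      rw [polarBilin_expand, gram_nodeF, f00, f01, f02, f12]
      fin_cases i <;> fin_cases j <;> simp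
      · linear_combination (r₃ * r₃⁻¹) * hα' + hr3
      · linear_combination k1
      · linear_combination (-r₁ * gram f 1 3 * r₃) * hα'
      · linear_combination k2
      · linear_combination (-r₂ * gram f 2 3 * r₃) * hα'
      · linear_combination (r₃ * r₃⁻¹) * hα' + hr3
      · linear_combination (-r₁ * gram f 1 3 * r₃) * hα'
      · linear_combination (-r₂ * gram f 2 3 * r₃) * hα'
      · linear_combination (-r₃ * gram f 3 3 * r₃) * hα')
    (by
      intro i j
      rw [polarBilin_expand, gram_nodeG, g0, g0, g0, g0, g11, g22, g13, g23]
      fin_cases i <;> fin_cases j <;> simp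
      · rw [hy]; ring
      · rw [hy]; ring
      · linear_combination k3)
  refine ⟨A, d * (α⁻¹ * r₃⁻¹), mul_ne_zero hd (mul_ne_zero (inv_ne_zero f03) (inv_ne_zero h3')), ?_, hs⟩
  rw [hA]
  ext i
  fin_cases i <;> simp [e]

/-- The resultant of two binary quadratic forms vanishes if they have a common zero. -/
lemma resultant_eq_zero {a b c a' b' c' s t : ℂ} (hst : ¬ (s = 0 ∧ t = 0))
    (h : a * s ^ 2 + 2 * b * s * t + c * t ^ 2 = 0)
    (h' : a' * s ^ 2 + 2 * b' * s * t + c' * t ^ 2 = 0) :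
    (a * c' + c * a' - 2 * b * b') ^ 2 - 4 * (a * c - b ^ 2) * (a' * c' - b' ^ 2) = 0 := by
  by_cases hs : s = 0
  · have ht : t ≠ 0 := fun ht => hst ⟨hs, ht⟩
    have hc : c = 0 := by simpa [hs, ht] using h
    have hc' : c' = 0 := by simpa [hs, ht] using h'
    rw [hc, hc']; ring
  · have h1 : (a * c' - c * a') * s + 2 * (b * c' - c * b') * t = 0 := by
      refine (mul_eq_zero.1 (?_ : s * _ = 0)).resolve_left hs
      linear_combination c' * h - c * h'
    have h2 : (2 * (a * b' - b * a') * s + (a * c' - c * a') * t) * t = 0 := by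
      linear_combination a * h' - a' * h
    rcases mul_eq_zero.1 h2 with h2 | ht
    · refine (mul_eq_zero.1 (?_ : s * _ = 0)).resolve_left hs
      linear_combination (a * c' - c * a') * h1 - 2 * (b * c' - c * b') * h2
    · have ha : a = 0 := by simpa [hs, ht] using h
      have ha' : a' = 0 := by simpa [hs, ht] using h'
      rw [ha, ha']; ring

/-- The binary forms `f, g` in `x₁, x₂` being in general position, the zeros of `g` provide
coordinates in which `g` is `x₁ x₂` and, modulo `g`, the form `f` is diagonal. -/
lemma exists_node_of_resultant {f g : Quadric}
    (f00 : gram f 0 0 = 0) (f01 : gram f 0 1 = 0) (f02 : gram f 0 2 = 0) (f03 : gram f 0 3 ≠ 0)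
    (g0 : ∀ i, gram g 0 i = 0) (hg : gram g 1 1 * gram g 2 2 - gram g 1 2 ^ 2 ≠ 0)
    (hres : (gram f 1 1 * gram g 2 2 + gram f 2 2 * gram g 1 1 - 2 * gram f 1 2 * gram g 1 2) ^ 2
      - 4 * (gram f 1 1 * gram f 2 2 - gram f 1 2 ^ 2) *
        (gram g 1 1 * gram g 2 2 - gram g 1 2 ^ 2) ≠ 0)
    (hker : ∀ v, g.polarBilin v = 0 → v ∈ Submodule.span ℂ {e 0}) :
    ∃ (A : SL(4, ℂ)) (c : ℂ), c ≠ 0 ∧ (A : Matrix (Fin 4) (Fin 4) ℂ).mulVec (e 0) = c • e 0 ∧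
      Submodule.span ℂ {act A f, act A g} = Submodule.span ℂ {nodeF, nodeG} := by
  obtain ⟨s, t, s', t', hdet, h1, h2, h3⟩ := exists_isotropic_pair hg
  set q := gram g 1 1 * s * s' + gram g 1 2 * (s * t' + t * s') + gram g 2 2 * t * t' with hq
  set r := gram f 1 1 * s * s' + gram f 1 2 * (s * t' + t * s') + gram f 2 2 * t * t' with hr
  -- the third vector is orthogonal to the two isotropic ones for `g`
  set m := -(gram g 1 3 * s' + gram g 2 3 * t') / q with hm
  set m' := -(gram g 1 3 * s + gram g 2 3 * t) / q with hm'
  have hmq : m * q = -(gram g 1 3 * s' + gram g 2 3 * t') := div_mul_cancel₀ _ h3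
  have hmq' : m' * q = -(gram g 1 3 * s + gram g 2 3 * t) := div_mul_cancel₀ _ h3
  have hst : ¬ (s = 0 ∧ t = 0) := by
    rintro ⟨rfl, rfl⟩
    exact hdet (by ring)
  have hst' : ¬ (s' = 0 ∧ t' = 0) := by
    rintro ⟨rfl, rfl⟩
    exact hdet (by ring)
  set b : Fin 4 → Vec := ![e 0, ![0, s, t, 0], ![0, s', t', 0],
    ![0, m * s + m' * s', m * t + m' * t', 1]] with hb
  obtain ⟨B, d, hd, hB⟩ := exists_SL_of_basis (b := b) (linearIndependent_of_det (by
    have : (Matrix.of b).det = s * t' - t * s' := by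
      simp [hb, e, Matrix.det_succ_row_zero, Fin.sum_univ_succ, Fin.succAbove]
      ring
    rwa [this]))
  have hd2 : d ^ 2 ≠ 0 := pow_ne_zero 2 hd
  have hgr := gram_act_of_basis hB
  -- `f + κ g` has no term with `x₁ x₂` in the new coordinates
  set κ := -r / q with hκ
  have hκq : κ * q = -r := div_mul_cancel₀ _ h3
  have hg00 := g0 0
  have hg01 := g0 1
  have hg02 := g0 2
  have hg03 := g0 3
  refine exists_node_of_act (f₁ := act B (f + κ • g)) (g₁ := act B g) hd (hB 0)
    (span_act_add_smul_eq B f g κ).symm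
    (exists_node_of_gram ?_ ?_ ?_ ?_ ?_ ?_ ?_ ?_ ?_ ?_ ?_ ?_ ?_ ?_)
  all_goals
    simp only [hgr, polarBilin_expand, map_add, map_smul, Matrix.add_apply, Matrix.smul_apply,
      smul_eq_mul, hg00, hg01, hg02, hg03, f00, f01, f02]
  · simp [hb, e]
  · simp [hb, e]
  · simp [hb, e]
  · simp [hb, e, hd, f03]
  · intro h
    simp [hb] at h
    refine hres (resultant_eq_zero hst (mul_left_cancel₀ hd2 ?_) h1)
    linear_combination h - κ * d ^ 2 * h1
  · intro h
    simp [hb] at h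
    refine hres (resultant_eq_zero hst' (mul_left_cancel₀ hd2 ?_) h2)
    linear_combination h - κ * d ^ 2 * h2
  · simp [hb]
    linear_combination d ^ 2 * (hκq - hr - κ * hq)
  · intro i
    simp [hb, e]
  · simp [hb]
    right
    linear_combination h1
  · simp [hb]
    right
    linear_combination h2
  · simp only [ne_eq, mul_eq_zero, hd2, false_or]
    intro h
    simp [hb] at h
    refine h3 ?_
    linear_combination h
  · simp [hb]
    right
    linear_combination hmq' + m * h1
  · simp [hb]
    right
    linear_combination hmq + m' * h2
  · simp only [ne_eq, mul_eq_zero, hd2, false_or]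
    intro h
    -- otherwise the third vector is in the kernel of `g`
    have hk (j : Fin 4) : gram (act B g) 3 j = 0 := by
      rw [hgr, polarBilin_expand, hg00, hg01, hg02, hg03]
      simp [hb] at h
      fin_cases j <;> simp [hb, e]
      · right
        linear_combination hmq' + m * h1
      · right
        linear_combination hmq + m' * h2
      · right
        linear_combination h
    have hk' : g.polarBilin (d • b 3) = 0 := by
      refine LinearMap.ext fun w => ?_
      obtain ⟨w, rfl⟩ := mulVec_surjective B w
      rw [← hB, ← act_polarBilin, polarBilin_comm, polarBilin_apply_e]
      simp [gram_comm _ _ 3, hk]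
    rw [map_smul] at hk'
    obtain ⟨c, hc⟩ := Submodule.mem_span_singleton.1 (hker _ ((smul_eq_zero.1 hk').resolve_left hd))
    have := congrFun hc 3
    simp [hb, e] at this

/-! ### The general members of Families 1 and 4 -/

lemma det_of_antidiagonal_corner {N : Matrix (Fin 4) (Fin 4) ℂ} (h00 : N 0 0 = 0) (h01 : N 0 1 = 0)
    (h02 : N 0 2 = 0) (h10 : N 1 0 = 0) (h20 : N 2 0 = 0) :
    N.det = -(N 0 3 * N 3 0) * (N 1 1 * N 2 2 - N 1 2 * N 2 1) := by
  simp [Matrix.det_succ_row_zero, Fin.sum_univ_succ, Fin.succAbove, h00, h01, h02, h10, h20]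
  ring

/-- Nonvanishing of this polynomial implies that a member of Family 1 defines a nodal curve. -/
def nodeDiscriminant {R : Type*} [CommRing R] (F G : Matrix (Fin 4) (Fin 4) R) : R :=
  F.det * (G.submatrix Fin.succ Fin.succ).det * middleInvariant F G * residualDiscriminant F G

lemma nodeDiscriminant_map {R S : Type*} [CommRing R] [CommRing S] (φ : R →+* S)
    (F G : Matrix (Fin 4) (Fin 4) R) :
    φ (nodeDiscriminant F G) = nodeDiscriminant (F.map φ) (G.map φ) := by
  simp only [nodeDiscriminant, middleInvariant_map, residualDiscriminant_map, map_mul,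
    RingHom.map_det, RingHom.mapMatrix_apply, Matrix.submatrix_map]

/-- If the tangent plane of `f` at the singular point is `x₃ = 0`, the invariants of the determinant
quartic are, up to powers of the coefficient of `x₀ x₃`, those of the binary forms in `x₁, x₂`. -/
lemma exists_node_of_special {f g : Quadric}
    (f00 : gram f 0 0 = 0) (f01 : gram f 0 1 = 0) (f02 : gram f 0 2 = 0)
    (g0 : ∀ i, gram g 0 i = 0) (hdet : (gram f).det ≠ 0)
    (hmid : middleInvariant (gram f) (gram g) ≠ 0)
    (hdisc : residualDiscriminant (gram f) (gram g) ≠ 0)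
    (hker : ∀ v, g.polarBilin v = 0 → v ∈ Submodule.span ℂ {e 0}) :
    ∃ (A : SL(4, ℂ)) (c : ℂ), c ≠ 0 ∧ (A : Matrix (Fin 4) (Fin 4) ℂ).mulVec (e 0) = c • e 0 ∧
      Submodule.span ℂ {act A f, act A g} = Submodule.span ℂ {nodeF, nodeG} := by
  have hg00 := g0 0
  have hg01 := g0 1
  have hg02 := g0 2
  have hg03 := g0 3
  have hcomm (f : Quadric) : gram f 1 0 = gram f 0 1 ∧ gram f 2 0 = gram f 0 2 ∧
      gram f 3 0 = gram f 0 3 ∧ gram f 2 1 = gram f 1 2 :=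
    ⟨gram_comm f _ _, gram_comm f _ _, gram_comm f _ _, gram_comm f _ _⟩
  have hF : (gram f).det = -(gram f 0 3) ^ 2 * (gram f 1 1 * gram f 2 2 - gram f 1 2 ^ 2) := by
    rw [det_of_antidiagonal_corner] <;> simp only [hcomm, f00, f01, f02]
    ring
  have hG : (gram g).det = 0 := by
    rw [det_of_antidiagonal_corner] <;> simp only [hcomm, hg00, hg01, hg02, hg03]
    ring
  have hadd : (gram f + gram g).det = -(gram f 0 3) ^ 2 * ((gram f 1 1 + gram g 1 1) *
      (gram f 2 2 + gram g 2 2) - (gram f 1 2 + gram g 1 2) ^ 2) := by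
    rw [det_of_antidiagonal_corner] <;>
      simp only [Matrix.add_apply, hcomm, f00, f01, f02, hg00, hg01, hg02, hg03, add_zero]
    ring
  have hsub : (gram f - gram g).det = -(gram f 0 3) ^ 2 * ((gram f 1 1 - gram g 1 1) *
      (gram f 2 2 - gram g 2 2) - (gram f 1 2 - gram g 1 2) ^ 2) := by
    rw [det_of_antidiagonal_corner] <;>
      simp only [Matrix.sub_apply, hcomm, f00, f01, f02, hg00, hg01, hg02, hg03, sub_zero]
    ring
  have hmid' : middleInvariant (gram f) (gram g) =
      -2 * gram f 0 3 ^ 2 * (gram g 1 1 * gram g 2 2 - gram g 1 2 ^ 2) := by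
    rw [middleInvariant, hF, hG, hadd, hsub]; ring
  refine exists_node_of_resultant f00 f01 f02 ?_ g0 ?_ ?_ hker
  · intro h
    rw [hF, h] at hdet
    simp at hdet
  · intro h
    rw [hmid', h] at hmid
    simp at hmid
  · intro h
    apply hdisc
    rw [residualDiscriminant, hmid', hF, hadd, hsub]
    linear_combination 4 * gram f 0 3 ^ 4 * h

/-- Normal form of the pairs whose second form is a cone with vertex `(1 : 0 : 0 : 0)`: a coordinate
change fixing this point carries the pencil to the standard one. -/
lemma exists_node {f g : Quadric} (f00 : gram f 0 0 = 0) (g0 : ∀ i, gram g 0 i = 0)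
    (hdet : (gram f).det ≠ 0) (hmid : middleInvariant (gram f) (gram g) ≠ 0)
    (hdisc : residualDiscriminant (gram f) (gram g) ≠ 0)
    (hker : ∀ v, g.polarBilin v = 0 → v ∈ Submodule.span ℂ {e 0}) :
    ∃ (A : SL(4, ℂ)) (c : ℂ), c ≠ 0 ∧ (A : Matrix (Fin 4) (Fin 4) ℂ).mulVec (e 0) = c • e 0 ∧
      Submodule.span ℂ {act A f, act A g} = Submodule.span ℂ {nodeF, nodeG} := by
  have hl : f.polarBilin (e 0) ≠ 0 :=
    isSmoothQuadric_of_det_ne_zero hdet _ (e_ne_zero 0) (by rw [apply_e, f00, zero_div])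
  obtain ⟨b, hb, hb0, hb1, hb2⟩ := exists_adapted_basis (e_ne_zero 0) hl
  obtain ⟨B, d, hd, hB⟩ := exists_SL_of_basis hb
  have hgr := gram_act_of_basis hB
  have hB0 := hB 0
  rw [hb0] at hB0
  refine exists_node_of_act hd hB0 rfl (exists_node_of_special ?_ ?_ ?_ (fun i => ?_) ?_ ?_ ?_ ?_)
  · rw [hgr, hb0, ← gram_apply, f00, mul_zero]
  · rw [hgr, hb0, hb1, mul_zero]
  · rw [hgr, hb0, hb2, mul_zero]
  · have : g.polarBilin (e 0) = 0 := dual_ext g0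
    rw [hgr, hb0, this]
    simp
  · rwa [det_gram_act]
  · rwa [middleInvariant_act]
  · rwa [residualDiscriminant_act]
  · intro v hv
    have h1 : g.polarBilin ((B : Matrix (Fin 4) (Fin 4) ℂ).mulVec v) = 0 := by
      refine LinearMap.ext fun w => ?_
      obtain ⟨w, rfl⟩ := mulVec_surjective B w
      rw [← act_polarBilin, hv]
      rfl
    obtain ⟨c, hc⟩ := Submodule.mem_span_singleton.1 (hker _ h1)
    refine Submodule.mem_span_singleton.2 ⟨c / d, mulVec_injective B ?_⟩
    rw [Matrix.mulVec_smul, hB0, smul_smul, div_mul_cancel₀ _ hd, hc]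

lemma e_zero_eq : (![1, 0, 0, 0] : Vec) = e 0 := by
  ext i; fin_cases i <;> simp [e]

lemma mem_span_of_polarBilin_eq_zero {g : Quadric} (g0 : ∀ i, gram g 0 i = 0)
    (hdet : ((gram g).submatrix Fin.succ Fin.succ).det ≠ 0) {v : Vec} (hv : g.polarBilin v = 0) :
    v ∈ Submodule.span ℂ {e 0} := by
  rw [polarBilin_apply_eq_zero_iff] at hv
  have h0 : (fun i : Fin 3 => v i.succ) = 0 := by
    by_contra hne
    refine hdet (Matrix.exists_mulVec_eq_zero_iff.1 ⟨_, hne, ?_⟩)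
    ext i
    have := congrFun hv i.succ
    rw [Matrix.mulVec, dotProduct, Fin.sum_univ_succ, gram_comm, g0, zero_mul, zero_add] at this
    exact this
  refine mem_span_of_eq (v 0) fun i => ?_
  refine Fin.cases ?_ (fun i => ?_) i
  · simp [e]
  · have := congrFun h0 i
    simp only [Pi.zero_apply] at this
    simp [e, this]

lemma isNodalCurveAt_of_nodeDiscriminant_ne_zero {f g : Quadric} (f00 : gram f 0 0 = 0)
    (g0 : ∀ i, gram g 0 i = 0) (hD : nodeDiscriminant (gram f) (gram g) ≠ 0) :
    IsNodalCurveAt f g ![1, 0, 0, 0] := by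
  simp only [nodeDiscriminant, ne_eq, mul_eq_zero, not_or] at hD
  obtain ⟨⟨⟨h1, h2⟩, h3⟩, h4⟩ := hD
  obtain ⟨A, c, hc, hA, hs⟩ := exists_node f00 g0 h1 h3 h4
    fun v hv => mem_span_of_polarBilin_eq_zero g0 h2 hv
  refine ⟨hasIrreducibleBaseLocus_of_parametrisation hs baseLocus_node, ?_⟩
  rw [e_zero_eq]
  refine singularExactlyA1At_node.of_projEquiv hs ?_ ?_
  · rintro _ rfl
    exact ⟨e 0, rfl, c⁻¹, inv_ne_zero hc, by rw [hA, smul_smul, inv_mul_cancel₀ hc, one_smul]⟩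
  · rintro _ rfl
    exact ⟨e 0, rfl, c, hA⟩

lemma IsNodalCurveAt.of_span_eq {f g f' g' : Quadric} {u : Vec}
    (h : IsNodalCurveAt f g u) (hs : Submodule.span ℂ {f, g} = Submodule.span ℂ {f', g'}) :
    IsNodalCurveAt f' g' u := by
  refine ⟨?_, h.2.of_span_eq hs⟩
  rw [HasIrreducibleBaseLocus, ← baseLocus_eq_of_span_eq hs]
  exact h.1

lemma det_nodeF_add_nodeG (x y : ℂ) :
    (x • gram nodeF + y • gram nodeG).det = x ^ 2 * (y ^ 2 - x ^ 2) := by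
  rw [det_of_antidiagonal_corner] <;> simp [gram_nodeF, gram_nodeG]
  ring

lemma nodeDiscriminant_node : nodeDiscriminant (gram nodeF) (gram nodeG) = 32 := by
  have h1 : (gram nodeF).det = -1 := by simpa using det_nodeF_add_nodeG 1 0
  have h2 : (gram nodeG).det = 0 := by simpa using det_nodeF_add_nodeG 0 1
  have h3 : (gram nodeF + gram nodeG).det = 0 := by simpa using det_nodeF_add_nodeG 1 1
  have h4 : (gram nodeF - gram nodeG).det = 0 := by
    simpa [sub_eq_add_neg] using det_nodeF_add_nodeG 1 (-1)
  have h5 : ((gram nodeG).submatrix Fin.succ Fin.succ).det = -1 := by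
    simp [gram_nodeG, Matrix.det_fin_three]
  rw [nodeDiscriminant, residualDiscriminant, middleInvariant, h1, h2, h3, h4, h5]
  norm_num

lemma HoldsForGeneralMember.of_eval {F P : Quadric → Quadric → Prop} {δ : Quadric → Quadric → ℂ}
    (D : MvPolynomial (Fin 2 × Fin 4 × Fin 4) ℂ)
    (heval : ∀ f g, MvPolynomial.eval (coeffs f g) D = δ f g) {f₀ g₀ : Quadric} (h₀ : F f₀ g₀)
    (hδ : δ f₀ g₀ ≠ 0) (h : ∀ f g, F f g → δ f g ≠ 0 → P f g) : HoldsForGeneralMember F P :=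
  ⟨D, ⟨f₀, g₀, h₀, by rwa [heval]⟩, fun f g hF hD => h f g hF (by rwa [← heval])⟩

lemma holdsForGeneralMember_family1 : HoldsForGeneralMember Family1 (fun f g =>
    IsStrictlySemistable f g ∧
    (IsSmoothQuadric f ∧ ¬ IsReducibleQuadric f) ∧
    (¬ IsSmoothQuadric g ∧ ¬ IsReducibleQuadric g) ∧
    IsNodalCurveAt f g ![1, 0, 0, 0]) := by
  have heval (f g : Quadric) : MvPolynomial.eval (coeffs f g)
      (nodeDiscriminant (genericMatrix 0) (genericMatrix 1) *
        quarticInvariant (genericMatrix 0) (genericMatrix 1)) =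
      nodeDiscriminant (gram f) (gram g) * quarticInvariant (gram f) (gram g) := by
    rw [map_mul, nodeDiscriminant_map, quarticInvariant_map, genericMatrix_zero_map,
      genericMatrix_one_map]
  refine .of_eval _ heval (f₀ := nodeF) (g₀ := nodeG) ?_ (mul_ne_zero ?_ ?_)
    fun f g hfam hD => ?_
  rotate_left 3
  · rw [mul_ne_zero_iff] at hD
    obtain ⟨f00, g0⟩ := (family1_iff f g).1 hfam
    have hD1 := hD.1
    simp only [nodeDiscriminant, ne_eq, mul_eq_zero, not_or] at hD1
    have hsm := isSmoothQuadric_of_det_ne_zero hD1.1.1.1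
    refine ⟨isStrictlySemistable_of_quarticInvariant_ne_zero hD.2
      (hasSingularBaseLocus_of_family1 hfam), ⟨hsm, hsm.not_isReducibleQuadric⟩, ⟨fun h => ?_,
      fun h => ?_⟩, isNodalCurveAt_of_nodeDiscriminant_ne_zero f00 g0 hD.1⟩
    · exact h (e 0) (e_ne_zero 0) (by rw [apply_e, g0, zero_div]) (dual_ext g0)
    · obtain ⟨p, hp, hp0, -, hp1⟩ := h.exists_singular_point (LinearMap.proj 0)
      obtain ⟨c, rfl⟩ := Submodule.mem_span_singleton.1
        (mem_span_of_polarBilin_eq_zero g0 hD1.1.1.2 hp1)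
      have : c = 0 := by simpa [e] using hp0
      exact hp (by rw [this, zero_smul])
  · rw [family1_iff]
    refine ⟨by simp [gram_nodeF], fun i => ?_⟩
    fin_cases i <;> simp [gram_nodeG]
  · rw [nodeDiscriminant_node]
    norm_num
  · rw [quarticInvariant_eq (a := -1) (b := 0) (c := 1) (d := 0) (e := 0)]
    · norm_num
    · intro x y
      beta_reduce
      rw [det_nodeF_add_nodeG]
      ring

/-- The member `β f - α g` of the pencil, where `α, β` are the coefficients of `x₀ x₃` in `f, g`,
is a cone with vertex `(1 : 0 : 0 : 0)`, so that the results on Family 1 apply. -/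
lemma holdsForGeneralMember_family4 : HoldsForGeneralMember Family4 (fun f g =>
    IsStrictlySemistable f g ∧
    (IsSmoothQuadric f ∧ ¬ IsReducibleQuadric f) ∧
    (IsSmoothQuadric g ∧ ¬ IsReducibleQuadric g) ∧
    IsNodalCurveAt f g ![1, 0, 0, 0]) := by
  have heval (f g : Quadric) : MvPolynomial.eval (coeffs f g)
      (nodeDiscriminant (genericMatrix 0) (genericMatrix 1 0 3 • genericMatrix 0 -
          genericMatrix 0 0 3 • genericMatrix 1) * (genericMatrix 1).det *
        quarticInvariant (genericMatrix 0) (genericMatrix 1)) =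
      nodeDiscriminant (gram f) (gram (gram g 0 3 • f - gram f 0 3 • g)) * (gram g).det *
        quarticInvariant (gram f) (gram g) := by
    rw [map_mul, map_mul, nodeDiscriminant_map, quarticInvariant_map, RingHom.map_det,
      RingHom.mapMatrix_apply, genericMatrix_zero_map, genericMatrix_one_map]
    congr 3
    rw [map_sub, map_smul, map_smul, ← genericMatrix_zero_map f g, ← genericMatrix_one_map f g]
    ext i j
    simp
  refine .of_eval _ heval (f₀ := nodeF) (g₀ := (2 : ℂ) • nodeF - nodeG) ?_
    (mul_ne_zero (mul_ne_zero ?_ ?_) ?_) fun f g hfam hD => ?_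
  rotate_left 4
  · rw [mul_ne_zero_iff, mul_ne_zero_iff] at hD
    obtain ⟨⟨f0, f1, f2⟩, ⟨g0, g1, g2⟩⟩ := (family4_iff f g).1 hfam
    have hD1 := hD.1.1
    simp only [nodeDiscriminant, ne_eq, mul_eq_zero, not_or] at hD1
    have hsf := isSmoothQuadric_of_det_ne_zero hD1.1.1.1
    have hsg := isSmoothQuadric_of_det_ne_zero hD.1.2
    refine ⟨isStrictlySemistable_of_quarticInvariant_ne_zero hD.2
      (hasSingularBaseLocus_of_family4 hfam), ⟨hsf, hsf.not_isReducibleQuadric⟩,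
      ⟨hsg, hsg.not_isReducibleQuadric⟩,
      (isNodalCurveAt_of_nodeDiscriminant_ne_zero f0 (fun i => ?_) hD.1.1).of_span_eq ?_⟩
    · rw [map_sub, map_smul, map_smul, Matrix.sub_apply, Matrix.smul_apply, Matrix.smul_apply,
        smul_eq_mul, smul_eq_mul]
      fin_cases i
      · simp [f0, g0]
      · simp [f1, g1]
      · simp [f2, g2]
      · simp [mul_comm]
    · have hα : gram f 0 3 ≠ 0 := by
        intro h
        refine hD1.1.1.1 (Matrix.det_eq_zero_of_row_eq_zero 0 fun i => ?_)
        fin_cases i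
        exacts [f0, f1, f2, h]
      have := span_combination_eq f g (a := 1) (b := 0) (c := gram g 0 3) (d := -gram f 0 3)
        (by simpa using hα)
      have hneg : gram g 0 3 • f - gram f 0 3 • g = gram g 0 3 • f + (-gram f 0 3) • g := by
        module
      rw [hneg]
      simpa only [one_smul, zero_smul, add_zero] using this
  · rw [family4_iff]
    simp [gram_nodeF, gram_nodeG]
  · have : gram ((2 : ℂ) • nodeF - nodeG) 0 3 • nodeF -
        gram nodeF 0 3 • ((2 : ℂ) • nodeF - nodeG) = nodeG := by
      simp [gram_nodeF, gram_nodeG]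
    rw [this, nodeDiscriminant_node]
    norm_num
  · rw [map_sub, map_smul, sub_eq_add_neg, ← neg_one_smul ℂ (gram nodeG), det_nodeF_add_nodeG]
    norm_num
  · rw [quarticInvariant_eq (a := -1) (b := -8) (c := -23) (d := -28) (e := -12)]
    · norm_num
    · intro x y
      have : x • gram nodeF + y • gram ((2 : ℂ) • nodeF - nodeG) =
          (x + 2 * y) • gram nodeF + (-y) • gram nodeG := by
        rw [map_sub, map_smul]
        module
      beta_reduce
      rw [this, det_nodeF_add_nodeG]
      ring

/-! ### The general member of Family 2 -/

/-- Normal form of the members of Family 2: `f` is a multiple of `x₀² + x₁²` plus a form in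
`x₂, x₃`. -/
structure IsFamily2NormalForm (f g : Quadric) (c : ℂ) : Prop where
  ne_zero : c ≠ 0
  f00 : gram f 0 0 = c
  f11 : gram f 1 1 = c
  f01 : gram f 0 1 = 0
  f02 : gram f 0 2 = 0
  f03 : gram f 0 3 = 0
  f12 : gram f 1 2 = 0
  f13 : gram f 1 3 = 0
  g0 : ∀ i, gram g 0 i = 0
  g1 : ∀ i, gram g 1 i = 0

namespace IsFamily2NormalForm

variable {f g : Quadric} {c : ℂ}

lemma f_polar (h : IsFamily2NormalForm f g c) (v w : Vec) : f.polarBilin v w =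
    c * (v 0 * w 0 + v 1 * w 1) + gram f 2 2 * (v 2 * w 2) + gram f 3 3 * (v 3 * w 3)
      + gram f 2 3 * (v 2 * w 3 + v 3 * w 2) := by
  rw [polarBilin_expand, h.f00, h.f11, h.f01, h.f02, h.f03, h.f12, h.f13]
  ring

lemma g_polar (h : IsFamily2NormalForm f g c) (v w : Vec) : g.polarBilin v w =
    gram g 2 2 * (v 2 * w 2) + gram g 3 3 * (v 3 * w 3) +
      gram g 2 3 * (v 2 * w 3 + v 3 * w 2) := by
  rw [polarBilin_expand, h.g0, h.g0, h.g0, h.g0, h.g1, h.g1, h.g1]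
  ring

/-- The conic cut out on the plane `t x₂ = s x₃` is `c (x₀² + x₁²) / 2` plus a multiple of the
square of a coordinate, nonzero since `f` does not vanish at `(0, 0, s, t)`. -/
lemma cutsSmoothConic (h : IsFamily2NormalForm f g c) {s t k : ℂ} (hst : ¬ (s = 0 ∧ t = 0))
    (hf : gram f 2 2 * s ^ 2 + 2 * gram f 2 3 * s * t + gram f 3 3 * t ^ 2 ≠ 0) (hk : k ≠ 0)
    {l : Module.Dual ℂ Vec} (hl : ∀ x, l x = k * (t * x 2 - s * x 3)) : CutsSmoothConic f l := by
  intro v hv hw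
  simp only [hl, mul_eq_zero, hk, false_or, h.f_polar] at hv hw
  have h0 : v 0 = 0 := by simpa [e, h.ne_zero] using hw (e 0) (by simp [e])
  have h1 : v 1 = 0 := by simpa [e, h.ne_zero] using hw (e 1) (by simp [e])
  have h2 := hw ![0, 0, s, t] (by simp [mul_comm])
  obtain ⟨r, hr2, hr3⟩ : ∃ r, v 2 = r * s ∧ v 3 = r * t := by
    by_cases hs : s = 0
    · have ht : t ≠ 0 := fun ht => hst ⟨hs, ht⟩
      refine ⟨v 3 / t, ?_, by field_simp⟩
      rw [hs] at hv ⊢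
      simpa [ht] using hv
    · refine ⟨v 2 / s, by field_simp, ?_⟩
      field_simp
      linear_combination -hv
  have h3 : r * (gram f 2 2 * s ^ 2 + 2 * gram f 2 3 * s * t + gram f 3 3 * t ^ 2) = 0 := by
    simp [h0, h1, hr2, hr3] at h2
    linear_combination h2
  have hr : r = 0 := (mul_eq_zero.1 h3).resolve_right hf
  ext i
  fin_cases i <;> simp [h0, h1, hr2, hr3, hr]

lemma isPairOfConics (h : IsFamily2NormalForm f g c)
    (hg : gram g 2 2 * gram g 3 3 - gram g 2 3 ^ 2 ≠ 0)
    (hres : (gram f 2 2 * gram g 3 3 + gram f 3 3 * gram g 2 2 - 2 * gram f 2 3 * gram g 2 3) ^ 2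
      - 4 * (gram f 2 2 * gram f 3 3 - gram f 2 3 ^ 2) *
        (gram g 2 2 * gram g 3 3 - gram g 2 3 ^ 2) ≠ 0) : IsPairOfConics f g := by
  obtain ⟨s, t, s', t', hdet, h1, h2, h3⟩ := exists_isotropic_pair hg
  set q := gram g 2 2 * s * s' + gram g 2 3 * (s * t' + t * s') + gram g 3 3 * t * t' with hq
  -- `g` is the product of the forms `t x₂ - s x₃` and `k (t' x₂ - s' x₃)` vanishing at its zeros
  set k := -q / (s * t' - t * s') ^ 2 with hk
  have hk0 : k ≠ 0 := div_ne_zero (neg_ne_zero.2 h3) (pow_ne_zero 2 hdet)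
  have hkq : k * (s * t' - t * s') ^ 2 = -q := div_mul_cancel₀ _ (pow_ne_zero 2 hdet)
  have hst : ¬ (s = 0 ∧ t = 0) := by
    rintro ⟨rfl, rfl⟩
    exact hdet (by ring)
  have hst' : ¬ (s' = 0 ∧ t' = 0) := by
    rintro ⟨rfl, rfl⟩
    exact hdet (by ring)
  let l (k s t : ℂ) : Module.Dual ℂ Vec := k • (t • LinearMap.proj 2 - s • LinearMap.proj 3)
  have hl (k s t : ℂ) (x : Vec) : l k s t x = k * (t * x 2 - s * x 3) := by simp [l]
  refine ⟨l 1 s t, l k s' t', ?_, fun x => ?_, h.cutsSmoothConic hst ?_ one_ne_zero (hl _ _ _),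
    h.cutsSmoothConic hst' ?_ hk0 (hl _ _ _)⟩
  · rw [LinearIndependent.pair_iff]
    intro x y hxy
    have e1 := LinearMap.congr_fun hxy ![0, 0, s', t']
    have e2 := LinearMap.congr_fun hxy ![0, 0, s, t]
    simp only [LinearMap.add_apply, LinearMap.smul_apply, hl, smul_eq_mul,
      LinearMap.zero_apply] at e1 e2
    simp at e1 e2
    constructor
    · refine (mul_eq_zero.1 (?_ : x * (s * t' - t * s') = 0)).resolve_right hdet
      linear_combination -e1
    · refine (mul_eq_zero.1 (?_ : y * (k * (s * t' - t * s')) = 0)).resolve_right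
        (mul_ne_zero hk0 hdet)
      linear_combination e2
  · refine mul_left_cancel₀ (pow_ne_zero 2 hdet) ?_
    have hgx : g x = (gram g 2 2 * x 2 ^ 2 + 2 * gram g 2 3 * x 2 * x 3 + gram g 3 3 * x 3 ^ 2) / 2 := by
      have := polarBilin_self g x
      rw [h.g_polar] at this
      linear_combination -this / 2
    rw [hl, hl, hgx]
    linear_combination (x 2 * t' - x 3 * s') ^ 2 / 2 * h1 + (x 3 * s - x 2 * t) ^ 2 / 2 * h2 -
      (t * x 2 - s * x 3) * (t' * x 2 - s' * x 3) * hkq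
  · exact fun hf => hres (resultant_eq_zero hst hf h1)
  · exact fun hf => hres (resultant_eq_zero hst' hf h2)

lemma isA1Point (h : IsFamily2NormalForm f g c)
    (hg : gram g 2 2 * gram g 3 3 - gram g 2 3 ^ 2 ≠ 0) {i : ℂ} (hi : i ^ 2 = -1) :
    IsA1Point f g ![1, i, 0, 0] := by
  refine ⟨fun h0 => one_ne_zero (congrFun h0 0), ?_, g, f, by rw [Set.pair_comm], ?_, ?_, ?_⟩
  · rw [mem_baseLocus_iff_polar, h.f_polar, h.g_polar]
    simp [← sq, hi]
  · refine LinearMap.ext fun w => ?_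
    rw [h.g_polar]
    simp
  · intro h0
    have := LinearMap.congr_fun h0 (e 0)
    rw [h.f_polar] at this
    simp [e, h.ne_zero] at this
  · intro v hv hw
    simp only [h.f_polar, h.g_polar] at hv hw
    have h2 := hw (e 2) (by simp [e])
    have h3 := hw (e 3) (by simp [e])
    simp [e] at h2 h3
    simp [h.ne_zero] at hv
    have hv2 : v 2 = 0 := by
      refine (mul_eq_zero.1 (?_ : v 2 * _ = 0)).resolve_right hg
      linear_combination gram g 3 3 * h2 - gram g 2 3 * h3
    have hv3 : v 3 = 0 := by
      refine (mul_eq_zero.1 (?_ : v 3 * _ = 0)).resolve_right hg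
      linear_combination gram g 2 2 * h3 - gram g 2 3 * h2
    refine mem_span_of_eq (v 0) fun j => ?_
    fin_cases j
    · simp
    · simp
      linear_combination -i * hv + v 1 * hi
    · simpa using hv2
    · simpa using hv3

lemma singularExactlyA1At (h : IsFamily2NormalForm f g c)
    (hg : gram g 2 2 * gram g 3 3 - gram g 2 3 ^ 2 ≠ 0)
    (hres : (gram f 2 2 * gram g 3 3 + gram f 3 3 * gram g 2 2 - 2 * gram f 2 3 * gram g 2 3) ^ 2
      - 4 * (gram f 2 2 * gram f 3 3 - gram f 2 3 ^ 2) *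
        (gram g 2 2 * gram g 3 3 - gram g 2 3 ^ 2) ≠ 0) :
    SingularExactlyA1At f g {![1, Complex.I, 0, 0], ![1, -Complex.I, 0, 0]} := by
  constructor
  · rintro _ (rfl | rfl)
    · exact h.isA1Point hg (by simp)
    · exact h.isA1Point hg (by simp)
  · intro p hp
    obtain ⟨x, y, hxy, hrel⟩ := hp.exists_relation
    have hb := (mem_baseLocus_iff_polar _ _ _).1 hp.2.1
    simp only [h.f_polar, h.g_polar] at hrel hb
    have e0 : x * (c * p 0) = 0 := by simpa [e] using hrel (e 0)
    have e1 : x * (c * p 1) = 0 := by simpa [e] using hrel (e 1)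
    have e2 := hrel (e 2)
    have e3 := hrel (e 3)
    simp [e] at e2 e3
    have hx : x = 0 := by
      by_contra hx
      have h0 : p 0 = 0 := by simpa [hx, h.ne_zero] using e0
      have h1 : p 1 = 0 := by simpa [hx, h.ne_zero] using e1
      have h23 : ¬ (p 2 = 0 ∧ p 3 = 0) := by
        rintro ⟨h2, h3⟩
        refine hp.1 (funext fun i => ?_)
        fin_cases i <;> assumption
      rw [h0, h1] at hb
      exact hres (resultant_eq_zero h23 (by linear_combination hb.1) (by linear_combination hb.2))
    have hy : y ≠ 0 := fun hy => hxy ⟨hx, hy⟩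
    simp only [hx, zero_mul, zero_add, mul_eq_zero, hy, false_or] at e2 e3
    have hp2 : p 2 = 0 := by
      refine (mul_eq_zero.1 (?_ : p 2 * _ = 0)).resolve_right hg
      linear_combination gram g 3 3 * e2 - gram g 2 3 * e3
    have hp3 : p 3 = 0 := by
      refine (mul_eq_zero.1 (?_ : p 3 * _ = 0)).resolve_right hg
      linear_combination gram g 2 2 * e3 - gram g 2 3 * e2
    have hsq : c * ((p 1 - Complex.I * p 0) * (p 1 + Complex.I * p 0)) = 0 := by
      have := hb.1
      rw [hp2, hp3] at this
      linear_combination this - c * p 0 ^ 2 * Complex.I_sq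
    rcases mul_eq_zero.1 ((mul_eq_zero.1 hsq).resolve_left h.ne_zero) with h1 | h1
    · refine ⟨_, Or.inl rfl, mem_span_of_eq (p 0) fun j => ?_⟩
      fin_cases j
      · simp
      · simp
        linear_combination h1
      · simpa using hp2
      · simpa using hp3
    · refine ⟨_, Or.inr rfl, mem_span_of_eq (p 0) fun j => ?_⟩
      fin_cases j
      · simp
      · simp
        linear_combination h1
      · simpa using hp2
      · simpa using hp3

lemma det_of_orthogonal_blocks {N : Matrix (Fin 4) (Fin 4) ℂ} (h01 : N 0 1 = 0)
    (h02 : N 0 2 = 0) (h03 : N 0 3 = 0) (h12 : N 1 2 = 0) (h13 : N 1 3 = 0) :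
    N.det = N 0 0 * N 1 1 * (N 2 2 * N 3 3 - N 2 3 * N 3 2) := by
  simp [Matrix.det_succ_row_zero, Fin.sum_univ_succ, Fin.succAbove, h01, h02, h03, h12, h13]
  ring

/-- The invariants of the determinant quartic are, up to a power of `c`, the discriminant of `g` and
the resultant of `f` and `g` as binary forms in `x₂, x₃`. -/
lemma ne_zero_of_invariants (h : IsFamily2NormalForm f g c)
    (hmid : middleInvariant (gram f) (gram g) ≠ 0)
    (hdisc : residualDiscriminant (gram f) (gram g) ≠ 0) :
    gram g 2 2 * gram g 3 3 - gram g 2 3 ^ 2 ≠ 0 ∧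
    (gram f 2 2 * gram g 3 3 + gram f 3 3 * gram g 2 2 - 2 * gram f 2 3 * gram g 2 3) ^ 2
      - 4 * (gram f 2 2 * gram f 3 3 - gram f 2 3 ^ 2) *
        (gram g 2 2 * gram g 3 3 - gram g 2 3 ^ 2) ≠ 0 := by
  have hg0 := h.g0
  have hg1 := h.g1
  have hF : (gram f).det = c ^ 2 * (gram f 2 2 * gram f 3 3 - gram f 2 3 ^ 2) := by
    rw [det_of_orthogonal_blocks h.f01 h.f02 h.f03 h.f12 h.f13, h.f00, h.f11, gram_comm f 3 2]
    ring
  have hG : (gram g).det = 0 := Matrix.det_eq_zero_of_row_eq_zero 0 hg0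
  have hadd : (gram f + gram g).det = c ^ 2 * ((gram f 2 2 + gram g 2 2) *
      (gram f 3 3 + gram g 3 3) - (gram f 2 3 + gram g 2 3) ^ 2) := by
    rw [det_of_orthogonal_blocks] <;>
      simp only [Matrix.add_apply, h.f00, h.f11, h.f01, h.f02, h.f03, h.f12, h.f13, hg0, hg1,
        gram_comm _ 3 2, add_zero]
    ring
  have hsub : (gram f - gram g).det = c ^ 2 * ((gram f 2 2 - gram g 2 2) *
      (gram f 3 3 - gram g 3 3) - (gram f 2 3 - gram g 2 3) ^ 2) := by
    rw [det_of_orthogonal_blocks] <;>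
      simp only [Matrix.sub_apply, h.f00, h.f11, h.f01, h.f02, h.f03, h.f12, h.f13, hg0, hg1,
        gram_comm _ 3 2, sub_zero]
    ring
  have hmid' : middleInvariant (gram f) (gram g) =
      2 * c ^ 2 * (gram g 2 2 * gram g 3 3 - gram g 2 3 ^ 2) := by
    rw [middleInvariant, hF, hG, hadd, hsub]; ring
  constructor
  · intro h0
    rw [hmid', h0] at hmid
    simp at hmid
  · intro h0
    apply hdisc
    rw [residualDiscriminant, hmid', hF, hadd, hsub]
    linear_combination 4 * c ^ 4 * h0

end IsFamily2NormalForm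

/-- An orthonormal basis of the line `x₂ = x₃ = 0`, completed by its orthogonal complement. -/
lemma exists_family2NormalForm {f g : Quadric} (g0 : ∀ i, gram g 0 i = 0)
    (g1 : ∀ i, gram g 1 i = 0) (hf : gram f 0 0 * gram f 1 1 - gram f 0 1 ^ 2 ≠ 0) :
    ∃ (A : SL(4, ℂ)) (c : ℂ), IsFamily2NormalForm (act A f) (act A g) c := by
  obtain ⟨s, t, s', t', hdet, h1, h2, h3⟩ := exists_isotropic_pair hf
  set q := gram f 0 0 * s * s' + gram f 0 1 * (s * t' + t * s') + gram f 1 1 * t * t' with hq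
  set u : Vec := ![s, t, 0, 0] with hu
  set u' : Vec := ![s', t', 0, 0] with hu'
  have huu : f.polarBilin u u = 0 := by
    rw [polarBilin_expand]
    simp [hu]
    linear_combination h1
  have huu' : f.polarBilin u' u' = 0 := by
    rw [polarBilin_expand]
    simp [hu']
    linear_combination h2
  have huq : f.polarBilin u u' = q := by
    rw [polarBilin_expand, hq]
    simp [hu, hu']
    ring
  have huq' : f.polarBilin u' u = q := by rw [polarBilin_comm, huq]
  set r := (2 * q)⁻¹ with hr
  have hrq : r * q = 1 / 2 := by rw [hr]; field_simp
  have hr0 : r ≠ 0 := inv_ne_zero (mul_ne_zero two_ne_zero h3)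
  set b₀ : Vec := u + r • u' with hb0
  set b₁ : Vec := Complex.I • u - (Complex.I * r) • u' with hb1
  have h00 : f.polarBilin b₀ b₀ = 1 := by
    simp only [hb0, map_add, map_smul, LinearMap.add_apply, LinearMap.smul_apply, huu, huu', huq,
      huq', smul_eq_mul]
    linear_combination 2 * hrq
  have h11 : f.polarBilin b₁ b₁ = 1 := by
    simp only [hb1, map_sub, map_smul, LinearMap.sub_apply, LinearMap.smul_apply, huu, huu', huq,
      huq', smul_eq_mul]
    linear_combination 2 * hrq - 2 * r * q * Complex.I_sq
  have h01 : f.polarBilin b₀ b₁ = 0 := by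
    simp only [hb0, hb1, map_add, map_sub, map_smul, LinearMap.add_apply,
      LinearMap.smul_apply, huu, huu', huq, huq', smul_eq_mul]
    ring
  have h10 : f.polarBilin b₁ b₀ = 0 := by rw [polarBilin_comm, h01]
  let p : Vec → Vec := fun w => w - (f.polarBilin b₀ w) • b₀ - (f.polarBilin b₁ w) • b₁
  have hp (w : Vec) : p w = w - (f.polarBilin b₀ w) • b₀ - (f.polarBilin b₁ w) • b₁ := rfl
  have hp0 (w : Vec) : f.polarBilin b₀ (p w) = 0 := by
    simp only [hp, map_sub, map_smul, h00, h01, smul_eq_mul]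
    ring
  have hp1 (w : Vec) : f.polarBilin b₁ (p w) = 0 := by
    simp only [hp, map_sub, map_smul, h11, h10, smul_eq_mul]
    ring
  set b : Fin 4 → Vec := ![b₀, b₁, p (e 2), p (e 3)] with hb
  obtain ⟨B, d, hd, hB⟩ := exists_SL_of_basis (b := b) (linearIndependent_of_det (by
    have : (Matrix.of b).det = -2 * Complex.I * r * (s * t' - t * s') := by
      have he2 : e 2 = ![0, 0, 1, 0] := by ext i; fin_cases i <;> simp [e]
      have he3 : e 3 = ![0, 0, 0, 1] := by ext i; fin_cases i <;> simp [e]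
      simp only [hb, hp, hb0, hb1, hu, hu', he2, he3]
      simp [Matrix.det_succ_row_zero, Fin.sum_univ_succ, Fin.succAbove]
      ring
    rw [this]
    simp [hr0, hdet]))
  have hgr := gram_act_of_basis hB
  have hg (v w : Vec) (hv2 : v 2 = 0) (hv3 : v 3 = 0) : g.polarBilin v w = 0 := by
    rw [polarBilin_expand, g0, g0, g0, g0, g1, g1, g1, hv2, hv3]
    ring
  refine ⟨B, d ^ 2, pow_ne_zero 2 hd, ?_, ?_, ?_, ?_, ?_, ?_, ?_, fun i => ?_, fun i => ?_⟩
  all_goals rw [hgr]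
  · simp [hb, h00]
  · simp [hb, h11]
  · simp [hb, h01]
  · simp [hb, hp0]
  · simp [hb, hp0]
  · simp [hb, hp1]
  · simp [hb, hp1]
  · rw [hg _ _ (by simp [hb, hb0, hu, hu']) (by simp [hb, hb0, hu, hu']), mul_zero]
  · rw [hg _ _ (by simp [hb, hb1, hu, hu']) (by simp [hb, hb1, hu, hu']), mul_zero]

lemma IsPairOfConics.act {f g : Quadric} (h : IsPairOfConics f g) (A : SL(4, ℂ)) :
    IsPairOfConics (act A f) (act A g) := by
  obtain ⟨l, m, hlm, hg, hl, hm⟩ := h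
  let A' : Vec →ₗ[ℂ] Vec := Matrix.toLin' (A : Matrix (Fin 4) (Fin 4) ℂ)
  have hA' (v : Vec) : A' v = (A : Matrix (Fin 4) (Fin 4) ℂ).mulVec v := rfl
  have hcut (l : Module.Dual ℂ Vec) (hl : CutsSmoothConic f l) :
      CutsSmoothConic (QuadricPencil.act A f) (l ∘ₗ A') := by
    intro v hv hw
    refine mulVec_injective A ?_
    rw [Matrix.mulVec_zero]
    refine hl _ hv fun w hlw => ?_
    obtain ⟨w, rfl⟩ := mulVec_surjective A w
    rw [← act_polarBilin]
    exact hw w hlw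
  refine ⟨l ∘ₗ A', m ∘ₗ A', ?_, fun x => hg _, hcut l hl, hcut m hm⟩
  rw [LinearIndependent.pair_iff] at hlm ⊢
  intro x y hxy
  refine hlm x y (LinearMap.ext fun w => ?_)
  obtain ⟨w, rfl⟩ := mulVec_surjective A w
  exact LinearMap.congr_fun hxy w

lemma holdsForGeneralMember_family2 : HoldsForGeneralMember Family2 (fun f g =>
    IsStrictlySemistable f g ∧
    (IsSmoothQuadric f ∧ ¬ IsReducibleQuadric f) ∧
    IsPairOfConics f g ∧
    ∃ A : SL(4, ℂ), Family2 (act A f) (act A g) ∧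
      SingularExactlyA1At (act A f) (act A g)
        {![1, Complex.I, 0, 0], ![1, -Complex.I, 0, 0]}) := by
  have heval (f g : Quadric) : MvPolynomial.eval (coeffs f g)
      ((genericMatrix 0).det * middleInvariant (genericMatrix 0) (genericMatrix 1) *
        residualDiscriminant (genericMatrix 0) (genericMatrix 1) *
        quarticInvariant (genericMatrix 0) (genericMatrix 1) *
        (genericMatrix 0 0 0 * genericMatrix 0 1 1 - genericMatrix 0 0 1 ^ 2)) =
      (gram f).det * middleInvariant (gram f) (gram g) * residualDiscriminant (gram f) (gram g) *
        quarticInvariant (gram f) (gram g) *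
        (gram f 0 0 * gram f 1 1 - gram f 0 1 ^ 2) := by
    simp only [map_mul, map_sub, map_pow, middleInvariant_map, residualDiscriminant_map,
      quarticInvariant_map, RingHom.map_det, RingHom.mapMatrix_apply, genericMatrix_zero_map,
      genericMatrix_one_map]
    rw [← genericMatrix_zero_map f g]
    simp
  have hdet (x y : ℂ) : (x • gram (diagForm fun _ => 1) + y • gram quadrangleG).det =
      x ^ 2 * (x ^ 2 - y ^ 2) := by
    rw [IsFamily2NormalForm.det_of_orthogonal_blocks] <;> simp [gram_diagForm, gram_quadrangleG]
    ring
  have h1 : (gram (diagForm fun _ => 1)).det = 1 := by simpa using hdet 1 0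
  have h2 : (gram quadrangleG).det = 0 := by simpa using hdet 0 1
  have h3 : (gram (diagForm fun _ => 1) + gram quadrangleG).det = 0 := by simpa using hdet 1 1
  have h4 : (gram (diagForm fun _ => 1) - gram quadrangleG).det = 0 := by
    simpa [sub_eq_add_neg] using hdet 1 (-1)
  refine .of_eval _ heval (f₀ := diagForm fun _ => 1) (g₀ := quadrangleG) ?_ ?_
    fun f g hfam hD => ?_
  · rw [family2_iff, gram_quadrangleG]
    constructor <;> intro i <;> fin_cases i <;> rfl
  · rw [quarticInvariant_eq (a := 1) (b := 0) (c := -1) (d := 0) (e := 0), residualDiscriminant,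
      middleInvariant, h1, h2, h3, h4, gram_diagForm]
    · simp
    · intro x y
      beta_reduce
      rw [hdet]
      ring
  · simp only [ne_eq, mul_eq_zero, not_or] at hD
    obtain ⟨⟨⟨⟨hf, hmid⟩, hdisc⟩, hI⟩, hf01⟩ := hD
    obtain ⟨g0, g1⟩ := (family2_iff f g).1 hfam
    obtain ⟨A, c, h⟩ := exists_family2NormalForm g0 g1 hf01
    obtain ⟨hg, hres⟩ := h.ne_zero_of_invariants (by rwa [middleInvariant_act])
      (by rwa [residualDiscriminant_act])
    have hsm := isSmoothQuadric_of_det_ne_zero hf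
    refine ⟨isStrictlySemistable_of_quarticInvariant_ne_zero hI
      (hasSingularBaseLocus_of_family2 hfam), ⟨hsm, hsm.not_isReducibleQuadric⟩, ?_, A,
      (family2_iff _ _).2 ⟨h.g0, h.g1⟩, h.singularExactlyA1At hg hres⟩
    have := (h.isPairOfConics hg hres).act A⁻¹
    rwa [act_inv_act, act_inv_act] at this

/-! ### The standard twisted cubic with a bisecant line -/

/-- The form `x₀ x₃ + x₂² / 2`. -/
noncomputable def cubicF : Quadric :=
  quad ((1 / 2 : ℂ) • !![0, 0, 0, 1; 0, 0, 0, 0; 0, 0, 1, 0; 1, 0, 0, 0])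

/-- The form `x₁ x₂ + x₃² / 2`. -/
noncomputable def cubicG : Quadric :=
  quad ((1 / 2 : ℂ) • !![0, 0, 0, 0; 0, 0, 1, 0; 0, 1, 0, 0; 0, 0, 0, 1])

lemma gram_cubicF : gram cubicF = !![0, 0, 0, 1; 0, 0, 0, 0; 0, 0, 1, 0; 1, 0, 0, 0] :=
  gram_quad_half (by ext i j; fin_cases i <;> fin_cases j <;> rfl)

lemma gram_cubicG : gram cubicG = !![0, 0, 0, 0; 0, 0, 1, 0; 0, 1, 0, 0; 0, 0, 0, 1] :=
  gram_quad_half (by ext i j; fin_cases i <;> fin_cases j <;> rfl)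

lemma cubicF_polar (v w : Vec) : cubicF.polarBilin v w = v 2 * w 2 + (v 0 * w 3 + v 3 * w 0) := by
  rw [polarBilin_expand, gram_cubicF]
  simp

lemma cubicG_polar (v w : Vec) : cubicG.polarBilin v w = v 3 * w 3 + (v 1 * w 2 + v 2 * w 1) := by
  rw [polarBilin_expand, gram_cubicG]
  simp

lemma singularExactlyA1At_cubic : SingularExactlyA1At cubicF cubicG {e 0, e 1} := by
  constructor
  · rintro _ (rfl | rfl)
    · refine ⟨e_ne_zero 0, ?_, cubicG, cubicF, by rw [Set.pair_comm], ?_, ?_, ?_⟩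
      · rw [mem_baseLocus_iff_polar, cubicF_polar, cubicG_polar]
        simp [e]
      · refine LinearMap.ext fun w => ?_
        rw [cubicG_polar]
        simp [e]
      · intro h
        have := LinearMap.congr_fun h (e 3)
        rw [cubicF_polar] at this
        simp [e] at this
      · intro v hv hw
        simp only [cubicF_polar, cubicG_polar] at hv hw
        have h3 : v 3 = 0 := by simpa [e] using hv
        have h1 : v 1 = 0 := by simpa [e] using hw (e 2) (by simp [e])
        have h2 : v 2 = 0 := by simpa [e] using hw (e 1) (by simp [e])
        refine mem_span_of_eq (v 0) fun i => ?_
        fin_cases i <;> simp [e, h1, h2, h3]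
    · refine ⟨e_ne_zero 1, ?_, cubicF, cubicG, rfl, ?_, ?_, ?_⟩
      · rw [mem_baseLocus_iff_polar, cubicF_polar, cubicG_polar]
        simp [e]
      · refine LinearMap.ext fun w => ?_
        rw [cubicF_polar]
        simp [e]
      · intro h
        have := LinearMap.congr_fun h (e 2)
        rw [cubicG_polar] at this
        simp [e] at this
      · intro v hv hw
        simp only [cubicF_polar, cubicG_polar] at hv hw
        have h2 : v 2 = 0 := by simpa [e] using hv
        have h0 : v 0 = 0 := by simpa [e] using hw (e 3) (by simp [e])
        have h3 : v 3 = 0 := by simpa [e] using hw (e 0) (by simp [e])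
        refine mem_span_of_eq (v 1) fun i => ?_
        fin_cases i <;> simp [e, h0, h2, h3]
  · intro p hp
    obtain ⟨x, y, hxy, h⟩ := hp.exists_relation
    have hb := (mem_baseLocus_iff_polar _ _ _).1 hp.2.1
    simp only [cubicF_polar, cubicG_polar] at h hb
    have e0 : x * p 3 = 0 := by simpa [e] using h (e 0)
    have e1 : y * p 2 = 0 := by simpa [e] using h (e 1)
    have e2 : x * p 2 + y * p 1 = 0 := by simpa [e] using h (e 2)
    have e3 : x * p 0 + y * p 3 = 0 := by simpa [e] using h (e 3)
    have h3 : p 3 = 0 := by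
      by_cases hx : x = 0
      · have hy : y ≠ 0 := fun hy => hxy ⟨hx, hy⟩
        simpa [hx, hy] using e3
      · simpa [hx] using e0
    have h2 : p 2 = 0 := by
      by_cases hx : x = 0
      · have hy : y ≠ 0 := fun hy => hxy ⟨hx, hy⟩
        simpa [hy] using e1
      · have := hb.1
        rw [h3] at this
        simpa using this
    rw [h2, mul_zero, zero_add] at e2
    rw [h3, mul_zero, add_zero] at e3
    by_cases hx : x = 0
    · have hy : y ≠ 0 := fun hy => hxy ⟨hx, hy⟩
      have h1 : p 1 = 0 := (mul_eq_zero.1 e2).resolve_left hy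
      refine ⟨e 0, Or.inl rfl, mem_span_of_eq (p 0) fun i => ?_⟩
      fin_cases i <;> simp [e, h1, h2, h3]
    · have h0 : p 0 = 0 := (mul_eq_zero.1 e3).resolve_left hx
      refine ⟨e 1, Or.inr rfl, mem_span_of_eq (p 1) fun i => ?_⟩
      fin_cases i <;> simp [e, h0, h2, h3]

lemma isTwistedCubicWithBisecant_cubic : IsTwistedCubicWithBisecant cubicF cubicG := by
  -- the scalar giving the matrix below determinant one
  obtain ⟨k, hk⟩ := IsAlgClosed.exists_pow_nat_eq (4 : ℂ) (n := 4) (by norm_num)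
  have hk0 : k ≠ 0 := by rintro rfl; norm_num at hk
  let B : SL(4, ℂ) := ⟨!![-k / 2, 0, 0, 0; 0, 0, 0, -k / 2; 0, k, 0, 0; 0, 0, k, 0], by
    simp [Matrix.det_succ_row_zero, Fin.sum_univ_succ, Fin.succAbove]
    linear_combination hk / 4⟩
  have hB (v : Vec) : Matrix.toLin' (B : Matrix (Fin 4) (Fin 4) ℂ) v =
      ![-k / 2 * v 0, -k / 2 * v 3, k * v 1, k * v 2] := by
    rw [Matrix.toLin'_apply]
    ext i
    fin_cases i <;> simp [B, Matrix.mulVec, dotProduct, Fin.sum_univ_four]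
  refine ⟨B, ?_⟩
  ext p
  rw [mem_baseLocus_iff_polar, cubicF_polar, cubicG_polar, Set.image_union, Set.mem_union]
  constructor
  · rintro ⟨hF, hG⟩
    by_cases h2 : p 2 = 0
    · have h3 : p 3 = 0 := by
        rw [h2] at hG
        simpa using hG
      -- the line `x₂ = x₃ = 0`
      right
      refine ⟨![-2 * p 0 / k, 0, 0, -2 * p 1 / k], ?_, ?_⟩
      · rw [mem_span_e_pair (by decide)]
        intro i hi hi'
        fin_cases i <;> simp at hi hi' ⊢
      · rw [hB]
        ext i
        fin_cases i
        · simp; field_simp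
        · simp; field_simp
        · simp [h2]
        · simp [h3]
    · have h3 : p 3 ≠ 0 := by
        intro h3
        rw [h3] at hF
        exact h2 (by simpa using hF)
      left
      obtain ⟨s, hs⟩ := IsAlgClosed.exists_pow_nat_eq (p 2 ^ 2 / (k * p 3)) (n := 3) (by norm_num)
      refine ⟨_, ⟨(s, p 3 * s / p 2), rfl⟩, ?_⟩
      have hs' : k * p 3 * s ^ 3 = p 2 ^ 2 := by rw [hs, mul_div_cancel₀ _ (mul_ne_zero hk0 h3)]
      rw [hB]
      ext i
      fin_cases i
      · simp
        refine mul_left_cancel₀ h3 ?_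
        linear_combination -hs' / 2 - hF / 2
      · simp
        field_simp
        linear_combination -p 3 ^ 2 * hs' - p 2 ^ 2 * hG
      · simp
        field_simp
        linear_combination hs'
      · simp
        field_simp
        linear_combination hs'
  · rintro (⟨_, ⟨⟨s, t⟩, rfl⟩, rfl⟩ | ⟨v, hv, rfl⟩)
    · rw [hB]
      simp
      constructor <;> ring
    · rw [mem_span_e_pair (by decide)] at hv
      rw [hB]
      simp [hv 1 (by decide) (by decide), hv 2 (by decide) (by decide)]

lemma IsTwistedCubicWithBisecant.of_projEquiv {f g f' g' : Quadric} (h : ProjEquiv f g f' g')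
    (h' : IsTwistedCubicWithBisecant f' g') : IsTwistedCubicWithBisecant f g := by
  obtain ⟨A, hA⟩ := h
  obtain ⟨B, hB⟩ := h'
  refine ⟨A * B, ?_⟩
  rw [baseLocus_eq_image hA, hB, ← Set.image_comp]
  refine congrArg (· '' _) (funext fun v => ?_)
  simp [Matrix.SpecialLinearGroup.coe_mul, Matrix.toLin'_apply, Matrix.mulVec_mulVec]

/-! ### The general member of Family 3 -/

/-- The coordinates `x₀` and `x₁` can be changed so as to absorb all terms with `x₃` in `f` and all
terms with `x₂` in `g`. -/
lemma projEquiv_cubic_of_gram {f g : Quadric}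
    (f00 : gram f 0 0 = 0) (f01 : gram f 0 1 = 0) (f11 : gram f 1 1 = 0) (f02 : gram f 0 2 = 0)
    (f12 : gram f 1 2 = 0) (f13 : gram f 1 3 = 0) (f03 : gram f 0 3 ≠ 0) (f22 : gram f 2 2 ≠ 0)
    (g00 : gram g 0 0 = 0) (g01 : gram g 0 1 = 0) (g11 : gram g 1 1 = 0) (g03 : gram g 0 3 = 0)
    (g13 : gram g 1 3 = 0) (g02 : gram g 0 2 = 0) (g12 : gram g 1 2 ≠ 0) (g33 : gram g 3 3 ≠ 0) :
    ProjEquiv f g cubicF cubicG := by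
  obtain ⟨A, -, -, -, -, -, hs⟩ := projEquiv_of_basis (f := f) (g := g) (f' := cubicF)
    (g' := cubicG) (x := gram f 2 2) (y := gram g 3 3)
    (b := ![![gram f 2 2 / gram f 0 3, 0, 0, 0], ![0, gram g 3 3 / gram g 1 2, 0, 0],
      ![-gram f 2 3 / gram f 0 3, -gram g 2 2 / gram g 1 2 / 2, 1, 0],
      ![-gram f 3 3 / gram f 0 3 / 2, -gram g 2 3 / gram g 1 2, 0, 1]])
    (linearIndependent_of_det (by
      simp [Matrix.det_succ_row_zero, Fin.sum_univ_succ, Fin.succAbove, f22, g33, f03, g12]))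
    f22 g33
    (by
      intro i j
      rw [polarBilin_expand, gram_cubicF, f00, f01, f11, f02, f12, f13]
      fin_cases i <;> fin_cases j <;> simp <;> field_simp <;> ring)
    (by
      intro i j
      rw [polarBilin_expand, gram_cubicG, g00, g01, g11, g03, g13, g02]
      fin_cases i <;> fin_cases j <;> simp <;> field_simp <;> ring)
  exact ⟨A, hs⟩

/-- If `∂f/∂x₀, ∂f/∂x₁` are multiples of `x₃` and `∂g/∂x₀, ∂g/∂x₁` are multiples of `x₂`, the
coordinates on the line `x₂ = x₃ = 0` can be chosen such that these are multiples
of `x₃, 0` and of `0, x₂`. -/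
lemma projEquiv_cubic_of_det {f g : Quadric}
    (f00 : gram f 0 0 = 0) (f01 : gram f 0 1 = 0) (f11 : gram f 1 1 = 0) (f02 : gram f 0 2 = 0)
    (f12 : gram f 1 2 = 0) (f22 : gram f 2 2 ≠ 0)
    (g00 : gram g 0 0 = 0) (g01 : gram g 0 1 = 0) (g11 : gram g 1 1 = 0) (g03 : gram g 0 3 = 0)
    (g13 : gram g 1 3 = 0) (g33 : gram g 3 3 ≠ 0)
    (hdet : gram f 0 3 * gram g 1 2 - gram f 1 3 * gram g 0 2 ≠ 0) :
    ProjEquiv f g cubicF cubicG := by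
  set b : Fin 4 → Vec := ![![gram g 1 2, -gram g 0 2, 0, 0], ![-gram f 1 3, gram f 0 3, 0, 0],
    ![0, 0, 1, 0], ![0, 0, 0, 1]] with hb
  obtain ⟨B, d, hd, hB⟩ := exists_SL_of_basis (b := b) (linearIndependent_of_det (by
    have : (Matrix.of b).det = gram f 0 3 * gram g 1 2 - gram f 1 3 * gram g 0 2 := by
      simp [hb, Matrix.det_succ_row_zero, Fin.sum_univ_succ, Fin.succAbove]
      ring
    rwa [this]))
  have hd2 : d ^ 2 ≠ 0 := pow_ne_zero 2 hd
  have hgr := gram_act_of_basis hB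
  refine ProjEquiv.trans ⟨B, rfl⟩ (projEquiv_cubic_of_gram ?_ ?_ ?_ ?_ ?_ ?_ ?_ ?_ ?_ ?_ ?_ ?_ ?_ ?_
    ?_ ?_)
  all_goals
    rw [hgr, polarBilin_expand]
    simp only [f00, f01, f11, f02, f12, g00, g01, g11, g03, g13]
  · simp [hb]
  · simp [hb]
  · simp [hb]
  · simp [hb]
  · simp [hb]
  · simp [hb]
    right
    ring
  · refine mul_ne_zero hd2 fun h => hdet ?_
    simp [hb] at h
    linear_combination h
  · simp [hb, hd, f22]
  · simp [hb]
  · simp [hb]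
  · simp [hb]
  · simp [hb]
  · simp [hb]
  · simp [hb]
    right
    ring
  · refine mul_ne_zero hd2 fun h => hdet ?_
    simp [hb] at h
    linear_combination h
  · simp [hb, hd, g33]

/-- For a pencil containing the line `x₂ = x₃ = 0`, the coefficients of the Jacobian determinant
with respect to `x₀, x₁`, which is a binary quadratic form in `x₂, x₃`. -/
def lineJacobian {R : Type*} [CommRing R] (F G : Matrix (Fin 4) (Fin 4) R) : Fin 3 → R :=
  ![F 0 2 * G 1 2 - F 1 2 * G 0 2,
    F 0 2 * G 1 3 + F 0 3 * G 1 2 - F 1 2 * G 0 3 - F 1 3 * G 0 2,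
    F 0 3 * G 1 3 - F 1 3 * G 0 3]

/-- The coefficients of the parametrisation by cubic forms in `x₂, x₃` of the residual curve of the
line `x₂ = x₃ = 0` in the base locus. -/
def residualCubic {R : Type*} [CommRing R] (F G : Matrix (Fin 4) (Fin 4) R) :
    Matrix (Fin 4) (Fin 4) R :=
  !![F 1 2 * G 2 2 - F 2 2 * G 1 2,
      F 1 3 * G 2 2 + 2 * F 1 2 * G 2 3 - 2 * F 2 3 * G 1 2 - F 2 2 * G 1 3,
      F 1 2 * G 3 3 + 2 * F 1 3 * G 2 3 - 2 * F 2 3 * G 1 3 - F 3 3 * G 1 2,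
      F 1 3 * G 3 3 - F 3 3 * G 1 3;
    F 2 2 * G 0 2 - F 0 2 * G 2 2,
      F 2 2 * G 0 3 + 2 * F 2 3 * G 0 2 - 2 * F 0 2 * G 2 3 - F 0 3 * G 2 2,
      2 * F 2 3 * G 0 3 + F 3 3 * G 0 2 - F 0 2 * G 3 3 - 2 * F 0 3 * G 2 3,
      F 3 3 * G 0 3 - F 0 3 * G 3 3;
    lineJacobian F G 0, lineJacobian F G 1, lineJacobian F G 2, 0;
    0, lineJacobian F G 0, lineJacobian F G 1, lineJacobian F G 2]

lemma lineJacobian_map {R S : Type*} [CommRing R] [CommRing S] (φ : R →+* S)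
    (F G : Matrix (Fin 4) (Fin 4) R) (i : Fin 3) :
    φ (lineJacobian F G i) = lineJacobian (F.map φ) (G.map φ) i := by
  fin_cases i <;> simp [lineJacobian]

lemma residualCubic_map {R S : Type*} [CommRing R] [CommRing S] (φ : R →+* S)
    (F G : Matrix (Fin 4) (Fin 4) R) :
    (residualCubic F G).map φ = residualCubic (F.map φ) (G.map φ) := by
  have h2 : φ 2 = 2 := map_ofNat φ 2
  ext i j
  fin_cases i <;> fin_cases j <;> simp [residualCubic, lineJacobian_map, h2]

/-- A zero of the Jacobian determinant at which the residual curve met the line in a singular way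
would be a zero of all cubic forms of the parametrisation. -/
lemma residualCubic_ne_zero {F G : Matrix (Fin 4) (Fin 4) ℂ} (h : (residualCubic F G).det ≠ 0)
    {s t : ℂ} (hst : ¬ (s = 0 ∧ t = 0))
    (hK : lineJacobian F G 0 * s ^ 2 + lineJacobian F G 1 * s * t + lineJacobian F G 2 * t ^ 2 = 0)
    (h1 : (F 1 2 * s + F 1 3 * t) * (G 2 2 * s ^ 2 + 2 * G 2 3 * s * t + G 3 3 * t ^ 2) =
      (F 2 2 * s ^ 2 + 2 * F 2 3 * s * t + F 3 3 * t ^ 2) * (G 1 2 * s + G 1 3 * t))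
    (h0 : (F 0 2 * s + F 0 3 * t) * (G 2 2 * s ^ 2 + 2 * G 2 3 * s * t + G 3 3 * t ^ 2) =
      (F 2 2 * s ^ 2 + 2 * F 2 3 * s * t + F 3 3 * t ^ 2) * (G 0 2 * s + G 0 3 * t)) : False := by
  refine h (Matrix.exists_mulVec_eq_zero_iff.1
    ⟨![s ^ 3, s ^ 2 * t, s * t ^ 2, t ^ 3], fun hv => hst ?_, ?_⟩)
  · have e0 := congrFun hv 0
    have e3 := congrFun hv 3
    exact ⟨by simpa using e0, by simpa using e3⟩
  · ext i
    fin_cases i <;> simp [Matrix.mulVec, dotProduct, Fin.sum_univ_four, residualCubic]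
    · linear_combination h1
    · linear_combination -h0
    · linear_combination s * hK
    · linear_combination t * hK

/-- The rows of a singular `2 × 2` matrix are linearly dependent. -/
lemma exists_relation_of_det_eq_zero {p q r w : ℂ} (h : p * w - q * r = 0) :
    ∃ x y : ℂ, ¬ (x = 0 ∧ y = 0) ∧ x * p + y * r = 0 ∧ x * q + y * w = 0 := by
  by_cases hp : p = 0 ∧ r = 0
  · by_cases hq : q = 0 ∧ w = 0
    · exact ⟨1, 0, by simp, by simp [hp.1], by simp [hq.1]⟩
    · exact ⟨w, -q, fun h => hq ⟨neg_eq_zero.1 h.2, h.1⟩, by simp [hp.1, hp.2], by ring⟩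
  · exact ⟨r, -p, fun h => hp ⟨neg_eq_zero.1 h.2, h.1⟩, by ring, by linear_combination -h⟩

/-- Two vectors in the kernel of a nonzero linear form on `ℂ²` are proportional. -/
lemma mul_eq_mul_of_relations {x y a b S S' : ℂ} (hxy : ¬ (x = 0 ∧ y = 0))
    (h : x * a + y * b = 0) (hS : x * S + y * S' = 0) : a * S' = S * b := by
  by_cases hx : x = 0
  · have hy : y ≠ 0 := fun hy => hxy ⟨hx, hy⟩
    refine mul_left_cancel₀ hy ?_
    linear_combination a * hS - S * h
  · refine mul_left_cancel₀ hx ?_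
    linear_combination S' * h - b * hS

/-- Two members of the pencil killing the partial derivatives along the line at the two different
zeros of the Jacobian determinant are different. -/
lemma det_ne_zero_of_relations {a₀ a₁ b₀ b₁ A₀ A₁ B₀ B₁ x y x' y' : ℂ}
    (hxy : ¬ (x = 0 ∧ y = 0)) (hxy' : ¬ (x' = 0 ∧ y' = 0))
    (h0 : x * a₀ + y * b₀ = 0) (h1 : x * a₁ + y * b₁ = 0)
    (h0' : x' * A₀ + y' * B₀ = 0) (h1' : x' * A₁ + y' * B₁ = 0)
    (hP : a₀ * B₁ + A₀ * b₁ - a₁ * B₀ - A₁ * b₀ ≠ 0) : x * y' - y * x' ≠ 0 := by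
  intro hD
  have key (A B : ℂ) (h : x' * A + y' * B = 0) : x * A + y * B = 0 := by
    by_cases hx : x' = 0
    · have hy : y' ≠ 0 := fun hy => hxy' ⟨hx, hy⟩
      refine (mul_eq_zero.1 (?_ : y' * _ = 0)).resolve_left hy
      linear_combination A * hD + y * h
    · refine (mul_eq_zero.1 (?_ : x' * _ = 0)).resolve_left hx
      linear_combination x * h - B * hD
  have k0 := key _ _ h0'
  have k1 := key _ _ h1'
  by_cases hx : x = 0
  · have hy : y ≠ 0 := fun hy => hxy ⟨hx, hy⟩
    refine hP ((mul_eq_zero.1 (?_ : y * _ = 0)).resolve_left hy)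
    linear_combination a₀ * k1 - a₁ * k0 + A₀ * h1 - A₁ * h0
  · refine hP ((mul_eq_zero.1 (?_ : x * _ = 0)).resolve_left hx)
    linear_combination b₁ * k0 - b₀ * k1 + B₁ * h0 - B₀ * h1

/-- Normal form of the pencils containing the line `x₂ = x₃ = 0`, in general position: the zeros of
the Jacobian determinant serve as coordinates `x₂, x₃`, and at each of them some member of the
pencil has vanishing partial derivatives with respect to `x₀, x₁`. -/
lemma projEquiv_cubic {f g : Quadric}
    (f00 : gram f 0 0 = 0) (f01 : gram f 0 1 = 0) (f11 : gram f 1 1 = 0)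
    (g00 : gram g 0 0 = 0) (g01 : gram g 0 1 = 0) (g11 : gram g 1 1 = 0)
    (hK : 4 * lineJacobian (gram f) (gram g) 0 * lineJacobian (gram f) (gram g) 2 -
      lineJacobian (gram f) (gram g) 1 ^ 2 ≠ 0)
    (hC : (residualCubic (gram f) (gram g)).det ≠ 0) : ProjEquiv f g cubicF cubicG := by
  obtain ⟨s, t, s', t', hst, h1, h2, h3⟩ := exists_isotropic_pair
    (a := lineJacobian (gram f) (gram g) 0) (b := lineJacobian (gram f) (gram g) 1 / 2)
    (c := lineJacobian (gram f) (gram g) 2) (fun h => hK (by linear_combination 4 * h))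
  have hst0 : ¬ (s = 0 ∧ t = 0) := by
    rintro ⟨rfl, rfl⟩
    exact hst (by ring)
  have hst0' : ¬ (s' = 0 ∧ t' = 0) := by
    rintro ⟨rfl, rfl⟩
    exact hst (by ring)
  have hC1 := residualCubic_ne_zero hC hst0 (by linear_combination h1)
  have hC2 := residualCubic_ne_zero hC hst0' (by linear_combination h2)
  simp only [lineJacobian, Matrix.cons_val_zero, Matrix.cons_val_one, Matrix.cons_val] at h1 h2 h3
  obtain ⟨x, y, hxy, e0, e1⟩ := exists_relation_of_det_eq_zero
    (p := gram f 0 2 * s + gram f 0 3 * t) (q := gram f 1 2 * s + gram f 1 3 * t)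
    (r := gram g 0 2 * s + gram g 0 3 * t) (w := gram g 1 2 * s + gram g 1 3 * t)
    (by linear_combination h1)
  obtain ⟨x', y', hxy', e0', e1'⟩ := exists_relation_of_det_eq_zero
    (p := gram f 0 2 * s' + gram f 0 3 * t') (q := gram f 1 2 * s' + gram f 1 3 * t')
    (r := gram g 0 2 * s' + gram g 0 3 * t') (w := gram g 1 2 * s' + gram g 1 3 * t')
    (by linear_combination h2)
  have hdet := det_ne_zero_of_relations hxy hxy' e0 e1 e0' e1'
    (fun h => h3 (by linear_combination h / 2))
  -- `x f + y g` and `x' f + y' g` are the new generators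
  set b : Fin 4 → Vec := ![e 0, e 1, ![0, 0, s, t], ![0, 0, s', t']] with hb
  obtain ⟨B, d, hd, hB⟩ := exists_SL_of_basis (b := b) (linearIndependent_of_det (by
    have : (Matrix.of b).det = s * t' - t * s' := by
      simp [hb, e, Matrix.det_succ_row_zero, Fin.sum_univ_succ, Fin.succAbove]
      ring
    rwa [this]))
  have hd2 : d ^ 2 ≠ 0 := pow_ne_zero 2 hd
  have hgr := gram_act_of_basis hB
  refine (ProjEquiv.of_span_eq (span_combination_eq f g hdet).symm).trans
    (ProjEquiv.trans ⟨B, rfl⟩ (projEquiv_cubic_of_det (f := act B (x • f + y • g))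
    (g := act B (x' • f + y' • g)) ?_ ?_ ?_ ?_ ?_ ?_ ?_ ?_ ?_ ?_ ?_ ?_ ?_))
  all_goals
    simp only [hgr, polarBilin_expand, map_add, map_smul, Matrix.add_apply, Matrix.smul_apply,
      smul_eq_mul, f00, f01, f11, g00, g01, g11]
  · simp [hb, e]
  · simp [hb, e]
  · simp [hb, e]
  · simp [hb, e]
    linear_combination d ^ 2 * e0
  · simp [hb, e]
    linear_combination d ^ 2 * e1
  · refine fun h => hC1 (mul_eq_mul_of_relations hxy e1 (?_ : x * _ + y * _ = 0))
      (mul_eq_mul_of_relations hxy e0 (?_ : x * _ + y * _ = 0)) <;>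
    · refine mul_left_cancel₀ hd2 ?_
      simp [hb] at h
      linear_combination h
  · simp [hb, e]
  · simp [hb, e]
  · simp [hb, e]
  · simp [hb, e]
    linear_combination d ^ 2 * e0'
  · simp [hb, e]
    linear_combination d ^ 2 * e1'
  · refine fun h => hC2 (mul_eq_mul_of_relations hxy' e1' (?_ : x' * _ + y' * _ = 0))
      (mul_eq_mul_of_relations hxy' e0' (?_ : x' * _ + y' * _ = 0)) <;>
    · refine mul_left_cancel₀ hd2 ?_
      simp [hb] at h
      linear_combination h
  · intro h
    simp [hb, e] at h
    refine mul_ne_zero (mul_ne_zero hd2 hd2) (mul_ne_zero hdet h3) ?_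
    linear_combination h / 2 + d ^ 4 / 2 *
      (e0 * (x' * (gram f 1 2 * s' + gram f 1 3 * t') + y' * (gram g 1 2 * s' + gram g 1 3 * t')) -
      e1 * (x' * (gram f 0 2 * s' + gram f 0 3 * t') + y' * (gram g 0 2 * s' + gram g 0 3 * t')))

lemma det_cubicF_add_cubicG (x y : ℂ) :
    (x • gram cubicF + y • gram cubicG).det = x ^ 2 * y ^ 2 := by
  simp [gram_cubicF, gram_cubicG, Matrix.det_succ_row_zero, Fin.sum_univ_succ, Fin.succAbove]
  ring

/-- The line `x₂ = x₃ = 0` lies on all members of the standard pencil. -/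
lemma family3_of_mem_span {f g : Quadric} (hf : f ∈ Submodule.span ℂ {cubicF, cubicG})
    (hg : g ∈ Submodule.span ℂ {cubicF, cubicG}) : Family3 f g := by
  obtain ⟨a, b, rfl⟩ := Submodule.mem_span_pair.1 hf
  obtain ⟨c, d, rfl⟩ := Submodule.mem_span_pair.1 hg
  rw [family3_iff]
  simp [gram_cubicF, gram_cubicG]

lemma holdsForGeneralMember_family3 : HoldsForGeneralMember Family3 (fun f g =>
    IsStrictlySemistable f g ∧
    (IsSmoothQuadric f ∧ ¬ IsReducibleQuadric f) ∧
    (IsSmoothQuadric g ∧ ¬ IsReducibleQuadric g) ∧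
    IsTwistedCubicWithBisecant f g ∧
    ∃ A : SL(4, ℂ), Family3 (act A f) (act A g) ∧
      SingularExactlyA1At (act A f) (act A g) {![1, 0, 0, 0], ![0, 1, 0, 0]}) := by
  have heval (f g : Quadric) : MvPolynomial.eval (coeffs f g)
      ((genericMatrix 0).det * (genericMatrix 1).det *
        quarticInvariant (genericMatrix 0) (genericMatrix 1) *
        (4 * lineJacobian (genericMatrix 0) (genericMatrix 1) 0 *
          lineJacobian (genericMatrix 0) (genericMatrix 1) 2 -
          lineJacobian (genericMatrix 0) (genericMatrix 1) 1 ^ 2) *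
        (residualCubic (genericMatrix 0) (genericMatrix 1)).det) =
      (gram f).det * (gram g).det * quarticInvariant (gram f) (gram g) *
        (4 * lineJacobian (gram f) (gram g) 0 * lineJacobian (gram f) (gram g) 2 -
          lineJacobian (gram f) (gram g) 1 ^ 2) *
        (residualCubic (gram f) (gram g)).det := by
    have h4 : MvPolynomial.eval (coeffs f g) 4 = 4 := map_ofNat _ 4
    simp only [map_mul, map_sub, map_pow, h4, quarticInvariant_map, lineJacobian_map,
      RingHom.map_det, RingHom.mapMatrix_apply, residualCubic_map, genericMatrix_zero_map,
      genericMatrix_one_map]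
  have hgram : gram (cubicF + cubicG) = (1 : ℂ) • gram cubicF + (1 : ℂ) • gram cubicG := by simp
  have hgram' : gram (cubicF - cubicG) = (1 : ℂ) • gram cubicF + (-1 : ℂ) • gram cubicG := by
    simp [sub_eq_add_neg]
  refine .of_eval _ heval (f₀ := cubicF + cubicG) (g₀ := cubicF - cubicG) ?_ ?_
    fun f g hfam hD => ?_
  · exact family3_of_mem_span (Submodule.mem_span_pair.2 ⟨1, 1, by simp⟩)
      (Submodule.mem_span_pair.2 ⟨1, -1, by simp [sub_eq_add_neg]⟩)
  · have hI : quarticInvariant (gram (cubicF + cubicG)) (gram (cubicF - cubicG)) = 576 := by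
      rw [quarticInvariant_eq (a := 1) (b := 0) (c := -2) (d := 0) (e := 1)]
      · norm_num
      · intro x y
        have : x • gram (cubicF + cubicG) + y • gram (cubicF - cubicG) =
            (x + y) • gram cubicF + (x - y) • gram cubicG := by
          rw [hgram, hgram']
          module
        beta_reduce
        rw [this, det_cubicF_add_cubicG]
        ring
    rw [hI, hgram, hgram', det_cubicF_add_cubicG, det_cubicF_add_cubicG]
    simp [lineJacobian, residualCubic, gram_cubicF, gram_cubicG, Matrix.det_succ_row_zero,
      Fin.sum_univ_succ, Fin.succAbove]
    norm_num
  · simp only [mul_ne_zero_iff] at hD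
    obtain ⟨⟨⟨⟨hf, hg⟩, hI⟩, hK⟩, hC⟩ := hD
    obtain ⟨⟨f00, f01, f11⟩, g00, g01, g11⟩ := (family3_iff f g).1 hfam
    have heq := projEquiv_cubic f00 f01 f11 g00 g01 g11 hK hC
    have hsf := isSmoothQuadric_of_det_ne_zero hf
    have hsg := isSmoothQuadric_of_det_ne_zero hg
    refine ⟨isStrictlySemistable_of_quarticInvariant_ne_zero hI
      (hasSingularBaseLocus_of_family3 hfam), ⟨hsf, hsf.not_isReducibleQuadric⟩,
      ⟨hsg, hsg.not_isReducibleQuadric⟩, isTwistedCubicWithBisecant_cubic.of_projEquiv heq, ?_⟩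
    obtain ⟨A, hA⟩ := heq
    refine ⟨A, family3_of_mem_span ?_ ?_, ?_⟩
    · rw [← hA]
      exact Submodule.subset_span (by simp)
    · rw [← hA]
      exact Submodule.subset_span (by simp)
    · have h1 : (![0, 1, 0, 0] : Vec) = e 1 := by ext i; fin_cases i <;> simp [e]
      rw [e_zero_eq, h1]
      exact singularExactlyA1At_cubic.of_span_eq hA.symm

end QuadricPencil

theorem mainTheorem10 :
    -- non-stable, singular base locus, and belonging to the four families are equivalent
    (∀ f g : Quadric, IsPencil f g →
      List.TFAE [¬ IsStable f g,
        HasSingularBaseLocus f g,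
        GeneratedBy Family1 f g ∨ GeneratedBy Family2 f g ∨
          GeneratedBy Family3 f g ∨ GeneratedBy Family4 f g]) ∧
    -- the general member of Family 1
    HoldsForGeneralMember Family1 (fun f g =>
      IsStrictlySemistable f g ∧
      (IsSmoothQuadric f ∧ ¬ IsReducibleQuadric f) ∧
      (¬ IsSmoothQuadric g ∧ ¬ IsReducibleQuadric g) ∧
      IsNodalCurveAt f g ![1, 0, 0, 0]) ∧
    -- the general member of Family 2
    HoldsForGeneralMember Family2 (fun f g =>
      IsStrictlySemistable f g ∧
      (IsSmoothQuadric f ∧ ¬ IsReducibleQuadric f) ∧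
      IsPairOfConics f g ∧
      ∃ A : SL(4, ℂ), Family2 (act A f) (act A g) ∧
        SingularExactlyA1At (act A f) (act A g)
          {![1, Complex.I, 0, 0], ![1, -Complex.I, 0, 0]}) ∧
    -- the general member of Family 3
    HoldsForGeneralMember Family3 (fun f g =>
      IsStrictlySemistable f g ∧
      (IsSmoothQuadric f ∧ ¬ IsReducibleQuadric f) ∧
      (IsSmoothQuadric g ∧ ¬ IsReducibleQuadric g) ∧
      IsTwistedCubicWithBisecant f g ∧
      ∃ A : SL(4, ℂ), Family3 (act A f) (act A g) ∧
        SingularExactlyA1At (act A f) (act A g) {![1, 0, 0, 0], ![0, 1, 0, 0]}) ∧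
    -- the general member of Family 4
    HoldsForGeneralMember Family4 (fun f g =>
      IsStrictlySemistable f g ∧
      (IsSmoothQuadric f ∧ ¬ IsReducibleQuadric f) ∧
      (IsSmoothQuadric g ∧ ¬ IsReducibleQuadric g) ∧
      IsNodalCurveAt f g ![1, 0, 0, 0]) ∧
    -- Families 1 and 4 are projectively equivalent
    (∀ f g : Quadric, IsPencil f g → (GeneratedBy Family1 f g ↔ GeneratedBy Family4 f g)) ∧
    -- stable pencils are the smooth ones
    (∀ f g : Quadric, IsPencil f g → (IsStable f g ↔ HasSmoothBaseLocus f g)) ∧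
    -- the strictly polystable pencils
    (∀ f g : Quadric, IsPencil f g →
      (IsStrictlyPolystable f g ↔ GeneratedBy PolystableFamily f g)) ∧
    (∀ f g f' g' : Quadric, IsStrictlyPolystable f g → IsStrictlyPolystable f' g' →
      ProjEquiv f g f' g') ∧
    (∀ f g : Quadric, PolystableFamily f g →
      (IsReducibleQuadric f ∧ ¬ IsSmoothQuadric f) ∧
      (IsReducibleQuadric g ∧ ¬ IsSmoothQuadric g)) ∧
    (∀ f g : Quadric, IsStrictlyPolystable f g →
      ∃ b : Fin 4 → Vec, IsQuadrangle (baseLocus f g) b ∧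
        SingularExactlyA1At f g (Set.range b)) := by
  refine ⟨fun f g _ => tfae_not_isStable f g, holdsForGeneralMember_family1,
    holdsForGeneralMember_family2, holdsForGeneralMember_family3, holdsForGeneralMember_family4,
    fun f g _ => (generatedBy_family1_iff f g).trans (generatedBy_family4_iff f g).symm,
    fun f g _ => ?_,
    fun f g _ => isStrictlyPolystable_iff.trans generatedBy_polystableFamily_iff.symm,
    fun f g f' g' h h' => (isStrictlyPolystable_iff.1 h).trans (isStrictlyPolystable_iff.1 h').symm,
    fun f g h => h.reducible_singular,
    fun f g h => exists_quadrangle_of_projEquiv (isStrictlyPolystable_iff.1 h)⟩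
  rw [HasSmoothBaseLocus, ← not_isStable_iff_hasSingularBaseLocus, not_not]
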